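/- **Setting.** Let $n,d\ge 1$. An $n$-tuple of Hermitian $d\times d$ matrices $Z=(Z^{(1)},\dots,Z^{(n)})$ is described by its $N=nd^2$ real coordinates $\mathrm{Re}\,Z^{(p)}_{ij}$ $(i\le j)$ and $\mathrm{Im}\,Z^{(p)}_{ij}$ $(i<j)$; the Lebesgue measure $dZ$ refers to these coordinates. Put $Z^{(n+1)}=\mathrm{Id}-\sum_{p=1}^n Z^{(p)}$ and $$\Delta_{n,d}=\{Z:\ Z^{(1)},\dots,Z^{(n+1)}\ \text{are positive semidefinite}\}.$$ For $a=(a_1,\dots,a_{n+1})$ with all $a_r>0$, let $D_a$ be the measure on $\Delta_{n,d}$ with density $C\prod_{r=1}^{n+1}\det(Z^{(r)})^{a_r-1}$ with respect to $dZ$, where $C^{-1}$ is the total mass of the unnormalized density. Let $\Omega\subset\mathbb R^N$ be open, let $\Gamma=(g^{ij})$ be a co-metric with smooth coefficients on $\Omega$, written $\Gamma(f,h)=\sum_{ij} g^{ij}\,\partial_i f\,\partial_j h$ (and extended $\mathbb C$-bilinearly to complex functions), and let $\mu$ be a measure. A *generator* of $(\Omega,\Gamma,\mu)$ is an operator $L=\sum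 g^{ij}\partial^2_{ij}+\sum b^i\partial_i$ with $b^i$ smooth on $\Omega$ such that $\int f\,L h\,d\mu=\int h\,L f\,d\mu$ for all smooth $f,h$ compactly supported in $\Omega$. The triple $(\Omega,\Gamma,\mu)$ is a *polynomial model* if - $\Omega$ is a bounded connected non-empty open set with piecewise $C^1$ boundary (off a closed subset of $\partial\Omega$ of zero $(N-1)$-dimensional Hausdorff measure, $\Omega$ is locally $\{\varphi>0\}$ near the boundary point, with $\varphi$ of class $C^1$ and $d\varphi\ne0$ at that point); - $(g^{ij})$ is symmetric and positive definite at each point of $\Omega$; - $\mu$ is a probability measure with a smooth positive density on $\Omega$; - there is a generator $L$ of $(\Omega,\Gamma,\mu)$ which is also symmetric for $\mu$ on polynomials and such that, for each $k$, the space of real polynomials of total degree at most $k$ has an $L^2(\mu)$-orthonormal basis of eigenvectors of $L$. **Theorem.** Let $A$ be a positive-definite Hermitian $d\times d$ matrix, $B=(B_{ij,kl})$ a positive-definite Hermitian $d^2\times d^2$ matrix, and $a_1,\dots,a_{n+1}>0$. For $1\le p,q\le n$ and $1\le i,j,k,l\le d$ let $$\begin{aligned}G^{p,q}_{ij,kl}(Z)={}&\delta_{pq}\big(A_{il}Z^{(p)}_{kj}+A_{kj}Z^{(p)}_{il}\big)-A_{kj}(Z^{(p)}Z^{(q)})_{il}-A_{il}(Z^{(q)}Z^{(p)})_{kj}\\&+\sum_{a,b}\big(B_{ia,lb}Z^{(p)}_{aj}Z^{(q)}_{kb}+B_{aj,bk}Z^{(p)}_{ia}Z^{(q)}_{bl}-B_{aj,lb}Z^{(p)}_{ia}Z^{(q)}_{kb}-B_{ia,bk}Z^{(p)}_{aj}Z^{(q)}_{bl}\big),\end{aligned}$$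 and assume that this expression is symmetric, as a co-metric must be: $G^{p,q}_{ij,kl}(Z)=G^{q,p}_{kl,ij}(Z)$ for all tuples $Z$ of Hermitian matrices and all indices. Then: 1. The formula $\Gamma_{A,B}(Z^{(p)}_{ij},Z^{(q)}_{kl})=G^{p,q}_{ij,kl}(Z)$ defines a co-metric $\Gamma_{A,B}$ with real coefficients in the real coordinates (obtained by writing these as $\tfrac12(Z_{ij}+Z_{ji})$ and $\tfrac1{2\mathrm i}(Z_{ij}-Z_{ji})$). Moreover $$\Gamma_{A,B}(Z^{(p)}_{ij},Z^{(q)}_{kl})=\sum_{r,s=1}^{n+1}\ \sum_{a,b,c,e=1}^{d}T^{ab,ce}_{r,s}\,Z^{(r)}_{ab}Z^{(s)}_{ce},$$ where $$\begin{aligned}T^{ab,ce}_{r,s}={}&\delta_{pq}\delta_{pr}\big(A_{ic}\,\delta_{ak}\delta_{bj}\delta_{el}+A_{kc}\,\delta_{ai}\delta_{bl}\delta_{ej}\big)-\delta_{pr}\delta_{qs}\big(A_{kj}\delta_{ai}\delta_{bc}\delta_{el}+A_{il}\delta_{ck}\delta_{ae}\delta_{bj}\big)\\&+\delta_{pr}\delta_{qs}\big(B_{ia,le}\delta_{bj}\delta_{ck}+B_{bj,ck}\delta_{ai}\delta_{el}-B_{bj,le}\delta_{ai}\delta_{ck}-B_{ia,ck}\delta_{bj}\delta_{el}\big).\end{aligned}$$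 2. $\Gamma_{A,B}$ is elliptic (positive definite) at each interior point of $\Delta_{n,d}$. 3. $(\Delta_{n,d},\Gamma_{A,B},D_a)$, with $\Omega$ the interior of $\Delta_{n,d}$, is a polynomial model. 4. Every generator $L=L_{A,B,a}$ of $(\Delta_{n,d},\Gamma_{A,B},D_a)$ satisfies, in the interior of $\Delta_{n,d}$, for all $1\le p\le n$ and $1\le i,j\le d$, $$\begin{aligned}L_{A,B,a}(Z^{(p)}_{ij})={}&2(a_p-1+d)A_{ij}-\sum_{q=1}^n(a_q-1+d)\big((AZ^{(p)})_{ij}+(Z^{(p)}A)_{ij}\big)\\&-(a_{n+1}-1)\big((AZ^{(p)})_{ij}+(Z^{(p)}A)_{ij}\big)-2A_{ij}\,\mathrm{trace}(Z^{(p)})\\&+\sum_{a,b}\big(B_{ia,jb}Z^{(p)}_{ab}+B_{bj,ai}Z^{(p)}_{ab}-B_{ia,ba}Z^{(p)}_{bj}-B_{bj,ba}Z^{(p)}_{ia}\big).\end{aligned}$$ -/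

import Mathlib

open scoped ContDiff ComplexOrder Topology
open MeasureTheory

noncomputable section

/-! ### Diffusion operators and polynomial models on open subsets of `ℝ^ι` -/

section PolynomialModels

variable {ι : Type*} [Fintype ι] [DecidableEq ι]

/-- The partial derivative `∂_i f`. -/
def pd {V : Type*} [NormedAddCommGroup V] [NormedSpace ℝ V] (i : ι) (f : (ι → ℝ) → V) :
    (ι → ℝ) → V :=
  fun x => fderiv ℝ f x (Pi.single i 1)

/-- The operator `L f = ∑ g^{ij} ∂²_{ij} f + ∑ b^i ∂_i f`, acting on functions with values in a
real vector space (in practice `ℝ` or `ℂ`). -/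
def diffusionOp {V : Type*} [NormedAddCommGroup V] [NormedSpace ℝ V]
    (g : (ι → ℝ) → Matrix ι ι ℝ) (b : (ι → ℝ) → ι → ℝ) (f : (ι → ℝ) → V) : (ι → ℝ) → V :=
  fun x => ∑ i, ∑ j, g x i j • pd i (pd j f) x + ∑ i, b x i • pd i f x

/-- The carré du champ `Γ(f, h) = ∑ g^{ij} ∂_i f ∂_j h`, extended `ℂ`-bilinearly to complex-valued
functions. -/
def carreDuChamp (g : (ι → ℝ) → Matrix ι ι ℝ) (f h : (ι → ℝ) → ℂ) : (ι → ℝ) → ℂ :=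
  fun x => ∑ i, ∑ j, g x i j • (pd i f x * pd j h x)

/-- `Ω` has a piecewise `C¹` boundary: outside a closed subset of the boundary which is negligible
for the hypersurface measure (the Hausdorff measure of codimension one), the boundary is locally
a `C¹` hypersurface, with `Ω` on exactly one side of it. -/
def HasPiecewiseC1Boundary (Ω : Set (ι → ℝ)) : Prop :=
  ∃ S : Set (ι → ℝ), S ⊆ frontier Ω ∧ IsClosed S ∧
    Measure.hausdorffMeasure ((Fintype.card ι : ℝ) - 1) S = 0 ∧
    ∀ x ∈ frontier Ω \ S, ∃ U : Set (ι → ℝ), IsOpen U ∧ x ∈ U ∧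
      ∃ φ : (ι → ℝ) → ℝ, ContDiffOn ℝ 1 φ U ∧ fderiv ℝ φ x ≠ 0 ∧
        ∀ y ∈ U, y ∈ Ω ↔ 0 < φ y

/-- `L = ∑ g^{ij} ∂²_{ij} + ∑ b^i ∂_i` is the generator attached to `(Ω, Γ, μ)`: its drift is smooth
on `Ω`, and it is symmetric for `μ` on the smooth functions with compact support in `Ω`. -/
structure IsGenerator (Ω : Set (ι → ℝ)) (g : (ι → ℝ) → Matrix ι ι ℝ) (μ : Measure (ι → ℝ))
    (b : (ι → ℝ) → ι → ℝ) : Prop where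
  smooth_drift : ContDiffOn ℝ ∞ b Ω
  symm : ∀ f h : (ι → ℝ) → ℝ, ContDiff ℝ ∞ f → ContDiff ℝ ∞ h →
    HasCompactSupport f → HasCompactSupport h → tsupport f ⊆ Ω → tsupport h ⊆ Ω →
    ∫ x, f x * diffusionOp g b h x ∂μ = ∫ x, h x * diffusionOp g b f x ∂μ

/-- `(Ω, Γ, μ)` is a (bounded, elliptic) polynomial model; `Γ` is given by its matrix `g`. -/
structure IsPolynomialModel (Ω : Set (ι → ℝ)) (g : (ι → ℝ) → Matrix ι ι ℝ)
    (μ : Measure (ι → ℝ)) : Prop where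
  isOpen : IsOpen Ω
  isConnected : IsConnected Ω
  isBounded : Bornology.IsBounded Ω
  boundary : HasPiecewiseC1Boundary Ω
  smooth_cometric : ∀ i j, ContDiffOn ℝ ∞ (fun x => g x i j) Ω
  /-- ellipticity (`Matrix.PosDef` contains the symmetry of `g x`) -/
  elliptic : ∀ x ∈ Ω, (g x).PosDef
  isProbabilityMeasure : IsProbabilityMeasure μ
  /-- `μ` has a smooth positive density on `Ω` with respect to the Lebesgue measure -/
  density : ∃ ρ : (ι → ℝ) → ℝ, ContDiffOn ℝ ∞ ρ Ω ∧ (∀ x ∈ Ω, 0 < ρ x) ∧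
    μ = (volume.restrict Ω).withDensity (fun x => ENNReal.ofReal (ρ x))
  /-- the operator `L` attached to `Γ` and `μ` is symmetric on polynomials, and for each `k` the
  space of polynomials of total degree at most `k` has an `L²(μ)`-orthonormal basis made of
  eigenvectors of `L` -/
  diagonalizable : ∃ b : (ι → ℝ) → ι → ℝ, IsGenerator Ω g μ b ∧
    (∀ P Q : MvPolynomial ι ℝ,
      ∫ x, P.eval x * diffusionOp g b (fun y => Q.eval y) x ∂μ
        = ∫ x, Q.eval x * diffusionOp g b (fun y => P.eval y) x ∂μ) ∧
    ∀ k : ℕ, ∃ (m : ℕ) (e : Module.Basis (Fin m) ℝ (MvPolynomial.restrictTotalDegree ι ℝ k))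
      (c : Fin m → ℝ),
      (∀ r s, ∫ x, (e r : MvPolynomial ι ℝ).eval x * (e s : MvPolynomial ι ℝ).eval x ∂μ
        = if r = s then 1 else 0) ∧
      ∀ r, ∀ x ∈ Ω, diffusionOp g b (fun y => (e r : MvPolynomial ι ℝ).eval y) x
        = c r * (e r : MvPolynomial ι ℝ).eval x

end PolynomialModels

/-! ### The complex matrix simplex and the matrix Dirichlet measure -/

/-- Indices `(p, i, j)` of the entries of an `n`-tuple of `d × d` matrices. The same set indexes
the real coordinates of an `n`-tuple of Hermitian matrices: for `i ≤ j` the coordinate `(p, i, j)`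
is `Re Z^{(p)}_{ij}`, and for `j < i` it is `Im Z^{(p)}_{ji}`. -/
abbrev Idx (n d : ℕ) : Type := Fin n × Fin d × Fin d

/-- The Hermitian matrix `Z^{(p)}`, `1 ≤ p ≤ n`, with real coordinates `x`. -/
def Zmat {n d : ℕ} (x : Idx n d → ℝ) (p : Fin n) : Matrix (Fin d) (Fin d) ℂ :=
  Matrix.of fun i j =>
    if i = j then (x (p, i, i) : ℂ)
    else if i < j then (x (p, i, j) : ℂ) + Complex.I * (x (p, j, i) : ℂ)
    else (x (p, j, i) : ℂ) - Complex.I * (x (p, i, j) : ℂ)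

/-- The matrices `Z^{(1)}, …, Z^{(n)}` and `Z^{(n+1)} = Id - ∑ Z^{(p)}`. -/
def Zfull {n d : ℕ} (x : Idx n d → ℝ) (r : Fin (n + 1)) : Matrix (Fin d) (Fin d) ℂ :=
  Fin.lastCases (motive := fun _ => Matrix (Fin d) (Fin d) ℂ) (1 - ∑ p, Zmat x p)
    (fun p => Zmat x p) r

/-- The matrix simplex `Δ_{n,d}`. -/
def matrixSimplex (n d : ℕ) : Set (Idx n d → ℝ) :=
  {x | (∀ p, (Zmat x p).PosSemidef) ∧ (1 - ∑ p, Zmat x p).PosSemidef}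

/-- The unnormalized density `∏_{r ≤ n+1} det(Z^{(r)})^{a_r - 1}`. -/
def dirichletWeight {n d : ℕ} (a : Fin (n + 1) → ℝ) (x : Idx n d → ℝ) : ℝ :=
  ∏ r, (Zfull x r).det.re ^ (a r - 1)

/-- The matrix Dirichlet measure `D_a` on `Δ_{n,d}`, divided by its total mass. -/
def dirichletMeasure (n d : ℕ) (a : Fin (n + 1) → ℝ) : Measure (Idx n d → ℝ) :=
  (∫⁻ x in matrixSimplex n d, ENNReal.ofReal (dirichletWeight a x))⁻¹ •
    (volume.restrict (matrixSimplex n d)).withDensity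
      (fun x => ENNReal.ofReal (dirichletWeight a x))

/-! ### The second model -/

/-- The expression of `Γ_{A,B}(Z^{(p)}_{ij}, Z^{(q)}_{kl})` in terms of the matrices `Z^{(p)}`. -/
def gammaAB {n d : ℕ} (A : Matrix (Fin d) (Fin d) ℂ) (B : Matrix (Fin d × Fin d) (Fin d × Fin d) ℂ)
    (Z : Fin n → Matrix (Fin d) (Fin d) ℂ) : Idx n d → Idx n d → ℂ
  | (p, i, j), (q, k, l) =>
    (if p = q then A i l * Z p k j + A k j * Z p i l else 0)
      - A k j * (Z p * Z q) i l - A i l * (Z q * Z p) k j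
      + ∑ a, ∑ b, (B (i, a) (l, b) * Z p a j * Z q k b + B (a, j) (b, k) * Z p i a * Z q b l
          - B (a, j) (l, b) * Z p i a * Z q k b - B (i, a) (b, k) * Z p a j * Z q b l)

/-- The coefficients of `Γ_{A,B}(Z^{(p)}_{ij}, Z^{(q)}_{kl})` as a quadratic form
`∑ T Z^{(r)}_{ab} Z^{(s)}_{cd}` in the entries of `Z^{(1)}, …, Z^{(n+1)}`
(here `e` stands for the index `d`). -/
def tensorAB {n d : ℕ} (A : Matrix (Fin d) (Fin d) ℂ)
    (B : Matrix (Fin d × Fin d) (Fin d × Fin d) ℂ) (p q : Fin n) (i j k l : Fin d)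
    (r s : Fin (n + 1)) (a b c e : Fin d) : ℂ :=
  let δ : Fin d → Fin d → ℂ := fun u v => if u = v then 1 else 0
  (if p = q ∧ p.castSucc = r then
      A i c * δ a k * δ b j * δ e l + A k c * δ a i * δ b l * δ e j else 0)
  + (if p.castSucc = r ∧ q.castSucc = s then
      - (A k j * δ a i * δ b c * δ e l + A i l * δ c k * δ a e * δ b j)
      + (B (i, a) (l, e) * δ b j * δ c k + B (b, j) (c, k) * δ a i * δ e l
        - B (b, j) (l, e) * δ a i * δ c k - B (i, a) (c, k) * δ b j * δ e l) else 0)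

/-- Passage from the entries `Z^{(p)}_{ij}` to the real coordinates: if `u (p, i, j)` is the value
of a `ℂ`-linear map at `Z^{(p)}_{ij}`, then `toRealCoord u (p, i, j)` is its value at the coordinate
`(p, i, j)`, i.e. at `Re Z_{ij} = (Z_{ij} + Z_{ji}) / 2` for `i ≤ j` and at
`Im Z_{ji} = (Z_{ji} - Z_{ij}) / 2i` for `j < i`. -/
def toRealCoord {n d : ℕ} (u : Idx n d → ℂ) : Idx n d → ℂ
  | (p, i, j) =>
    if i ≤ j then (u (p, i, j) + u (p, j, i)) / 2
    else (u (p, j, i) - u (p, i, j)) / (2 * Complex.I)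

/-- The matrix of the co-metric `Γ_{A,B}` in the real coordinates. -/
def cometricAB {n d : ℕ} (A : Matrix (Fin d) (Fin d) ℂ)
    (B : Matrix (Fin d × Fin d) (Fin d × Fin d) ℂ) (x : Idx n d → ℝ) :
    Matrix (Idx n d) (Idx n d) ℝ :=
  Matrix.of fun α β =>
    (toRealCoord (fun α' => toRealCoord (fun β' => gammaAB A B (Zmat x) α' β') β) α).re

/-- The expression of `L_{A,B,a}(Z^{(p)}_{ij})` in terms of the matrices `Z^{(p)}`. -/
def generatorAB {n d : ℕ} (A : Matrix (Fin d) (Fin d) ℂ)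
    (B : Matrix (Fin d × Fin d) (Fin d × Fin d) ℂ) (a : Fin (n + 1) → ℝ)
    (Z : Fin n → Matrix (Fin d) (Fin d) ℂ) (p : Fin n) (i j : Fin d) : ℂ :=
  2 * ((a p.castSucc : ℂ) - 1 + d) * A i j
    - ∑ q : Fin n, ((a q.castSucc : ℂ) - 1 + d) * ((A * Z p) i j + (Z p * A) i j)
    - ((a (Fin.last n) : ℂ) - 1) * ((A * Z p) i j + (Z p * A) i j)
    - 2 * A i j * (Z p).trace
    + ∑ u, ∑ v, (B (i, u) (j, v) * Z p u v + B (v, j) (u, i) * Z p u v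
        - B (i, u) (v, u) * Z p v j - B (v, j) (v, u) * Z p i u)

end

/-!
The co-metric is studied in the `ℂ`-linear coordinates `Z^{(p)}_{ij}`, which are complex linear
combinations of the real coordinates; `entryCoeff` and `realCoeff` are the two inverse matrices of
this change of coordinates, and `wirtinger` denotes the derivations dual to the entries.

*Ellipticity* (`posDef_cometricAB`). A real covector is a tuple `H` of Hermitian matrices. With
`M = ∑ H^{(p)} Z^{(p)}` and `H^{(n+1)} = 0`, completing the square writes the quadratic form of
`Γ_{A,B}` as `2 tr A (∑_{r ≤ n+1} (H^{(r)} - M) Z^{(r)} (H^{(r)} - M)^*)` plus the value of the form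
`B` at `∑ [Z^{(p)}, H^{(p)}]`. Both terms are nonnegative, and the first one vanishes only for `H = 0`
when all `Z^{(r)}` are positive definite.

*Finite mass* (`lintegral_dirichletWeight_lt_top`). On tuples of `n + 1` independent Hermitian
matrices in a box, the weight `∏ det^{a_r - 1}` is integrated one diagonal entry at a time: each
leading minor is affine in its last diagonal entry, with slope the preceding minor. Fubini gives a
positive definite `S` for which the integral over the tuples of sum `S` is finite, and the congruence
by a matrix `C` with `C C^* = S` carries it to the simplex, where the sum is the identity.

*Boundary* (`hasPiecewiseC1Boundary_matrixSimplex`). Where exactly one `Z^{(r)}` is singular, with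
corank one, the boundary is the zero set of `det Z^{(r)}`, whose differential does not vanish there.
All other boundary points have total corank at least two. Solving the kernel equations expresses two
real diagonal coordinates in terms of the others, so that these points lie in finitely many images of
`C¹` maps depending on `N - 2` variables, and are negligible for the `(N - 1)`-dimensional Hausdorff
measure.

*Symmetry* (`integral_mul_diffusionOp_driftAB_comm`). The boundary equation
`Γ(Z^{(p)}_{ij}, det Z^{(r)}) = det Z^{(r)} (2 δ_{pr} A - A Z^{(p)} - Z^{(p)} A)_{ij}`
(`sum_gammaAB_mul_wirtinger_det`) has no contribution of `B`, which enters through commutators only.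
It gives `Γ(·, log ρ)` for the Dirichlet density `ρ`, and adding the divergence of the co-metric gives
`generatorAB` (`sum_wirtinger_gammaAB_add`, `driftAB_eq`). It also shows that `Γ(·, D)` is divisible
by `D = ∏ det Z^{(r)}`. Integrating by parts against the cutoff `χ(D / ε)` therefore leaves a boundary
term bounded by `ρ |t χ'(t)|` at `t = D / ε`, which tends to zero by dominated convergence
(`integral_mul_diffusionOp_sub_eq_zero`). No condition on the exponents other than the integrability
of `ρ` is needed, and the test functions need not vanish at the boundary.

*Diagonalization* (`exists_eigenbasis`). The second order coefficients are polynomials of degree at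
most two and the drift is of degree at most one, so that the operator preserves the polynomials of
degree at most `k`; there it is symmetric for `L²(μ)`, and the finite-dimensional spectral theorem
applies.

*Uniqueness* (`eq_of_isGenerator`). The difference of two generators of the same triple is a vector
field which is symmetric on test functions, and such a field is zero. Hence every generator has the
drift found above.
-/

noncomputable section

/-! ### Real coordinates and entries of Hermitian tuples -/

section Coordinates

variable {n d : ℕ}

/-- The inverse of `toRealCoord`: the entries of a tuple with (complexified) real coordinates `u`. -/
def toEntries (u : Idx n d → ℂ) : Idx n d → ℂ
  | (p, i, j) =>
    if i = j then u (p, i, i)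
    else if i < j then u (p, i, j) + Complex.I * u (p, j, i)
    else u (p, j, i) - Complex.I * u (p, i, j)

/-- The index of the transposed entry. -/
def swapIdx (α : Idx n d) : Idx n d := (α.1, α.2.2, α.2.1)

@[simp] lemma swapIdx_swapIdx (α : Idx n d) : swapIdx (swapIdx α) = α := rfl

@[simp] lemma swapIdx_mk (p : Fin n) (i j : Fin d) : swapIdx (p, i, j) = (p, j, i) := rfl

/-- The entry `Z^{(p)}_{ij}` as a function of the real coordinates. -/
def entry (γ : Idx n d) (x : Idx n d → ℝ) : ℂ := Zmat x γ.1 γ.2.1 γ.2.2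

lemma entry_eq_toEntries (γ : Idx n d) (x : Idx n d → ℝ) :
    entry γ x = toEntries (fun α => (x α : ℂ)) γ := rfl

lemma toEntries_toRealCoord (u : Idx n d → ℂ) : toEntries (toRealCoord u) = u := by
  funext ⟨p, i, j⟩
  rcases lt_trichotomy i j with h | rfl | h
  · simp only [toEntries, toRealCoord, h.ne, h, h.le, h.not_ge, if_true, if_false]
    field_simp
    ring
  · simp [toEntries, toRealCoord]
  · simp only [toEntries, toRealCoord, h.ne', h.not_gt, h.le, h.not_ge, if_true, if_false]
    field_simp
    ring

lemma toRealCoord_toEntries (u : Idx n d → ℂ) : toRealCoord (toEntries u) = u := by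
  funext ⟨p, i, j⟩
  rcases lt_trichotomy i j with h | rfl | h
  · simp only [toEntries, toRealCoord, h.ne, h.ne', h, h.not_gt, h.le, if_true, if_false]
    ring
  · simp [toEntries, toRealCoord]
  · simp only [toEntries, toRealCoord, h.ne, h.ne', h, h.not_gt, h.not_ge, if_true, if_false]
    field_simp
    ring

/-- `toRealCoord` as a linear map. -/
def toRealCoordₗ : (Idx n d → ℂ) →ₗ[ℂ] (Idx n d → ℂ) where
  toFun := toRealCoord
  map_add' u v := by
    funext ⟨p, i, j⟩
    by_cases h : i ≤ j <;> simp [toRealCoord, h] <;> ring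
  map_smul' c u := by
    funext ⟨p, i, j⟩
    by_cases h : i ≤ j <;> simp [toRealCoord, h] <;> ring

/-- `toEntries` as a linear map. -/
def toEntriesₗ : (Idx n d → ℂ) →ₗ[ℂ] (Idx n d → ℂ) where
  toFun := toEntries
  map_add' u v := by
    funext ⟨p, i, j⟩
    by_cases h : i = j <;> by_cases h' : i < j <;> simp [toEntries, h, h'] <;> ring
  map_smul' c u := by
    funext ⟨p, i, j⟩
    by_cases h : i = j <;> by_cases h' : i < j <;> simp [toEntries, h, h'] <;> ring

/-- The matrix of `toRealCoord`. -/
def realCoeff (α β : Idx n d) : ℂ := toRealCoord (Pi.single β 1) α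

/-- The matrix of `toEntries`. -/
def entryCoeff (γ α : Idx n d) : ℂ := toEntries (Pi.single α 1) γ

lemma toRealCoord_apply (u : Idx n d → ℂ) (α : Idx n d) :
    toRealCoord u α = ∑ β, realCoeff α β * u β := by
  have h := congrFun (LinearMap.pi_apply_eq_sum_univ (toRealCoordₗ (n := n) (d := d)) u) α
  simp only [Finset.sum_apply, Pi.smul_apply, smul_eq_mul] at h
  change toRealCoord u α = _ at h
  rw [h]
  refine Finset.sum_congr rfl fun β _ => ?_
  rw [mul_comm, realCoeff]
  congr 1
  change toRealCoord (fun j => if β = j then 1 else 0) α = _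
  congr 1
  funext ε
  simp [Pi.single_apply, eq_comm]

lemma toEntries_apply (u : Idx n d → ℂ) (γ : Idx n d) :
    toEntries u γ = ∑ α, entryCoeff γ α * u α := by
  have h := congrFun (LinearMap.pi_apply_eq_sum_univ (toEntriesₗ (n := n) (d := d)) u) γ
  simp only [Finset.sum_apply, Pi.smul_apply, smul_eq_mul] at h
  change toEntries u γ = _ at h
  rw [h]
  refine Finset.sum_congr rfl fun β _ => ?_
  rw [mul_comm, entryCoeff]
  congr 1
  change toEntries (fun j => if β = j then 1 else 0) γ = _
  congr 1
  funext ε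
  simp [Pi.single_apply, eq_comm]

lemma sum_entryCoeff_realCoeff (γ β : Idx n d) :
    ∑ α, entryCoeff γ α * realCoeff α β = if γ = β then 1 else 0 := by
  rw [← toEntries_apply (fun α => realCoeff α β) γ]
  change toEntries (toRealCoord (Pi.single β 1)) γ = _
  rw [toEntries_toRealCoord, Pi.single_apply]

lemma sum_realCoeff_entryCoeff (α β : Idx n d) :
    ∑ γ, realCoeff α γ * entryCoeff γ β = if α = β then 1 else 0 := by
  rw [← toRealCoord_apply (fun γ => entryCoeff γ β) α]
  change toRealCoord (toEntries (Pi.single β 1)) α = _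
  rw [toRealCoord_toEntries, Pi.single_apply]

lemma conj_toRealCoord (u : Idx n d → ℂ) (α : Idx n d) :
    star (toRealCoord u α) = toRealCoord (fun β => star (u (swapIdx β))) α := by
  obtain ⟨p, i, j⟩ := α
  by_cases h : i ≤ j
  · simp [toRealCoord, h, add_comm]
  · simp only [toRealCoord, h, if_false, swapIdx_mk, Complex.star_def, map_div₀, map_sub, map_mul,
      Complex.conj_I, map_ofNat]
    field_simp
    ring

/-- `toRealCoord u` is real when `u` satisfies the Hermitian symmetry `u_{ji} = conj u_{ij}`. -/
lemma ofReal_re_toRealCoord {u : Idx n d → ℂ} (hu : ∀ β, star (u (swapIdx β)) = u β)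
    (α : Idx n d) : ((toRealCoord u α).re : ℂ) = toRealCoord u α := by
  rw [← Complex.conj_eq_iff_re]
  have := conj_toRealCoord u α
  rw [Complex.star_def] at this
  rw [this]
  congr 1
  funext β
  exact hu β

lemma star_realCoeff (α β : Idx n d) : star (realCoeff α β) = realCoeff α (swapIdx β) := by
  rw [realCoeff, conj_toRealCoord, realCoeff]
  congr 1
  funext γ
  by_cases h : γ = swapIdx β
  · subst h; simp
  · have : swapIdx γ ≠ β := fun h' => h (by rw [← h', swapIdx_swapIdx])
    simp [h, this]

lemma Zmat_isHermitian (x : Idx n d → ℝ) (p : Fin n) : (Zmat x p).IsHermitian := by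
  ext i j
  rcases lt_trichotomy i j with h | h | h
  · simp [Zmat, h.ne, h.ne', h, h.not_gt, Matrix.conjTranspose_apply, sub_eq_add_neg]
  · simp [Zmat, h, Matrix.conjTranspose_apply]
  · simp [Zmat, h.ne, h.ne', h, h.not_gt, Matrix.conjTranspose_apply, sub_eq_add_neg]

lemma star_Zmat (x : Idx n d → ℝ) (p : Fin n) (i j : Fin d) :
    star (Zmat x p i j) = Zmat x p j i := (Zmat_isHermitian x p).apply j i

lemma Zmat_add (x y : Idx n d → ℝ) (p : Fin n) : Zmat (x + y) p = Zmat x p + Zmat y p := by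
  ext i j
  by_cases h : i = j <;> by_cases h' : i < j <;> simp [Zmat, h, h'] <;> ring

lemma Zmat_smul (c : ℝ) (x : Idx n d → ℝ) (p : Fin n) : Zmat (c • x) p = (c : ℂ) • Zmat x p := by
  ext i j
  by_cases h : i = j <;> by_cases h' : i < j <;> simp [Zmat, h, h'] <;> ring

/-- The real coordinates of a tuple of (Hermitian) matrices. -/
def coordOf (M : Fin n → Matrix (Fin d) (Fin d) ℂ) : Idx n d → ℝ :=
  fun α => (toRealCoord (fun β => M β.1 β.2.1 β.2.2) α).re

lemma Zmat_coordOf {M : Fin n → Matrix (Fin d) (Fin d) ℂ} (hM : ∀ p, (M p).IsHermitian)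
    (p : Fin n) : Zmat (coordOf M) p = M p := by
  ext i j
  change entry (p, i, j) (coordOf M) = _
  rw [entry_eq_toEntries]
  have : (fun α => (coordOf M α : ℂ)) = toRealCoord (fun β => M β.1 β.2.1 β.2.2) := by
    funext α
    exact ofReal_re_toRealCoord (fun β => (hM β.1).apply β.2.1 β.2.2) α
  rw [this, toEntries_toRealCoord]

lemma coordOf_Zmat (x : Idx n d → ℝ) : coordOf (Zmat x) = x := by
  funext α
  change (toRealCoord (toEntries (fun α => (x α : ℂ))) α).re = x α
  rw [toRealCoord_toEntries, Complex.ofReal_re]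

lemma Zmat_injective : Function.Injective (Zmat (n := n) (d := d)) :=
  fun x y h => by rw [← coordOf_Zmat x, h, coordOf_Zmat]

/-- The entry `Z^{(p)}_{ij}` as a continuous linear form of the real coordinates. -/
def entryL (γ : Idx n d) : (Idx n d → ℝ) →L[ℝ] ℂ :=
  LinearMap.toContinuousLinearMap
    { toFun := entry γ
      map_add' := fun x y => by simp [entry, Zmat_add]
      map_smul' := fun c x => by simp [entry, Zmat_smul] }

@[simp] lemma entryL_apply (γ : Idx n d) (x : Idx n d → ℝ) : entryL γ x = entry γ x := rfl

lemma hasFDerivAt_entry (γ : Idx n d) (x : Idx n d → ℝ) : HasFDerivAt (entry γ) (entryL γ) x :=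
  (entryL γ).hasFDerivAt

lemma contDiff_entry (γ : Idx n d) {k : WithTop ℕ∞} : ContDiff ℝ k (entry γ) := (entryL γ).contDiff

lemma contDiff_Zmat (p : Fin n) (i j : Fin d) {k : WithTop ℕ∞} :
    ContDiff ℝ k (fun x : Idx n d → ℝ => Zmat x p i j) := contDiff_entry (p, i, j)

lemma entry_single (γ α : Idx n d) : entry γ (Pi.single α 1) = entryCoeff γ α := by
  rw [entry_eq_toEntries, entryCoeff]
  congr 1
  funext β
  by_cases h : β = α
  · subst h; simp
  · simp [h]

lemma pd_entry (γ α : Idx n d) (x : Idx n d → ℝ) : pd α (entry γ) x = entryCoeff γ α := by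
  rw [pd, (hasFDerivAt_entry γ x).fderiv, entryL_apply, entry_single]

end Coordinates

/-! ### Partial derivatives -/

section PartialDerivatives

set_option linter.unusedSectionVars false

variable {ι : Type*} [Fintype ι] [DecidableEq ι] {V : Type*} [NormedAddCommGroup V]
  [NormedSpace ℝ V]

lemma pd_const (i : ι) (c : V) (x : ι → ℝ) : pd i (fun _ => c) x = 0 := by simp [pd]

lemma pd_add {i : ι} {f h : (ι → ℝ) → V} {x : ι → ℝ} (hf : DifferentiableAt ℝ f x)
    (hh : DifferentiableAt ℝ h x) : pd i (fun y => f y + h y) x = pd i f x + pd i h x := by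
  rw [pd, fderiv_fun_add hf hh]; rfl

lemma pd_sub {i : ι} {f h : (ι → ℝ) → V} {x : ι → ℝ} (hf : DifferentiableAt ℝ f x)
    (hh : DifferentiableAt ℝ h x) : pd i (fun y => f y - h y) x = pd i f x - pd i h x := by
  rw [pd, fderiv_fun_sub hf hh]; rfl

lemma pd_sum {κ : Type*} (s : Finset κ) {i : ι} {f : κ → (ι → ℝ) → V} {x : ι → ℝ}
    (hf : ∀ k ∈ s, DifferentiableAt ℝ (f k) x) :
    pd i (fun y => ∑ k ∈ s, f k y) x = ∑ k ∈ s, pd i (f k) x := by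
  rw [pd, fderiv_fun_sum hf]
  simp [pd]

lemma pd_mul {𝔸 : Type*} [NormedCommRing 𝔸] [NormedAlgebra ℝ 𝔸] {i : ι} {f h : (ι → ℝ) → 𝔸}
    {x : ι → ℝ} (hf : DifferentiableAt ℝ f x) (hh : DifferentiableAt ℝ h x) :
    pd i (fun y => f y * h y) x = f x * pd i h x + h x * pd i f x := by
  rw [pd, fderiv_fun_mul hf hh]; rfl

lemma pd_congr {i : ι} {f h : (ι → ℝ) → V} {x : ι → ℝ} (hfh : f =ᶠ[𝓝 x] h) :
    pd i f x = pd i h x := by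
  rw [pd, hfh.fderiv_eq]; rfl

lemma pd_ofReal {i : ι} {f : (ι → ℝ) → ℝ} {x : ι → ℝ} (hf : DifferentiableAt ℝ f x) :
    pd i (fun y => (f y : ℂ)) x = ((pd i f x : ℝ) : ℂ) := by
  have h : HasFDerivAt (fun y => (f y : ℂ)) (Complex.ofRealCLM.comp (fderiv ℝ f x)) x :=
    Complex.ofRealCLM.hasFDerivAt.comp x hf.hasFDerivAt
  rw [pd, h.fderiv]; rfl

lemma contDiff_pd {f : (ι → ℝ) → V} (hf : ContDiff ℝ ∞ f) (i : ι) : ContDiff ℝ ∞ (pd i f) :=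
  (hf.fderiv_right (m := ∞) (by simp)).clm_apply contDiff_const

end PartialDerivatives

/-! ### Formal derivatives with respect to the entries -/

section Wirtinger

variable {n d : ℕ}

/-- The complex derivation `∂/∂Z^{(p)}_{ij}`, dual to the entries considered as `nd²` independent
complex linear coordinates. -/
def wirtinger (β : Idx n d) (f : (Idx n d → ℝ) → ℂ) (x : Idx n d → ℝ) : ℂ :=
  ∑ α, realCoeff α β * pd α f x

lemma wirtinger_entry (β γ : Idx n d) (x : Idx n d → ℝ) :
    wirtinger β (entry γ) x = if γ = β then 1 else 0 := by
  simp only [wirtinger, pd_entry, mul_comm (realCoeff _ _)]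
  exact sum_entryCoeff_realCoeff γ β

lemma wirtinger_const (β : Idx n d) (c : ℂ) (x : Idx n d → ℝ) :
    wirtinger β (fun _ => c) x = 0 := by
  simp [wirtinger, pd_const]

lemma wirtinger_add {β : Idx n d} {f h : (Idx n d → ℝ) → ℂ} {x : Idx n d → ℝ}
    (hf : DifferentiableAt ℝ f x) (hh : DifferentiableAt ℝ h x) :
    wirtinger β (fun y => f y + h y) x = wirtinger β f x + wirtinger β h x := by
  simp [wirtinger, pd_add hf hh, mul_add, Finset.sum_add_distrib]

lemma wirtinger_sub {β : Idx n d} {f h : (Idx n d → ℝ) → ℂ} {x : Idx n d → ℝ}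
    (hf : DifferentiableAt ℝ f x) (hh : DifferentiableAt ℝ h x) :
    wirtinger β (fun y => f y - h y) x = wirtinger β f x - wirtinger β h x := by
  simp [wirtinger, pd_sub hf hh, mul_sub, Finset.sum_sub_distrib]

lemma wirtinger_sum {κ : Type*} (s : Finset κ) {β : Idx n d} {f : κ → (Idx n d → ℝ) → ℂ}
    {x : Idx n d → ℝ} (hf : ∀ k ∈ s, DifferentiableAt ℝ (f k) x) :
    wirtinger β (fun y => ∑ k ∈ s, f k y) x = ∑ k ∈ s, wirtinger β (f k) x := by
  simp only [wirtinger, pd_sum s hf, Finset.mul_sum]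
  exact Finset.sum_comm

lemma wirtinger_mul {β : Idx n d} {f h : (Idx n d → ℝ) → ℂ} {x : Idx n d → ℝ}
    (hf : DifferentiableAt ℝ f x) (hh : DifferentiableAt ℝ h x) :
    wirtinger β (fun y => f y * h y) x = f x * wirtinger β h x + h x * wirtinger β f x := by
  simp only [wirtinger, pd_mul hf hh, mul_add, Finset.sum_add_distrib, Finset.mul_sum]
  congr 1 <;> exact Finset.sum_congr rfl fun _ _ => by ring

lemma wirtinger_const_mul {β : Idx n d} (c : ℂ) {f : (Idx n d → ℝ) → ℂ} {x : Idx n d → ℝ}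
    (hf : DifferentiableAt ℝ f x) :
    wirtinger β (fun y => c * f y) x = c * wirtinger β f x := by
  rw [wirtinger_mul (differentiableAt_const c) hf, wirtinger_const, mul_zero, add_zero]

end Wirtinger

/-! ### Algebra of the co-metric -/

section Cometric

variable {n d : ℕ} {A : Matrix (Fin d) (Fin d) ℂ} {B : Matrix (Fin d × Fin d) (Fin d × Fin d) ℂ}

/-- Conjugation turns `G^{p,q}_{ij,kl}` into `G^{q,p}_{lk,ji}`; together with the symmetry of the
co-metric this makes its coefficients in the real coordinates real. -/
lemma star_gammaAB_swap (hA : A.IsHermitian) (hB : B.IsHermitian) (x : Idx n d → ℝ)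
    (α β : Idx n d) :
    star (gammaAB A B (Zmat x) α β) = gammaAB A B (Zmat x) (swapIdx β) (swapIdx α) := by
  obtain ⟨p, i, j⟩ := α
  obtain ⟨q, k, l⟩ := β
  have hA' : ∀ u v, (starRingEnd ℂ) (A u v) = A v u := fun u v => hA.apply v u
  have hB' : ∀ u v, (starRingEnd ℂ) (B u v) = B v u := fun u v => hB.apply v u
  have hZ : ∀ r u v, (starRingEnd ℂ) (Zmat x r u v) = Zmat x r v u := fun r u v => star_Zmat x r u v
  simp only [gammaAB, swapIdx_mk, Matrix.mul_apply, Complex.star_def, map_add, map_sub, map_sum,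
    map_mul, apply_ite (starRingEnd ℂ), map_zero, hA', hB', hZ]
  congr 1
  · congr 1
    · congr 1
      · by_cases h : p = q
        · subst h; simp only [if_true]
        · simp only [h, Ne.symm h, if_false]
      · congr 1
        exact Finset.sum_congr rfl fun _ _ => mul_comm _ _
    · congr 1
      exact Finset.sum_congr rfl fun _ _ => mul_comm _ _
  · rw [Finset.sum_comm]
    exact Finset.sum_congr rfl fun _ _ => Finset.sum_congr rfl fun _ _ => by ring

/-- The symmetry of the expression together with `A` and `B` being Hermitian gives the Hermitian
symmetry of `Γ_{A,B}`, i.e. that `Γ_{A,B}` is a real co-metric. -/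
lemma star_gammaAB (hA : A.IsHermitian) (hB : B.IsHermitian)
    (hsymm : ∀ (x : Idx n d → ℝ) (α β : Idx n d),
      gammaAB A B (Zmat x) α β = gammaAB A B (Zmat x) β α) (x : Idx n d → ℝ) (α β : Idx n d) :
    star (gammaAB A B (Zmat x) (swapIdx α) (swapIdx β)) = gammaAB A B (Zmat x) α β := by
  rw [star_gammaAB_swap hA hB, hsymm]; rfl

lemma ofReal_cometricAB (hA : A.IsHermitian) (hB : B.IsHermitian)
    (hsymm : ∀ (x : Idx n d → ℝ) (α β : Idx n d),
      gammaAB A B (Zmat x) α β = gammaAB A B (Zmat x) β α) (x : Idx n d → ℝ) (α β : Idx n d) :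
    (cometricAB A B x α β : ℂ) =
      toRealCoord (fun α' => toRealCoord (fun β' => gammaAB A B (Zmat x) α' β') β) α := by
  refine ofReal_re_toRealCoord (fun γ => ?_) α
  rw [conj_toRealCoord]
  congr 1
  funext δ
  exact star_gammaAB hA hB hsymm x γ δ

/-- Going back from the real coordinates to the entries in the first argument of `Γ_{A,B}`. -/
lemma sum_entryCoeff_cometricAB (hA : A.IsHermitian) (hB : B.IsHermitian)
    (hsymm : ∀ (x : Idx n d → ℝ) (α β : Idx n d),
      gammaAB A B (Zmat x) α β = gammaAB A B (Zmat x) β α) (x : Idx n d → ℝ) (γ β : Idx n d) :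
    ∑ α, entryCoeff γ α * (cometricAB A B x α β : ℂ) =
      toRealCoord (fun β' => gammaAB A B (Zmat x) γ β') β := by
  simp only [ofReal_cometricAB hA hB hsymm]
  rw [← toEntries_apply, toEntries_toRealCoord]

lemma carreDuChamp_entry (hA : A.IsHermitian) (hB : B.IsHermitian)
    (hsymm : ∀ (x : Idx n d → ℝ) (α β : Idx n d),
      gammaAB A B (Zmat x) α β = gammaAB A B (Zmat x) β α) (x : Idx n d → ℝ) (γ δ : Idx n d) :
    carreDuChamp (cometricAB A B) (entry γ) (entry δ) x = gammaAB A B (Zmat x) γ δ := by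
  have h : ∀ α β, cometricAB A B x α β • (entryCoeff γ α * entryCoeff δ β)
      = entryCoeff δ β * (entryCoeff γ α * (cometricAB A B x α β : ℂ)) := fun α β => by
    rw [Complex.real_smul]; ring
  simp only [carreDuChamp, pd_entry, h]
  rw [Finset.sum_comm]
  simp only [← Finset.mul_sum, sum_entryCoeff_cometricAB hA hB hsymm]
  rw [← toEntries_apply, toEntries_toRealCoord]

lemma cometricAB_symm (hsymm : ∀ (x : Idx n d → ℝ) (α β : Idx n d),
      gammaAB A B (Zmat x) α β = gammaAB A B (Zmat x) β α) (x : Idx n d → ℝ) (α β : Idx n d) :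
    cometricAB A B x α β = cometricAB A B x β α := by
  simp only [cometricAB, Matrix.of_apply, toRealCoord_apply, Finset.mul_sum]
  rw [Finset.sum_comm]
  congr 1
  refine Finset.sum_congr rfl fun γ _ => Finset.sum_congr rfl fun δ _ => ?_
  rw [hsymm x]; ring

/-! ### The complemented tuple -/

@[simp] lemma Zfull_castSucc (x : Idx n d → ℝ) (p : Fin n) : Zfull x p.castSucc = Zmat x p := by
  simp [Zfull]

@[simp] lemma Zfull_last (x : Idx n d → ℝ) : Zfull x (Fin.last n) = 1 - ∑ p, Zmat x p := by
  simp [Zfull]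

lemma sum_Zfull (x : Idx n d → ℝ) : ∑ r, Zfull x r = 1 := by
  rw [Fin.sum_univ_castSucc]; simp

lemma Zfull_isHermitian (x : Idx n d → ℝ) (r : Fin (n + 1)) : (Zfull x r).IsHermitian := by
  refine Fin.lastCases ?_ (fun p => ?_) r
  · rw [Zfull_last]
    refine Matrix.IsHermitian.sub Matrix.isHermitian_one ?_
    exact isSelfAdjoint_sum _ fun p _ => Zmat_isHermitian x p
  · rw [Zfull_castSucc]; exact Zmat_isHermitian x p

lemma sum_pairs_sum_quadruples_comm {R D M : Type*} [Fintype R] [Fintype D] [AddCommMonoid M]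
    (F : R → R → D → D → D → D → M) :
    ∑ r, ∑ s, ∑ a, ∑ b, ∑ c, ∑ e, F r s a b c e = ∑ a, ∑ b, ∑ c, ∑ e, ∑ r, ∑ s, F r s a b c e := by
  have h : ∑ y : R × R, ∑ z : D × D × D × D, F y.1 y.2 z.1 z.2.1 z.2.2.1 z.2.2.2
      = ∑ z : D × D × D × D, ∑ y : R × R, F y.1 y.2 z.1 z.2.1 z.2.2.1 z.2.2.2 := Finset.sum_comm
  simpa only [Fintype.sum_prod_type] using h

lemma gammaAB_eq_tensorAB (x : Idx n d → ℝ) (p q : Fin n) (i j k l : Fin d) :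
    gammaAB A B (Zmat x) (p, i, j) (q, k, l)
      = ∑ r, ∑ s, ∑ a', ∑ b', ∑ c', ∑ d',
          tensorAB A B p q i j k l r s a' b' c' d' * Zfull x r a' b' * Zfull x s c' d' := by
  rw [sum_pairs_sum_quadruples_comm]
  have hsum : ∀ c e, ∑ s, Zfull x s c e = if c = e then 1 else 0 := fun c e => by
    rw [← Matrix.one_apply, ← sum_Zfull x, Matrix.sum_apply]
  have h1 : ∀ (P : Prop) [Decidable P] (u : ℂ) (a b c e : Fin d),
      ∑ r, ∑ s, (if P ∧ p.castSucc = r then u else 0) * Zfull x r a b * Zfull x s c e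
        = if P then u * Zmat x p a b * (if c = e then 1 else 0) else 0 := by
    intro P _ u a b c e
    by_cases hP : P
    · simp only [hP, true_and, if_true, ite_mul, zero_mul, Finset.sum_ite_irrel,
        Finset.sum_const_zero, Finset.sum_ite_eq, Finset.mem_univ]
      rw [← Finset.mul_sum, hsum, Zfull_castSucc]
    · simp [hP]
  have h2 : ∀ (u : ℂ) (a b c e : Fin d),
      ∑ r, ∑ s, (if p.castSucc = r ∧ q.castSucc = s then u else 0) * Zfull x r a b * Zfull x s c e
        = u * Zmat x p a b * Zmat x q c e := by
    intro u a b c e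
    rw [Finset.sum_eq_single p.castSucc, Finset.sum_eq_single q.castSucc]
    · simp
    · intro s _ hs; simp [Ne.symm hs]
    · simp
    · intro r _ hr; simp [Ne.symm hr]
    · simp
  have hT : ∀ a b c e, ∑ r, ∑ s, tensorAB A B p q i j k l r s a b c e * Zfull x r a b
        * Zfull x s c e = _ := fun a b c e => by
    simp only [tensorAB, add_mul _ _ (Zfull x _ _ _), Finset.sum_add_distrib]
    rw [h1, h2]
  simp only [hT]
  simp only [gammaAB, Matrix.mul_apply, add_mul, sub_mul, neg_mul, mul_ite, ite_mul, mul_one,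
    mul_zero, zero_mul, Finset.sum_add_distrib, Finset.sum_sub_distrib,
    Finset.sum_neg_distrib, Finset.sum_ite_irrel, Finset.sum_const_zero, Finset.sum_ite_eq,
    Finset.sum_ite_eq', Finset.mem_univ, if_true]
  have e1 : A k j * ∑ u, Zmat x p i u * Zmat x q u l = ∑ u, A k j * Zmat x p i u * Zmat x q u l := by
    rw [Finset.mul_sum]
    exact Finset.sum_congr rfl fun _ _ => by ring
  have e2 : A i l * ∑ u, Zmat x q k u * Zmat x p u j = ∑ u, A i l * Zmat x p u j * Zmat x q k u := by
    rw [Finset.mul_sum]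
    exact Finset.sum_congr rfl fun _ _ => by ring
  rw [e1, e2]
  ring

end Cometric

/-! ### The quadratic form of the co-metric -/

section QuadraticForm

variable {n d : ℕ} {A : Matrix (Fin d) (Fin d) ℂ} {B : Matrix (Fin d × Fin d) (Fin d × Fin d) ℂ}

lemma sum_sextuple_comm {D M : Type*} [Fintype D] [AddCommMonoid M]
    (F : D → D → D → D → D → D → M) (e : Equiv.Perm (D × D × D × D × D × D)) :
    ∑ i, ∑ j, ∑ k, ∑ l, ∑ a, ∑ b, F i j k l a b
      = ∑ i, ∑ j, ∑ k, ∑ l, ∑ a, ∑ b, F (e (i, j, k, l, a, b)).1 (e (i, j, k, l, a, b)).2.1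
          (e (i, j, k, l, a, b)).2.2.1 (e (i, j, k, l, a, b)).2.2.2.1
          (e (i, j, k, l, a, b)).2.2.2.2.1 (e (i, j, k, l, a, b)).2.2.2.2.2 := by
  have h := Equiv.sum_comp e (fun t => F t.1 t.2.1 t.2.2.1 t.2.2.2.1 t.2.2.2.2.1 t.2.2.2.2.2)
  simpa only [Fintype.sum_prod_type] using h.symm

lemma sum_mul_eq_trace (P Q H K : Matrix (Fin d) (Fin d) ℂ) :
    ∑ i, ∑ j, ∑ k, ∑ l, H j i * K l k * (P i l * Q k j) = (P * K * Q * H).trace := by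
  simp only [Matrix.trace, Matrix.diag, Matrix.mul_apply, Finset.sum_mul]
  refine Finset.sum_congr rfl fun i _ => Finset.sum_congr rfl fun j _ =>
    Finset.sum_congr rfl fun k _ => Finset.sum_congr rfl fun l _ => by ring

/-- As a bilinear form in `H` and `K`, the `B`-part of the co-metric is `B` evaluated at the commutators
`[X, H]` and `[K, Y]`. -/
lemma sum_mul_sum_commutator (X Y H K : Matrix (Fin d) (Fin d) ℂ) :
    ∑ i, ∑ j, ∑ k, ∑ l, H j i * K l k * ∑ a, ∑ b, (B (i, a) (l, b) * X a j * Y k b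
        + B (a, j) (b, k) * X i a * Y b l - B (a, j) (l, b) * X i a * Y k b
        - B (i, a) (b, k) * X a j * Y b l)
      = ∑ x, ∑ y, ∑ u, ∑ v, B (x, y) (u, v) * (X * H - H * X) y x * (K * Y - Y * K) u v := by
  have e1 : ∑ i, ∑ j, ∑ k, ∑ l, ∑ a, ∑ b, H j i * K l k * (B (i, a) (l, b) * X a j * Y k b)
      = ∑ x, ∑ y, ∑ u, ∑ v, B (x, y) (u, v) * (X * H) y x * (K * Y) u v := by
    rw [sum_sextuple_comm _ ⟨fun (i, a, l, b, j, k) => (i, j, k, l, a, b),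
      fun (i, j, k, l, a, b) => (i, a, l, b, j, k), fun _ => rfl, fun _ => rfl⟩]
    simp only [Matrix.mul_apply, Finset.mul_sum, Finset.sum_mul, Equiv.coe_fn_mk]
    refine Finset.sum_congr rfl fun _ _ => Finset.sum_congr rfl fun _ _ =>
      Finset.sum_congr rfl fun _ _ => Finset.sum_congr rfl fun _ _ => ?_
    rw [Finset.sum_comm]
    exact Finset.sum_congr rfl fun _ _ => Finset.sum_congr rfl fun _ _ => by ring
  have e2 : ∑ i, ∑ j, ∑ k, ∑ l, ∑ a, ∑ b, H j i * K l k * (B (a, j) (b, k) * X i a * Y b l)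
      = ∑ x, ∑ y, ∑ u, ∑ v, B (x, y) (u, v) * (H * X) y x * (Y * K) u v := by
    rw [sum_sextuple_comm _ ⟨fun (a, j, b, k, i, l) => (i, j, k, l, a, b),
      fun (i, j, k, l, a, b) => (a, j, b, k, i, l), fun _ => rfl, fun _ => rfl⟩]
    simp only [Matrix.mul_apply, Finset.mul_sum, Finset.sum_mul, Equiv.coe_fn_mk]
    refine Finset.sum_congr rfl fun _ _ => Finset.sum_congr rfl fun _ _ =>
      Finset.sum_congr rfl fun _ _ => Finset.sum_congr rfl fun _ _ => ?_
    rw [Finset.sum_comm]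
    exact Finset.sum_congr rfl fun _ _ => Finset.sum_congr rfl fun _ _ => by ring
  have e3 : ∑ i, ∑ j, ∑ k, ∑ l, ∑ a, ∑ b, H j i * K l k * (B (a, j) (l, b) * X i a * Y k b)
      = ∑ x, ∑ y, ∑ u, ∑ v, B (x, y) (u, v) * (H * X) y x * (K * Y) u v := by
    rw [sum_sextuple_comm _ ⟨fun (a, j, l, b, i, k) => (i, j, k, l, a, b),
      fun (i, j, k, l, a, b) => (a, j, l, b, i, k), fun _ => rfl, fun _ => rfl⟩]
    simp only [Matrix.mul_apply, Finset.mul_sum, Finset.sum_mul, Equiv.coe_fn_mk]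
    refine Finset.sum_congr rfl fun _ _ => Finset.sum_congr rfl fun _ _ =>
      Finset.sum_congr rfl fun _ _ => Finset.sum_congr rfl fun _ _ => ?_
    rw [Finset.sum_comm]
    exact Finset.sum_congr rfl fun _ _ => Finset.sum_congr rfl fun _ _ => by ring
  have e4 : ∑ i, ∑ j, ∑ k, ∑ l, ∑ a, ∑ b, H j i * K l k * (B (i, a) (b, k) * X a j * Y b l)
      = ∑ x, ∑ y, ∑ u, ∑ v, B (x, y) (u, v) * (X * H) y x * (Y * K) u v := by
    rw [sum_sextuple_comm _ ⟨fun (i, a, b, k, j, l) => (i, j, k, l, a, b),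
      fun (i, j, k, l, a, b) => (i, a, b, k, j, l), fun _ => rfl, fun _ => rfl⟩]
    simp only [Matrix.mul_apply, Finset.mul_sum, Finset.sum_mul, Equiv.coe_fn_mk]
    refine Finset.sum_congr rfl fun _ _ => Finset.sum_congr rfl fun _ _ =>
      Finset.sum_congr rfl fun _ _ => Finset.sum_congr rfl fun _ _ => ?_
    rw [Finset.sum_comm]
    exact Finset.sum_congr rfl fun _ _ => Finset.sum_congr rfl fun _ _ => by ring
  have e5 : ∀ x y u v, B (x, y) (u, v) * (X * H - H * X) y x * (K * Y - Y * K) u v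
      = B (x, y) (u, v) * (X * H) y x * (K * Y) u v + B (x, y) (u, v) * (H * X) y x * (Y * K) u v
        - B (x, y) (u, v) * (H * X) y x * (K * Y) u v
        - B (x, y) (u, v) * (X * H) y x * (Y * K) u v := fun x y u v => by
    simp only [Matrix.sub_apply]; ring
  simp only [e5, Finset.sum_add_distrib, Finset.sum_sub_distrib, ← e1, ← e2, ← e3, ← e4, mul_add,
    mul_sub, Finset.mul_sum]

/-- The quadratic form of `Γ_{A,B}` at a linear form `Z ↦ ∑ tr(H^{(p)} Z^{(p)})`. -/
lemma sum_mul_gammaAB (Z H : Fin n → Matrix (Fin d) (Fin d) ℂ) :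
    ∑ α : Idx n d, ∑ β : Idx n d, H α.1 α.2.2 α.2.1 * H β.1 β.2.2 β.2.1 * gammaAB A B Z α β
      = 2 * (A * (∑ p, H p * Z p * H p - (∑ p, H p * Z p) * ∑ p, Z p * H p)).trace
        + ∑ x, ∑ y, ∑ u, ∑ v, B (x, y) (u, v) * (∑ p, (Z p * H p - H p * Z p)) y x
            * (∑ p, (H p * Z p - Z p * H p)) u v := by
  have key : ∀ p q, ∑ i, ∑ j, ∑ k, ∑ l, H p j i * H q l k * gammaAB A B Z (p, i, j) (q, k, l)
      = (if p = q then 2 * (A * (H p * Z p * H p)).trace else 0)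
        - (A * (H p * Z p * (Z q * H q))).trace - (A * (H q * Z q * (Z p * H p))).trace
        + ∑ x, ∑ y, ∑ u, ∑ v, B (x, y) (u, v) * (Z p * H p - H p * Z p) y x
            * (H q * Z q - Z q * H q) u v := by
    intro p q
    rw [← sum_mul_sum_commutator]
    have e1 : ∑ i, ∑ j, ∑ k, ∑ l, H p j i * H q l k *
        (if p = q then A i l * Z p k j + A k j * Z p i l else 0)
        = if p = q then 2 * (A * (H p * Z p * H p)).trace else 0 := by
      by_cases h : p = q
      · subst h
        simp only [if_true, mul_add, Finset.sum_add_distrib]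
        have h2 : ∀ i j k l, H p j i * H p l k * (A k j * Z p i l)
          = H p j i * H p l k * (Z p i l * A k j) := fun i j k l => by ring
        simp only [h2]
        rw [sum_mul_eq_trace, sum_mul_eq_trace, Matrix.mul_assoc (Z p * H p),
          Matrix.trace_mul_comm (Z p * H p), two_mul]
        simp only [Matrix.mul_assoc]
      · simp [h]
    have e2 : ∑ i, ∑ j, ∑ k, ∑ l, H p j i * H q l k * (A k j * (Z p * Z q) i l)
        = (A * (H p * Z p * (Z q * H q))).trace := by
      have h2 : ∀ i j k l, H p j i * H q l k * (A k j * (Z p * Z q) i l)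
        = H p j i * H q l k * ((Z p * Z q) i l * A k j) := fun i j k l => by ring
      simp only [h2]
      rw [sum_mul_eq_trace, Matrix.mul_assoc (Z p * Z q * H q), Matrix.trace_mul_comm]
      simp only [Matrix.mul_assoc]
    have e3 : ∑ i, ∑ j, ∑ k, ∑ l, H p j i * H q l k * (A i l * (Z q * Z p) k j)
        = (A * (H q * Z q * (Z p * H p))).trace := by
      rw [sum_mul_eq_trace]
      simp only [Matrix.mul_assoc]
    simp only [gammaAB, mul_add, mul_sub, Finset.sum_add_distrib, Finset.sum_sub_distrib] at e1 e2 e3 ⊢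
    rw [← e1, ← e2, ← e3]
  have h1 : ∑ α : Idx n d, ∑ β : Idx n d,
        H α.1 α.2.2 α.2.1 * H β.1 β.2.2 β.2.1 * gammaAB A B Z α β
      = ∑ p, ∑ q, ∑ i, ∑ j, ∑ k, ∑ l, H p j i * H q l k * gammaAB A B Z (p, i, j) (q, k, l) := by
    simp only [Fintype.sum_prod_type]
    refine Finset.sum_congr rfl fun p _ => ?_
    calc _ = ∑ i, ∑ q, ∑ j, ∑ k, ∑ l, H p j i * H q l k * gammaAB A B Z (p, i, j) (q, k, l) :=
          Finset.sum_congr rfl fun i _ => Finset.sum_comm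
      _ = _ := Finset.sum_comm
  have h2 : ∑ p, ∑ q, ∑ x, ∑ y, ∑ u, ∑ v, B (x, y) (u, v) * (Z p * H p - H p * Z p) y x
        * (H q * Z q - Z q * H q) u v
      = ∑ x, ∑ y, ∑ u, ∑ v, B (x, y) (u, v) * (∑ p, (Z p * H p - H p * Z p)) y x
            * (∑ p, (H p * Z p - Z p * H p)) u v := by
    rw [sum_pairs_sum_quadruples_comm]
    simp only [Matrix.sum_apply, Finset.mul_sum, Finset.sum_mul]
    refine Finset.sum_congr rfl fun _ _ => Finset.sum_congr rfl fun _ _ =>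
      Finset.sum_congr rfl fun _ _ => Finset.sum_congr rfl fun _ _ => Finset.sum_comm
  have h3 : (A * (∑ p, H p * Z p * H p - (∑ p, H p * Z p) * ∑ p, Z p * H p)).trace
      = ∑ p, (A * (H p * Z p * H p)).trace - ∑ p, ∑ q, (A * (H p * Z p * (Z q * H q))).trace := by
    simp only [Matrix.mul_sub, Finset.mul_sum, Finset.sum_mul, Matrix.trace_sub, Matrix.trace_sum]
    rw [Finset.sum_comm]
  have h4 : ∑ p, ∑ q, (A * (H q * Z q * (Z p * H p))).trace
      = ∑ p, ∑ q, (A * (H p * Z p * (Z q * H q))).trace := Finset.sum_comm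
  rw [h1]
  simp only [key, Finset.sum_add_distrib, Finset.sum_sub_distrib, Finset.sum_ite_eq,
    Finset.mem_univ, if_true]
  rw [h2, h3, h4, ← Finset.mul_sum]
  simp only [Finset.sum_sub_distrib]
  ring

end QuadraticForm

/-! ### Positive matrices -/

section PositiveMatrices

variable {d : ℕ}

lemma posSemidef_exists_eq_conjTranspose_mul_self {A : Matrix (Fin d) (Fin d) ℂ}
    (hA : A.PosSemidef) : ∃ C : Matrix (Fin d) (Fin d) ℂ, A = C.conjTranspose * C := by
  open scoped MatrixOrder Matrix.Norms.L2Operator in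
  exact CStarAlgebra.nonneg_iff_eq_star_mul_self.mp hA.nonneg

lemma posDef_exists_eq_mul_conjTranspose {A : Matrix (Fin d) (Fin d) ℂ}
    (hA : A.PosDef) : ∃ C : Matrix (Fin d) (Fin d) ℂ, A = C * C.conjTranspose ∧ IsUnit C := by
  obtain ⟨C, hC⟩ := posSemidef_exists_eq_conjTranspose_mul_self hA.posSemidef
  have hu : IsUnit (C.conjTranspose * C) := hC ▸ hA.isUnit
  refine ⟨C.conjTranspose, by rw [Matrix.conjTranspose_conjTranspose, hC], ?_⟩
  rw [Matrix.isUnit_iff_isUnit_det] at hu ⊢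
  rw [Matrix.det_mul] at hu
  exact isUnit_of_mul_isUnit_left hu

lemma trace_mul_nonneg {A X : Matrix (Fin d) (Fin d) ℂ} (hA : A.PosDef) (hX : X.PosSemidef) :
    0 ≤ (A * X).trace := by
  obtain ⟨C, rfl, -⟩ := posDef_exists_eq_mul_conjTranspose hA
  rw [Matrix.mul_assoc, Matrix.trace_mul_comm]
  exact (hX.conjTranspose_mul_mul_same C).trace_nonneg

lemma trace_mul_eq_zero {A X : Matrix (Fin d) (Fin d) ℂ} (hA : A.PosDef) (hX : X.PosSemidef)
    (h : (A * X).trace = 0) : X = 0 := by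
  obtain ⟨C, rfl, hC⟩ := posDef_exists_eq_mul_conjTranspose hA
  rw [Matrix.mul_assoc, Matrix.trace_mul_comm,
    (hX.conjTranspose_mul_mul_same C).trace_eq_zero_iff] at h
  have hC' : IsUnit C.conjTranspose := by
    rw [Matrix.isUnit_iff_isUnit_det, Matrix.det_conjTranspose] at *
    exact hC.star
  rwa [hC.mul_left_eq_zero, hC'.mul_right_eq_zero] at h

lemma eq_zero_of_mul_mul_conjTranspose {Y Z : Matrix (Fin d) (Fin d) ℂ} (hZ : Z.PosDef)
    (h : Y * Z * Y.conjTranspose = 0) : Y = 0 := by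
  obtain ⟨C, rfl, hC⟩ := posDef_exists_eq_mul_conjTranspose hZ
  have h' : (Y * C) * (Y * C).conjTranspose = 0 := by
    rw [Matrix.conjTranspose_mul]; simpa only [Matrix.mul_assoc] using h
  rw [Matrix.self_mul_conjTranspose_eq_zero] at h'
  rwa [hC.mul_left_eq_zero] at h'

/-- Positive definiteness tested on the compact unit sphere, which makes it an open condition. -/
lemma posDef_iff_forall_re {M : Matrix (Fin d) (Fin d) ℂ} (hM : M.IsHermitian) :
    M.PosDef ↔ ∀ v ∈ Metric.sphere (0 : Fin d → ℂ) 1,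
      0 < (dotProduct (star v) (M.mulVec v)).re := by
  constructor
  · intro h v hv
    have hv0 : v ≠ 0 := by
      rintro rfl; simp at hv
    exact h.re_dotProduct_pos hv0
  · intro h
    refine Matrix.PosDef.of_dotProduct_mulVec_pos hM fun v hv => ?_
    have hn : ‖v‖ ≠ 0 := norm_ne_zero_iff.mpr hv
    have h1 := h ((‖v‖⁻¹ : ℂ) • v) (by simp [norm_smul, hn])
    have hreal : (dotProduct (star v) (M.mulVec v)).im = 0 := by
      have := hM.im_star_dotProduct_mulVec_self v
      simpa using this
    rw [Complex.lt_def]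
    refine ⟨?_, by simp [hreal]⟩
    have h2 : dotProduct (star ((‖v‖⁻¹ : ℂ) • v)) (M.mulVec ((‖v‖⁻¹ : ℂ) • v))
        = ((‖v‖⁻¹ * ‖v‖⁻¹ : ℝ) : ℂ) * dotProduct (star v) (M.mulVec v) := by
      rw [Matrix.mulVec_smul, star_smul, smul_dotProduct, dotProduct_smul]
      simp [smul_eq_mul, mul_assoc]
    rw [h2, Complex.re_ofReal_mul] at h1
    simpa using (pos_iff_pos_of_mul_pos h1).mp (by positivity)

lemma isOpen_setOf_posDef {X : Type*} [TopologicalSpace X] {M : X → Matrix (Fin d) (Fin d) ℂ}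
    (hM : Continuous M) (hH : ∀ x, (M x).IsHermitian) : IsOpen {x | (M x).PosDef} := by
  rw [isOpen_iff_mem_nhds]
  intro x₀ hx₀
  have hcont : Continuous fun y : X × (Fin d → ℂ) =>
      (dotProduct (star y.2) ((M y.1).mulVec y.2)).re := by
    have h1 : Continuous fun y : X × (Fin d → ℂ) => M y.1 := hM.comp continuous_fst
    exact Complex.continuous_re.comp (continuous_snd.star.dotProduct
      (h1.matrix_mulVec continuous_snd))
  have h := (isCompact_sphere (0 : Fin d → ℂ) 1).eventually_forall_of_forall_eventually
    (x₀ := x₀) (P := fun x v => 0 < (dotProduct (star v) ((M x).mulVec v)).re)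
    (fun v hv => hcont.continuousAt.eventually
      (lt_mem_nhds ((posDef_iff_forall_re (hH x₀)).mp hx₀ v hv)))
  filter_upwards [h] with x hx
  exact (posDef_iff_forall_re (hH x)).mpr hx

/-- The entries of a positive semidefinite matrix are bounded by its trace. -/
lemma norm_apply_le_trace {M : Matrix (Fin d) (Fin d) ℂ} (hM : M.PosSemidef) (i j : Fin d) :
    ‖M i j‖ ≤ M.trace.re := by
  obtain ⟨C, rfl⟩ := posSemidef_exists_eq_conjTranspose_mul_self hM
  have hdiag : ∀ i, ((C.conjTranspose * C) i i).re = ∑ k, ‖C k i‖ ^ 2 := fun i => by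
    simp only [Matrix.mul_apply, Matrix.conjTranspose_apply, Complex.re_sum]
    refine Finset.sum_congr rfl fun k _ => ?_
    rw [Complex.star_def, Complex.conj_mul']
    norm_cast
  have htr : (C.conjTranspose * C).trace.re = ∑ i, ∑ k, ‖C k i‖ ^ 2 := by
    simp only [Matrix.trace, Matrix.diag, Complex.re_sum, hdiag]
  have hle : ∀ i, ∑ k, ‖C k i‖ ^ 2 ≤ (C.conjTranspose * C).trace.re := fun i => by
    rw [htr]
    exact Finset.single_le_sum (f := fun i => ∑ k, ‖C k i‖ ^ 2)
      (fun i _ => Finset.sum_nonneg fun _ _ => by positivity) (Finset.mem_univ i)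
  calc ‖(C.conjTranspose * C) i j‖ ≤ ∑ k, ‖C k i‖ * ‖C k j‖ := by
        rw [Matrix.mul_apply]
        refine (norm_sum_le _ _).trans (Finset.sum_le_sum fun k _ => ?_)
        rw [norm_mul, Matrix.conjTranspose_apply, norm_star]
    _ ≤ ∑ k, (‖C k i‖ ^ 2 + ‖C k j‖ ^ 2) / 2 := Finset.sum_le_sum fun k _ => by
        nlinarith [sq_nonneg (‖C k i‖ - ‖C k j‖)]
    _ = (∑ k, ‖C k i‖ ^ 2 + ∑ k, ‖C k j‖ ^ 2) / 2 := by
        rw [← Finset.sum_div, Finset.sum_add_distrib]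
    _ ≤ _ := by linarith [hle i, hle j]

end PositiveMatrices

/-! ### Ellipticity -/

section Ellipticity

variable {n d : ℕ} {A : Matrix (Fin d) (Fin d) ℂ} {B : Matrix (Fin d × Fin d) (Fin d × Fin d) ℂ}

/-- The quadratic form of `B`, written with pairs of indices. -/
lemma sum_mul_star_nonneg (hB : B.PosSemidef) (c : Fin d → Fin d → ℂ) :
    0 ≤ ∑ x, ∑ y, ∑ u, ∑ v, B (x, y) (u, v) * c x y * star (c u v) := by
  have h := hB.dotProduct_mulVec_nonneg (fun z => star (c z.1 z.2))
  convert h using 1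
  simp only [dotProduct, Matrix.mulVec, Fintype.sum_prod_type, Finset.mul_sum, Pi.star_apply,
    star_star]
  refine Finset.sum_congr rfl fun _ _ => Finset.sum_congr rfl fun _ _ =>
      Finset.sum_congr rfl fun _ _ => Finset.sum_congr rfl fun _ _ => by ring

/-- Completing the square: with `H^{(n+1)} = 0` and `M = ∑ H^{(p)} Z^{(p)}`,
`∑ H Z H - M M^* = ∑_{r ≤ n+1} (H^{(r)} - M) Z^{(r)} (H^{(r)} - M)^*`. -/
lemma sum_sub_eq_sum_squares (Z H : Fin n → Matrix (Fin d) (Fin d) ℂ)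
    (hZ : ∀ p, (Z p).IsHermitian) (hH : ∀ p, (H p).IsHermitian) :
    ∑ p, H p * Z p * H p - (∑ p, H p * Z p) * ∑ p, Z p * H p
      = ∑ p, (H p - ∑ p, H p * Z p) * Z p * (H p - ∑ p, H p * Z p).conjTranspose
        + (∑ p, H p * Z p) * (1 - ∑ p, Z p) * (∑ p, H p * Z p).conjTranspose := by
  have hM : (∑ p, H p * Z p).conjTranspose = ∑ p, Z p * H p := by
    rw [Matrix.conjTranspose_sum]
    refine Finset.sum_congr rfl fun p _ => ?_
    rw [Matrix.conjTranspose_mul, (hZ p).eq, (hH p).eq]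
  rw [hM]
  generalize hM1 : ∑ p, H p * Z p = M at *
  generalize hM2 : ∑ p, Z p * H p = M' at *
  have h : ∀ p, (H p - M) * Z p * (H p - M).conjTranspose
      = H p * Z p * H p - M * (Z p * H p) - H p * Z p * M' + M * Z p * M' := fun p => by
    rw [Matrix.conjTranspose_sub, (hH p).eq, hM]
    noncomm_ring
  simp only [h, Finset.sum_add_distrib, Finset.sum_sub_distrib, ← Finset.mul_sum, ← Finset.sum_mul,
    hM1, hM2]
  noncomm_ring

/-- Ellipticity. For the Hermitian tuple `H` attached to a real covector, the quadratic form is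
`2 tr A (∑_r (H^{(r)} - M) Z^{(r)} (H^{(r)} - M)^*)` plus the nonnegative value of `B` at
`∑ [Z^{(p)}, H^{(p)}]`. The term `r = n + 1` is `M Z^{(n+1)} M^*`; it forces `M = 0`, and then the
other terms force `H = 0`. -/
lemma posDef_cometricAB (hA : A.PosDef) (hB : B.PosDef)
    (hsymm : ∀ (x : Idx n d → ℝ) (α β : Idx n d),
      gammaAB A B (Zmat x) α β = gammaAB A B (Zmat x) β α) {x : Idx n d → ℝ}
    (hx : ∀ r, (Zfull x r).PosDef) : (cometricAB A B x).PosDef := by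
  refine Matrix.PosDef.of_dotProduct_mulVec_pos ?_ fun ξ hξ => ?_
  · ext α β
    rw [Matrix.conjTranspose_apply, star_trivial, cometricAB_symm hsymm]
  set H : Fin n → Matrix (Fin d) (Fin d) ℂ :=
    fun p => Matrix.of fun j i => ∑ α, (ξ α : ℂ) * realCoeff α (p, i, j) with hHdef
  have hH : ∀ p, (H p).IsHermitian := fun p => by
    ext i j
    simp only [hHdef, Matrix.conjTranspose_apply, Matrix.of_apply, star_sum, star_mul',
      star_realCoeff, swapIdx_mk]
    simp
  have hHx : ∀ α : Idx n d, H α.1 α.2.2 α.2.1 = ∑ γ, (ξ γ : ℂ) * realCoeff γ α := fun α => rfl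
  have hform : ((star ξ ⬝ᵥ (cometricAB A B x).mulVec ξ : ℝ) : ℂ)
      = ∑ α : Idx n d, ∑ β : Idx n d,
        H α.1 α.2.2 α.2.1 * H β.1 β.2.2 β.2.1 * gammaAB A B (Zmat x) α β := by
    have h1 : ((star ξ ⬝ᵥ (cometricAB A B x).mulVec ξ : ℝ) : ℂ)
        = ∑ γ, ∑ δ, ∑ α, ∑ β, (ξ γ : ℂ) * ((realCoeff γ α * (realCoeff δ β
            * gammaAB A B (Zmat x) α β)) * (ξ δ : ℂ)) := by
      simp only [dotProduct, Matrix.mulVec, star_trivial]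
      push_cast
      simp only [ofReal_cometricAB hA.isHermitian hB.isHermitian hsymm, toRealCoord_apply,
        Finset.mul_sum, Finset.sum_mul]
    rw [h1]
    simp only [hHx, Finset.sum_mul, Finset.mul_sum]
    calc _ = ∑ γ, ∑ α, ∑ δ, ∑ β, (ξ γ : ℂ) * ((realCoeff γ α * (realCoeff δ β
            * gammaAB A B (Zmat x) α β)) * (ξ δ : ℂ)) :=
          Finset.sum_congr rfl fun _ _ => Finset.sum_comm
      _ = ∑ α, ∑ γ, ∑ δ, ∑ β, (ξ γ : ℂ) * ((realCoeff γ α * (realCoeff δ β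
            * gammaAB A B (Zmat x) α β)) * (ξ δ : ℂ)) := Finset.sum_comm
      _ = ∑ α, ∑ γ, ∑ β, ∑ δ, (ξ γ : ℂ) * ((realCoeff γ α * (realCoeff δ β
            * gammaAB A B (Zmat x) α β)) * (ξ δ : ℂ)) :=
          Finset.sum_congr rfl fun _ _ => Finset.sum_congr rfl fun _ _ => Finset.sum_comm
      _ = ∑ α, ∑ β, ∑ γ, ∑ δ, (ξ γ : ℂ) * ((realCoeff γ α * (realCoeff δ β
            * gammaAB A B (Zmat x) α β)) * (ξ δ : ℂ)) :=
          Finset.sum_congr rfl fun _ _ => Finset.sum_comm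
      _ = _ := Finset.sum_congr rfl fun _ _ => Finset.sum_congr rfl fun _ _ => by
          rw [Finset.sum_comm]
          exact Finset.sum_congr rfl fun _ _ => Finset.sum_congr rfl fun _ _ => by ring
  have hZ := fun p => Zmat_isHermitian x p
  rw [sum_mul_gammaAB, sum_sub_eq_sum_squares _ _ hZ hH] at hform
  set M := ∑ p, H p * Zmat x p with hM
  have hxp : ∀ p, (Zmat x p).PosDef := fun p => by simpa using hx p.castSucc
  have hxl : (1 - ∑ p, Zmat x p).PosDef := by simpa using hx (Fin.last n)
  have hT1 : ∀ p, ((H p - M) * Zmat x p * (H p - M).conjTranspose).PosSemidef := fun p =>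
    (hxp p).posSemidef.mul_mul_conjTranspose_same _
  have hT2 : (M * (1 - ∑ p, Zmat x p) * M.conjTranspose).PosSemidef :=
    hxl.posSemidef.mul_mul_conjTranspose_same _
  have hBnn : 0 ≤ ∑ a, ∑ y, ∑ u, ∑ v, B (a, y) (u, v)
      * (∑ p, (Zmat x p * H p - H p * Zmat x p)) y a
      * (∑ p, (H p * Zmat x p - Zmat x p * H p)) u v := by
    have h := sum_mul_star_nonneg hB.posSemidef
      (fun a y => (∑ p, (Zmat x p * H p - H p * Zmat x p)) y a)
    convert h using 10 with a _ y _ u _ v _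
    rw [← Matrix.conjTranspose_apply, Matrix.conjTranspose_sum]
    refine congrFun (congrFun (Finset.sum_congr rfl fun p _ => ?_) u) v
    rw [Matrix.conjTranspose_sub, Matrix.conjTranspose_mul, Matrix.conjTranspose_mul, (hZ p).eq,
      (hH p).eq]
  have hT : (∑ p, (H p - M) * Zmat x p * (H p - M).conjTranspose
      + M * (1 - ∑ p, Zmat x p) * M.conjTranspose).PosSemidef :=
    (Matrix.posSemidef_sum _ fun p _ => hT1 p).add hT2
  have hTtr := trace_mul_nonneg hA hT
  have hnn : (0 : ℂ) ≤ ((star ξ ⬝ᵥ (cometricAB A B x).mulVec ξ : ℝ) : ℂ) := by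
    rw [hform]
    exact add_nonneg (mul_nonneg (by norm_num) hTtr) hBnn
  have hnn' : 0 ≤ star ξ ⬝ᵥ (cometricAB A B x).mulVec ξ := by exact_mod_cast hnn
  refine lt_of_le_of_ne hnn' fun h0 => hξ ?_
  rw [← h0, Complex.ofReal_zero] at hform
  have h2 : (A * (∑ p, (H p - M) * Zmat x p * (H p - M).conjTranspose
      + M * (1 - ∑ p, Zmat x p) * M.conjTranspose)).trace = 0 := by
    refine le_antisymm ?_ hTtr
    have : (2 : ℂ) * (A * (∑ p, (H p - M) * Zmat x p * (H p - M).conjTranspose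
      + M * (1 - ∑ p, Zmat x p) * M.conjTranspose)).trace ≤ 2 * 0 := by
      rw [mul_zero]
      exact (le_add_of_nonneg_right hBnn).trans hform.ge
    exact le_of_mul_le_mul_left this (by norm_num)
  rw [Matrix.mul_add, Finset.mul_sum, Matrix.trace_add, Matrix.trace_sum] at h2
  have hs := Finset.sum_nonneg fun p (_ : p ∈ Finset.univ) => trace_mul_nonneg hA (hT1 p)
  obtain ⟨h3, h4⟩ := (add_eq_zero_iff_of_nonneg hs (trace_mul_nonneg hA hT2)).mp h2
  have hM0 : M = 0 := eq_zero_of_mul_mul_conjTranspose hxl (trace_mul_eq_zero hA hT2 h4)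
  have hH0 : ∀ p, H p = 0 := fun p => by
    have := (Finset.sum_eq_zero_iff_of_nonneg
      (fun p _ => trace_mul_nonneg hA (hT1 p))).mp h3 p (Finset.mem_univ p)
    have := eq_zero_of_mul_mul_conjTranspose (hxp p) (trace_mul_eq_zero hA (hT1 p) this)
    rwa [hM0, sub_zero] at this
  -- `H` determines `ξ`, because `realCoeff` is invertible
  have hzero : ∀ γ, ∑ α, (ξ α : ℂ) * realCoeff α γ = 0 := fun γ => by
    rw [← hHx γ, hH0]; rfl
  funext β
  have h5 : ∑ γ, (∑ α, (ξ α : ℂ) * realCoeff α γ) * entryCoeff γ β = (ξ β : ℂ) := by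
    simp only [Finset.sum_mul, mul_assoc]
    rw [Finset.sum_comm]
    simp only [← Finset.mul_sum, sum_realCoeff_entryCoeff]
    simp
  simp only [hzero, zero_mul, Finset.sum_const_zero] at h5
  exact_mod_cast h5.symm

end Ellipticity

/-! ### Geometry of the matrix simplex -/

section Simplex

variable {n d : ℕ}

lemma mem_matrixSimplex_iff (x : Idx n d → ℝ) :
    x ∈ matrixSimplex n d ↔ ∀ r, (Zfull x r).PosSemidef := by
  rw [Fin.forall_fin_succ']
  simp [matrixSimplex]

lemma contDiff_Zfull (r : Fin (n + 1)) (i j : Fin d) {k : WithTop ℕ∞} :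
    ContDiff ℝ k (fun x : Idx n d → ℝ => Zfull x r i j) := by
  refine Fin.lastCases ?_ (fun p => ?_) r
  · simp only [Zfull_last, Matrix.sub_apply, Matrix.sum_apply]
    exact contDiff_const.sub (ContDiff.sum fun p _ => contDiff_Zmat p i j)
  · simpa only [Zfull_castSucc] using contDiff_Zmat p i j

lemma continuous_Zfull (r : Fin (n + 1)) : Continuous (fun x : Idx n d → ℝ => Zfull x r) :=
  continuous_matrix fun i j => (contDiff_Zfull r i j (k := 0)).continuous

lemma Zfull_convexComb (x y : Idx n d → ℝ) {s t : ℝ} (hst : s + t = 1) (r : Fin (n + 1)) :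
    Zfull (s • x + t • y) r = (s : ℂ) • Zfull x r + (t : ℂ) • Zfull y r := by
  refine Fin.lastCases ?_ (fun p => ?_) r
  · simp only [Zfull_last, Zmat_add, Zmat_smul, Finset.sum_add_distrib, ← Finset.smul_sum, smul_sub]
    have h : (1 : Matrix (Fin d) (Fin d) ℂ) = (s : ℂ) • 1 + (t : ℂ) • 1 := by
      rw [← add_smul, ← Complex.ofReal_add, hst]; simp
    nth_rw 1 [h]
    abel
  · simp only [Zfull_castSucc, Zmat_add, Zmat_smul]

/-- Each of the matrices `Z^{(1)}, …, Z^{(n+1)}` can be shifted by multiples of the identity. -/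
lemma exists_shift (hn : 1 ≤ n) (r : Fin (n + 1)) :
    ∃ e : Idx n d → ℝ, ∀ (x : Idx n d → ℝ) (t : ℝ),
      Zfull (x + t • e) r = Zfull x r + (t : ℂ) • (1 : Matrix (Fin d) (Fin d) ℂ) := by
  have hherm : ∀ (q : Fin n) (c : ℝ) p,
      ((Pi.single q ((c : ℂ) • (1 : Matrix (Fin d) (Fin d) ℂ)) : Fin n → Matrix _ _ ℂ) p).IsHermitian := by
    intro q c p
    by_cases h : p = q
    · subst h
      rw [Pi.single_eq_same, Matrix.IsHermitian, Matrix.conjTranspose_smul]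
      simp
    · rw [Pi.single_eq_of_ne h]; exact Matrix.isHermitian_zero
  refine Fin.lastCases ?_ (fun p => ?_) r
  · refine ⟨coordOf (Pi.single ⟨0, hn⟩ (((-1 : ℝ) : ℂ) • 1)), fun x t => ?_⟩
    simp only [Zfull_last, Zmat_add, Zmat_smul, Zmat_coordOf (hherm _ _), Finset.sum_add_distrib,
      ← Finset.smul_sum, Finset.sum_pi_single', Finset.mem_univ]
    simp
    abel
  · refine ⟨coordOf (Pi.single p (((1 : ℝ) : ℂ) • 1)), fun x t => ?_⟩
    simp only [Zfull_castSucc, Zmat_add, Zmat_smul, Zmat_coordOf (hherm _ _)]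
    simp

lemma isOpen_setOf_posDef_Zfull :
    IsOpen {x : Idx n d → ℝ | ∀ r, (Zfull x r).PosDef} := by
  simp only [Set.ofPred_forall]
  exact isOpen_iInter_of_finite fun r =>
    isOpen_setOf_posDef (continuous_Zfull r) fun x => Zfull_isHermitian x r

/-- The interior is cut out by strict positivity: moving an interior point by `-t e`, with `e` from
`exists_shift`, subtracts `t` from `Z^{(r)}` and stays in the simplex for small `t > 0`. -/
lemma mem_interior_matrixSimplex_iff (hn : 1 ≤ n) (x : Idx n d → ℝ) :
    x ∈ interior (matrixSimplex n d) ↔ ∀ r, (Zfull x r).PosDef := by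
  constructor
  · intro hx r
    obtain ⟨e, he⟩ := exists_shift (d := d) hn r
    have hlim : Filter.Tendsto (fun t : ℝ => x + t • e) (𝓝[<] 0) (𝓝 x) := by
      have : Continuous fun t : ℝ => x + t • e := by fun_prop
      have h := this.tendsto 0
      simp only [zero_smul, add_zero] at h
      exact h.mono_left nhdsWithin_le_nhds
    obtain ⟨t, ht, ht0⟩ := ((hlim.eventually (mem_interior_iff_mem_nhds.mp hx)).and
      self_mem_nhdsWithin).exists
    have h1 := (mem_matrixSimplex_iff _).mp ht r
    have ht0' : (0 : ℝ) < -t := by simpa using ht0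
    have h2 : Zfull x r = Zfull (x + t • e) r + ((-t : ℝ) : ℂ) • 1 := by
      rw [he]; simp
    rw [h2]
    refine Matrix.PosDef.posSemidef_add h1 ?_
    exact Matrix.PosDef.smul Matrix.PosDef.one (by exact_mod_cast ht0')
  · intro hx
    refine interior_maximal (t := {x | ∀ r, (Zfull x r).PosDef}) (fun y hy => ?_)
      isOpen_setOf_posDef_Zfull hx
    exact (mem_matrixSimplex_iff y).mpr fun r => (hy r).posSemidef

lemma convex_matrixSimplex : Convex ℝ (matrixSimplex n d) := by
  intro x hx y hy s t hs ht hst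
  rw [mem_matrixSimplex_iff] at *
  intro r
  rw [Zfull_convexComb x y hst]
  exact ((hx r).smul (by exact_mod_cast hs)).add ((hy r).smul (by exact_mod_cast ht))

lemma isClosed_setOf_posSemidef {X : Type*} [TopologicalSpace X]
    {M : X → Matrix (Fin d) (Fin d) ℂ}
    (hM : Continuous M) (hH : ∀ x, (M x).IsHermitian) : IsClosed {x | (M x).PosSemidef} := by
  have h : {x | (M x).PosSemidef} = ⋂ v : Fin d → ℂ, {x | 0 ≤ star v ⬝ᵥ (M x).mulVec v} := by
    ext x
    simp [Matrix.posSemidef_iff_dotProduct_mulVec, hH x]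
  rw [h]
  refine isClosed_iInter fun v => isClosed_le continuous_const ?_
  exact continuous_const.dotProduct (hM.matrix_mulVec continuous_const)

lemma isClosed_matrixSimplex : IsClosed (matrixSimplex n d) := by
  have h : matrixSimplex n d = ⋂ r, {x | (Zfull x r).PosSemidef} := by
    ext x; simp [mem_matrixSimplex_iff]
  rw [h]
  exact isClosed_iInter fun r =>
    isClosed_setOf_posSemidef (continuous_Zfull r) fun x => Zfull_isHermitian x r

lemma abs_coord_le {x : Idx n d → ℝ} {p : Fin n} {C : ℝ} (h : ∀ i j, ‖Zmat x p i j‖ ≤ C)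
    (i j : Fin d) : |x (p, i, j)| ≤ C := by
  rcases lt_trichotomy i j with hij | hij | hij
  · refine le_trans ?_ ((Complex.abs_re_le_norm _).trans (h i j))
    simp [Zmat, hij, hij.ne]
  · refine le_trans ?_ ((Complex.abs_re_le_norm _).trans (h i j))
    simp [Zmat, hij]
  · refine le_trans ?_ ((Complex.abs_im_le_norm _).trans (h j i))
    simp [Zmat, hij, hij.ne]

lemma abs_coord_le_of_mem {x : Idx n d → ℝ} (hx : x ∈ matrixSimplex n d) (α : Idx n d) :
    |x α| ≤ d := by
  rw [mem_matrixSimplex_iff] at hx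
  refine abs_coord_le (p := α.1) (fun i j => ?_) α.2.1 α.2.2
  have h1 := norm_apply_le_trace (hx α.1.castSucc) i j
  have h2 : ∑ r, (Zfull x r).trace.re = d := by
    rw [← Complex.re_sum, ← Matrix.trace_sum, sum_Zfull]; simp
  have h3 : (Zfull x α.1.castSucc).trace.re ≤ ∑ r, (Zfull x r).trace.re :=
    Finset.single_le_sum (f := fun r => (Zfull x r).trace.re)
      (fun r _ => (Complex.le_def.mp (hx r).trace_nonneg).1) (Finset.mem_univ _)
  rw [Zfull_castSucc] at *
  linarith

lemma isBounded_matrixSimplex : Bornology.IsBounded (matrixSimplex n d) := by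
  refine (Metric.isBounded_closedBall (x := (0 : Idx n d → ℝ)) (r := d)).subset fun x hx => ?_
  rw [mem_closedBall_zero_iff, pi_norm_le_iff_of_nonneg (by positivity)]
  exact fun α => abs_coord_le_of_mem hx α

lemma isCompact_matrixSimplex : IsCompact (matrixSimplex n d) :=
  Metric.isCompact_of_isClosed_isBounded isClosed_matrixSimplex isBounded_matrixSimplex

lemma interior_matrixSimplex_nonempty (hn : 1 ≤ n) : (interior (matrixSimplex n d)).Nonempty := by
  have hpos : (0 : ℝ) < ((n : ℝ) + 1)⁻¹ := by positivity
  have hherm : ∀ _ : Fin n, (((((n : ℝ) + 1)⁻¹ : ℝ) : ℂ) •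
      (1 : Matrix (Fin d) (Fin d) ℂ)).IsHermitian := fun _ => by
    rw [Matrix.IsHermitian, Matrix.conjTranspose_smul]; simp
  refine ⟨coordOf fun _ => ((((n : ℝ) + 1)⁻¹ : ℝ) : ℂ) • 1, ?_⟩
  rw [mem_interior_matrixSimplex_iff hn]
  have hc : (((((n : ℝ) + 1)⁻¹ : ℝ) : ℂ) • (1 : Matrix (Fin d) (Fin d) ℂ)).PosDef :=
    Matrix.PosDef.smul Matrix.PosDef.one (by exact_mod_cast hpos)
  intro r
  refine Fin.lastCases ?_ (fun p => ?_) r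
  · have h : (1 : Matrix (Fin d) (Fin d) ℂ) - ∑ _ : Fin n, ((((n : ℝ) + 1)⁻¹ : ℝ) : ℂ) • 1
        = ((((n : ℝ) + 1)⁻¹ : ℝ) : ℂ) • 1 := by
      rw [Finset.sum_const, Finset.card_univ, Fintype.card_fin, ← Nat.cast_smul_eq_nsmul ℂ,
        smul_smul]
      nth_rw 1 [← one_smul ℂ (1 : Matrix (Fin d) (Fin d) ℂ)]
      rw [← sub_smul]
      congr 1
      have : (n : ℂ) + 1 ≠ 0 := by exact_mod_cast (Nat.succ_ne_zero n)
      push_cast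
      field_simp
      ring
    simp only [Zfull_last, Zmat_coordOf hherm, h, hc]
  · simp only [Zfull_castSucc, Zmat_coordOf hherm, hc]

lemma isConnected_interior_matrixSimplex (hn : 1 ≤ n) :
    IsConnected (interior (matrixSimplex n d)) :=
  ⟨interior_matrixSimplex_nonempty hn, convex_matrixSimplex.interior.isPreconnected⟩

lemma volume_frontier_matrixSimplex : volume (frontier (matrixSimplex n d)) = 0 :=
  convex_matrixSimplex.addHaar_frontier volume

lemma interior_ae_eq_matrixSimplex :
    interior (matrixSimplex n d) =ᵐ[volume] matrixSimplex n d :=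
  interior_ae_eq_of_null_frontier volume_frontier_matrixSimplex

/-! ### The Dirichlet weight -/

lemma contDiff_det_re {X : Type*} [NormedAddCommGroup X] [NormedSpace ℝ X] {k : WithTop ℕ∞}
    {M : X → Matrix (Fin d) (Fin d) ℂ} (hM : ∀ i j, ContDiff ℝ k (fun x => M x i j)) :
    ContDiff ℝ k (fun x => (M x).det.re) := by
  have h : ContDiff ℝ k (fun x => (M x).det) := by
    simp only [Matrix.det_apply']
    exact ContDiff.sum fun σ _ => contDiff_const.mul (contDiff_prod fun i _ => hM _ _)
  exact Complex.reCLM.contDiff.comp h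

lemma det_re_pos {M : Matrix (Fin d) (Fin d) ℂ} (hM : M.PosDef) : 0 < M.det.re :=
  (Complex.lt_def.mp hM.det_pos).1

lemma ofReal_det_re {M : Matrix (Fin d) (Fin d) ℂ} (hM : M.IsHermitian) :
    (M.det.re : ℂ) = M.det := by
  rw [← Complex.conj_eq_iff_re]
  have := Matrix.det_conjTranspose M
  rw [hM.eq] at this
  exact this.symm

lemma contDiffOn_dirichletWeight (hn : 1 ≤ n) (a : Fin (n + 1) → ℝ) :
    ContDiffOn ℝ ∞ (dirichletWeight a) (interior (matrixSimplex n d)) := by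
  refine contDiffOn_prod fun r _ => ?_
  refine ContDiffOn.rpow_const_of_ne (contDiff_det_re fun i j => contDiff_Zfull r i j).contDiffOn ?_
  intro x hx
  exact (det_re_pos ((mem_interior_matrixSimplex_iff hn x).mp hx r)).ne'

lemma dirichletWeight_pos (hn : 1 ≤ n) (a : Fin (n + 1) → ℝ) {x : Idx n d → ℝ}
    (hx : x ∈ interior (matrixSimplex n d)) : 0 < dirichletWeight a x :=
  Finset.prod_pos fun r _ =>
    Real.rpow_pos_of_pos (det_re_pos ((mem_interior_matrixSimplex_iff hn x).mp hx r)) _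

lemma measurable_dirichletWeight (a : Fin (n + 1) → ℝ) :
    Measurable (dirichletWeight (d := d) a) := by
  refine Finset.measurable_prod _ fun r _ => ?_
  exact ((contDiff_det_re (k := 0) fun i j => contDiff_Zfull r i j).continuous.measurable).pow_const _

end Simplex

/-! ### Leading principal minors -/

section LeadingMinors

variable {d : ℕ}

/-- The leading principal `k × k` block of `M`, completed to a `d × d` matrix by the identity. -/
def leadingBlock (k : ℕ) (M : Matrix (Fin d) (Fin d) ℂ) : Matrix (Fin d) (Fin d) ℂ :=
  Matrix.of fun i j => if i.1 < k ∧ j.1 < k then M i j else if i = j then 1 else 0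

/-- The (real part of the) leading principal `k × k` minor. -/
def leadingMinor (k : ℕ) (M : Matrix (Fin d) (Fin d) ℂ) : ℝ := (leadingBlock k M).det.re

lemma leadingBlock_self (M : Matrix (Fin d) (Fin d) ℂ) : leadingBlock d M = M := by
  ext i j; simp [leadingBlock]

lemma leadingMinor_zero (M : Matrix (Fin d) (Fin d) ℂ) : leadingMinor 0 M = 1 := by
  have : leadingBlock 0 M = 1 := by ext i j; simp [leadingBlock, Matrix.one_apply]
  simp [leadingMinor, this]

lemma leadingMinor_congr {k : ℕ} {M N : Matrix (Fin d) (Fin d) ℂ}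
    (h : ∀ i j : Fin d, i.1 < k → j.1 < k → M i j = N i j) :
    leadingMinor k M = leadingMinor k N := by
  have : leadingBlock k M = leadingBlock k N := by
    ext i j
    by_cases hij : i.1 < k ∧ j.1 < k
    · simp [leadingBlock, hij, h i j hij.1 hij.2]
    · simp only [leadingBlock, Matrix.of_apply, hij, if_false]
  rw [leadingMinor, this, leadingMinor]

lemma posDef_leadingBlock (k : ℕ) {M : Matrix (Fin d) (Fin d) ℂ} (hM : M.PosDef) :
    (leadingBlock k M).PosDef := by
  set P : Matrix (Fin d) (Fin d) ℂ := Matrix.diagonal fun i => if i.1 < k then 1 else 0 with hP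
  set Q : Matrix (Fin d) (Fin d) ℂ := Matrix.diagonal fun i => if i.1 < k then 0 else 1 with hQ
  have hPh : P.conjTranspose = P := by
    rw [hP, Matrix.diagonal_conjTranspose]
    congr 1
    funext i
    by_cases h : i.1 < k <;> simp [h]
  have hPQ : P + Q = 1 := by
    rw [hP, hQ, Matrix.diagonal_add, ← Matrix.diagonal_one]
    congr 1
    funext i
    by_cases h : i.1 < k <;> simp [h]
  have hblock : leadingBlock k M = P * M * P.conjTranspose + Q := by
    rw [hPh]
    ext i j
    rw [Matrix.add_apply, hP, Matrix.mul_diagonal, Matrix.diagonal_mul, hQ, Matrix.diagonal_apply]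
    by_cases hij : i = j
    · subst hij
      by_cases hi : i.1 < k <;> simp [leadingBlock, hi]
    · by_cases hi : i.1 < k <;> by_cases hj : j.1 < k <;> simp [leadingBlock, hi, hj, hij]
  have hQpsd : Q.PosSemidef := Matrix.PosSemidef.diagonal fun i => by
    by_cases h : i.1 < k <;> simp [h]
  have h1 : (P * M * P.conjTranspose).PosSemidef := hM.posSemidef.mul_mul_conjTranspose_same P
  rw [hblock]
  refine Matrix.PosDef.of_dotProduct_mulVec_pos (h1.add hQpsd).isHermitian fun v hv => ?_
  rw [Matrix.add_mulVec, dotProduct_add]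
  by_cases hPv : P.mulVec v = 0
  · have hQv : Q.mulVec v = v := by
      have := congrArg (fun N => N.mulVec v) hPQ
      simpa [Matrix.add_mulVec, hPv] using this
    rw [hQv]
    exact add_pos_of_nonneg_of_pos (h1.dotProduct_mulVec_nonneg v)
      (Matrix.dotProduct_star_self_pos_iff.mpr hv)
  · refine add_pos_of_pos_of_nonneg ?_ (hQpsd.dotProduct_mulVec_nonneg v)
    have h2 : star v ⬝ᵥ (P * M * P.conjTranspose).mulVec v
        = star (P.mulVec v) ⬝ᵥ M.mulVec (P.mulVec v) := by
      rw [Matrix.star_mulVec, ← Matrix.dotProduct_mulVec, Matrix.mulVec_mulVec,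
        Matrix.mulVec_mulVec, hPh]
    rw [h2]
    exact hM.dotProduct_mulVec_pos hPv

lemma leadingMinor_pos (k : ℕ) {M : Matrix (Fin d) (Fin d) ℂ} (hM : M.PosDef) :
    0 < leadingMinor k M := det_re_pos (posDef_leadingBlock k hM)

/-- If the `k`-th row is `e_k`, then the determinant does not depend on the `k`-th column. -/
lemma det_eq_of_row_eq_single {P Q : Matrix (Fin d) (Fin d) ℂ} (k : Fin d)
    (hP : P k = Pi.single k 1) (hQ : Q k = Pi.single k 1)
    (h : ∀ i j, i ≠ k → j ≠ k → P i j = Q i j) : P.det = Q.det := by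
  simp only [Matrix.det_apply]
  refine Finset.sum_congr rfl fun σ _ => ?_
  congr 1
  by_cases hσ : σ k = k
  · refine Finset.prod_congr rfl fun i _ => ?_
    by_cases hi : i = k
    · subst hi; rw [hσ, hP, hQ]
    · exact h _ _ (fun h' => hi (σ.injective (h'.trans hσ.symm))) hi
  · have hk : σ⁻¹ k ≠ k := fun h' => hσ (by rw [Equiv.Perm.inv_eq_iff_eq] at h'; exact h'.symm)
    rw [Finset.prod_eq_zero (Finset.mem_univ (σ⁻¹ k)),
      Finset.prod_eq_zero (Finset.mem_univ (σ⁻¹ k))]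
    · rw [show σ (σ⁻¹ k) = k from σ.apply_symm_apply k, hQ, Pi.single_eq_of_ne hk]
    · rw [show σ (σ⁻¹ k) = k from σ.apply_symm_apply k, hP, Pi.single_eq_of_ne hk]

variable {n : ℕ}

lemma Zmat_update_diag (x : Idx n d → ℝ) (r : Fin n) (k : Fin d) (t : ℝ) (q : Fin n)
    (i j : Fin d) (h : ¬ (q = r ∧ i = k ∧ j = k)) :
    Zmat (Function.update x (r, k, k) t) q i j = Zmat x q i j := by
  have hu : ∀ u v : Fin d, ¬ (q = r ∧ u = k ∧ v = k) →
      Function.update x (r, k, k) t (q, u, v) = x (q, u, v) := fun u v huv =>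
    Function.update_of_ne (fun h' => huv (by simpa [Prod.ext_iff] using h')) _ _
  have h' : ¬ (q = r ∧ j = k ∧ i = k) := fun h' => h ⟨h'.1, h'.2.2, h'.2.1⟩
  by_cases hij : i = j
  · subst hij
    simp [Zmat, hu i i h]
  · by_cases hlt : i < j <;> simp [Zmat, hij, hlt, hu i j h, hu j i h']

/-- The leading minors are affine functions of the last diagonal entry. -/
lemma exists_leadingMinor_succ_eq (x : Idx n d → ℝ) (r : Fin n) (k : Fin d) :
    ∃ c : ℝ, ∀ t : ℝ, leadingMinor (k.1 + 1) (Zmat (Function.update x (r, k, k) t) r)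
      = c + t * leadingMinor k.1 (Zmat x r) := by
  set N := leadingBlock (k.1 + 1) (Zmat (Function.update x (r, k, k) 0) r) with hN
  refine ⟨N.det.re, fun t => ?_⟩
  have h1 : leadingBlock (k.1 + 1) (Zmat (Function.update x (r, k, k) t) r)
      = Matrix.updateRow N k (N k + (t : ℂ) • Pi.single k 1) := by
    ext i j
    rw [Matrix.updateRow_apply]
    by_cases hi : i = k
    · subst hi
      by_cases hj : j = i
      · subst hj
        simp [hN, leadingBlock, Zmat]
      · simp only [hN, leadingBlock, Matrix.of_apply, if_true, Pi.add_apply, Pi.smul_apply,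
          Pi.single_apply, hj, if_false, smul_zero, add_zero]
        rw [Zmat_update_diag _ _ _ _ _ _ _ (by simp [hj]), Zmat_update_diag _ _ _ _ _ _ _ (by simp [hj])]
    · simp only [hN, leadingBlock, Matrix.of_apply, hi, if_false]
      rw [Zmat_update_diag _ _ _ _ _ _ _ (by simp [hi]), Zmat_update_diag _ _ _ _ _ _ _ (by simp [hi])]
  have h2 : (Matrix.updateRow N k (Pi.single k 1)).det = (leadingBlock k.1 (Zmat x r)).det := by
    refine det_eq_of_row_eq_single k (Matrix.updateRow_self) ?_ fun i j hi hj => ?_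
    · funext j
      simp [leadingBlock, Pi.single_apply, eq_comm]
    · rw [Matrix.updateRow_ne hi, hN]
      have hi' : i.1 ≠ k.1 := fun h => hi (Fin.ext h)
      have hj' : j.1 ≠ k.1 := fun h => hj (Fin.ext h)
      have e1 : i.1 < k.1 + 1 ↔ i.1 < k.1 := by omega
      have e2 : j.1 < k.1 + 1 ↔ j.1 < k.1 := by omega
      simp only [leadingBlock, Matrix.of_apply, e1, e2]
      rw [Zmat_update_diag _ _ _ _ _ _ _ (by simp [hi])]
  rw [leadingMinor, h1, Matrix.det_updateRow_add, Matrix.det_updateRow_smul,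
    Matrix.updateRow_eq_self, h2, leadingMinor, Complex.add_re, Complex.re_ofReal_mul]

lemma continuous_leadingMinor_Zmat (k : ℕ) (r : Fin n) :
    Continuous (fun x : Idx n d → ℝ => leadingMinor k (Zmat x r)) := by
  refine (contDiff_det_re (k := 0) fun i j => ?_).continuous
  by_cases h : i.1 < k ∧ j.1 < k
  · simpa only [leadingBlock, Matrix.of_apply, h, and_self, if_true] using contDiff_Zmat r i j
  · simpa only [leadingBlock, Matrix.of_apply, h, if_false] using contDiff_const

end LeadingMinors

/-! ### Integrability of the Dirichlet weight -/

section Integrability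

open scoped ENNReal

/-- Comparison of integrals over `ℝ^ι` from a comparison along one coordinate. -/
lemma lintegral_le_mul_of_forall_update {ι : Type*} [Fintype ι] [DecidableEq ι] (i : ι)
    {f g : (ι → ℝ) → ℝ≥0∞} (hf : Measurable f) (hg : Measurable g) (C : ℝ≥0∞)
    (h : ∀ x, ∫⁻ t, f (Function.update x i t) ≤ C * ∫⁻ t, g (Function.update x i t)) :
    ∫⁻ x, f x ≤ C * ∫⁻ x, g x := by
  rw [← lintegral_const_mul C hg]
  refine lintegral_le_of_lmarginal_le {i} hf (hg.const_mul C) fun x => ?_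
  rw [lmarginal_singleton, lmarginal_singleton]
  refine (h x).trans ?_
  exact (lintegral_const_mul C (hg.comp (measurable_update x))).ge

lemma lintegral_rpow_Ioc_lt_top {b : ℝ} (hb : 0 < b) (T : ℝ) :
    ∫⁻ u in Set.Ioc 0 T, ENNReal.ofReal (u ^ (b - 1)) < ⊤ := by
  rcases le_or_gt T 0 with hT | hT
  · simp [Set.Ioc_eq_empty (not_lt.mpr hT)]
  · have h := (intervalIntegral.intervalIntegrable_rpow' (r := b - 1) (a := 0) (b := T) (by linarith)).1
    refine lt_of_le_of_lt (lintegral_mono fun u => ?_) h.2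
    exact Real.ofReal_le_enorm _

/-- `∫_{|t| ≤ R} (c + t m)_+^{b-1} dt ≤ K m^{b-1}`, uniformly in `c`, for `b ≤ 1`. -/
lemma lintegral_affine_rpow_le {b : ℝ} (hb1 : b ≤ 1) (R c : ℝ) {m : ℝ} (hm : 0 < m) :
    ∫⁻ t, (Set.Ioc (-R) R).indicator
        (fun t => if 0 < c + t * m then ENNReal.ofReal ((c + t * m) ^ (b - 1)) else 0) t
      ≤ (∫⁻ u in Set.Ioc 0 (2 * R), ENNReal.ofReal (u ^ (b - 1))) * ENNReal.ofReal (m ^ (b - 1)) := by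
  -- `s` is the left endpoint of the set where the integrand does not vanish
  set s := max (-(c / m)) (-R) with hs
  have hpt : ∀ t, (Set.Ioc (-R) R).indicator
      (fun t => if 0 < c + t * m then ENNReal.ofReal ((c + t * m) ^ (b - 1)) else 0) t
      ≤ (Set.Ioc (0 : ℝ) (2 * R)).indicator (fun u => ENNReal.ofReal (u ^ (b - 1))) (t - s)
        * ENNReal.ofReal (m ^ (b - 1)) := by
    intro t
    by_cases ht : t ∈ Set.Ioc (-R) R
    · rw [Set.indicator_of_mem ht]
      by_cases hc : 0 < c + t * m
      · rw [if_pos hc]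
        have h1 : -(c / m) < t := by
          rw [neg_lt, lt_div_iff₀ hm]
          linarith
        have hst : s < t := max_lt h1 ht.1
        have hmem : t - s ∈ Set.Ioc (0 : ℝ) (2 * R) := by
          have : -R ≤ s := le_max_right _ _
          constructor <;> linarith [ht.2]
        rw [Set.indicator_of_mem hmem, ← ENNReal.ofReal_mul (Real.rpow_nonneg hmem.1.le _),
          ← Real.mul_rpow hmem.1.le hm.le]
        refine ENNReal.ofReal_le_ofReal ?_
        refine Real.rpow_le_rpow_of_nonpos (mul_pos hmem.1 hm) ?_ (by linarith)
        have h2 : -(c / m) ≤ s := le_max_left _ _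
        have h3 : -(c / m) * m ≤ s * m := mul_le_mul_of_nonneg_right h2 hm.le
        rw [neg_mul, div_mul_cancel₀ _ hm.ne'] at h3
        linarith [sub_mul t s m]
      · simp [hc]
    · simp [Set.indicator_of_notMem ht]
  refine (lintegral_mono hpt).trans ?_
  have hmeas : Measurable ((Set.Ioc (0 : ℝ) (2 * R)).indicator
      (fun u => ENNReal.ofReal (u ^ (b - 1)))) :=
    Measurable.indicator (by fun_prop) measurableSet_Ioc
  have hmeas' : Measurable fun t => (Set.Ioc (0 : ℝ) (2 * R)).indicator
      (fun u => ENNReal.ofReal (u ^ (b - 1))) (t - s) := hmeas.comp (measurable_sub_const s)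
  rw [lintegral_mul_const _ hmeas',
    lintegral_sub_right_eq_self _ s, lintegral_indicator measurableSet_Ioc]

/-- The power `m_k^{b-1}` of the `k`-th leading minor, on the set where the first `k` leading
minors are positive. -/
def minorWeight {d : ℕ} (b : ℝ) (k : ℕ) (M : Matrix (Fin d) (Fin d) ℂ) : ℝ≥0∞ :=
  open scoped Classical in
  if ∀ j ≤ k, 0 < leadingMinor j M then ENNReal.ofReal (leadingMinor k M ^ (b - 1)) else 0

variable {n d : ℕ}

lemma measurable_minorWeight_Zmat (b : ℝ) (k : ℕ) (r : Fin n) :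
    Measurable (fun x : Idx n d → ℝ => minorWeight b k (Zmat x r)) := by
  unfold minorWeight
  refine Measurable.ite ?_ ?_ measurable_const
  · have : {x : Idx n d → ℝ | ∀ j ≤ k, 0 < leadingMinor j (Zmat x r)}
        = ⋂ j ∈ Finset.range (k + 1), {x | 0 < leadingMinor j (Zmat x r)} := by
      ext x; simp
    rw [this]
    refine Finset.measurableSet_biInter _ fun j _ => ?_
    exact (isOpen_lt continuous_const (continuous_leadingMinor_Zmat j r)).measurableSet
  · exact ((continuous_leadingMinor_Zmat k r).measurable.pow_const _).ennreal_ofReal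

/-- The product of the weights `minorWeight (b r) (k r)` of the matrices of a tuple, restricted to
a box. -/
def boxWeight (R : ℝ) (b : Fin n → ℝ) (k : Fin n → ℕ) (x : Idx n d → ℝ) : ℝ≥0∞ :=
  (∏ α, (Set.Ioc (-R) R).indicator (fun _ => (1 : ℝ≥0∞)) (x α)) * ∏ r, minorWeight (b r) (k r) (Zmat x r)

lemma measurable_boxWeight (R : ℝ) (b : Fin n → ℝ) (k : Fin n → ℕ) :
    Measurable (boxWeight (d := d) R b k) := by
  refine Measurable.mul (Finset.measurable_prod _ fun α _ => ?_)
    (Finset.measurable_prod _ fun r _ => measurable_minorWeight_Zmat _ _ _)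
  exact (measurable_const.indicator measurableSet_Ioc).comp (measurable_pi_apply α)

/-- Inside the box, the diagonal entry `(r, j, j)` enters the weight only through the minor of order `j + 1` of
`Z^{(r)}`, as an affine function with slope the minor of order `j`. Integrating it out replaces
`m_{j+1}^{b-1}` by a multiple of `m_j^{b-1}`, and the minors are peeled off one at a time. -/
lemma lintegral_boxWeight_lt_top {R : ℝ} (hR : 1 ≤ R) {b : Fin n → ℝ} (hb : ∀ r, 0 < b r)
    (hb1 : ∀ r, b r ≤ 1) (k : Fin n → ℕ) (hk : ∀ r, k r ≤ d) :
    ∫⁻ x, boxWeight (d := d) R b k x < ⊤ := by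
  induction hN : ∑ r, k r generalizing k with
  | zero =>
    have hk0 : ∀ r, k r = 0 := fun r => by
      rw [Finset.sum_eq_zero_iff] at hN; exact hN r (Finset.mem_univ r)
    have h : ∀ x, boxWeight (d := d) R b k x
        = ∏ α, (Set.Ioc (-R) R).indicator (fun _ => (1 : ℝ≥0∞)) (x α) := fun x => by
      simp [boxWeight, hk0, minorWeight, leadingMinor_zero]
    refine lt_of_le_of_lt (lintegral_mono (g := (Metric.closedBall 0 R).indicator 1) fun x => ?_) ?_
    · by_cases hx : x ∈ Metric.closedBall 0 R
      · rw [h, Set.indicator_of_mem hx]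
        exact Finset.prod_le_one' fun α _ => Set.indicator_le_self' (by simp) _
      · rw [Set.indicator_of_notMem hx, h]
        rw [mem_closedBall_zero_iff, pi_norm_le_iff_of_nonneg (by linarith)] at hx
        push Not at hx
        obtain ⟨α, hα⟩ := hx
        refine (Finset.prod_eq_zero (Finset.mem_univ α) (Set.indicator_of_notMem ?_ _)).le
        intro hα'
        rw [Real.norm_eq_abs] at hα
        exact absurd (abs_le.mpr ⟨hα'.1.le, hα'.2⟩) (not_le.mpr hα)
    · rw [lintegral_indicator_one Metric.isClosed_closedBall.measurableSet]
      exact measure_closedBall_lt_top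
  | succ N ih =>
    obtain ⟨r, hr⟩ : ∃ r, k r ≠ 0 := by
      by_contra! h
      simp [h] at hN
    obtain ⟨j, hj⟩ := Nat.exists_eq_succ_of_ne_zero hr
    have hjd : j < d := by have := hk r; omega
    set J : Fin d := ⟨j, hjd⟩ with hJ
    set k' := Function.update k r j with hk'
    have hk'r : k' r = j := by simp [hk']
    have hk'ne : ∀ q, q ≠ r → k' q = k q := fun q hq => by simp [hk', hq]
    have hlt := ih k' (fun q => by
        by_cases hq : q = r
        · subst hq; rw [hk'r]; omega
        · rw [hk'ne q hq]; exact hk q) (by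
        have h1 : ∑ q, k' q = j + ∑ q ∈ Finset.univ \ {r}, k q :=
          Finset.sum_update_of_mem (Finset.mem_univ r) _ _
        have h2 : ∑ q, k q = k r + ∑ q ∈ Finset.univ \ {r}, k q := by
          rw [← Finset.sum_update_of_mem (Finset.mem_univ r), Function.update_eq_self]
        omega)
    refine lt_of_le_of_lt (lintegral_le_mul_of_forall_update (r, J, J) (measurable_boxWeight R b k)
      (measurable_boxWeight R b k')
      (∫⁻ u in Set.Ioc 0 (2 * R), ENNReal.ofReal (u ^ (b r - 1))) fun x => ?_)
      (ENNReal.mul_lt_top (lintegral_rpow_Ioc_lt_top (hb r) _) hlt)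
    -- the factors which do not depend on the coordinate `(r, J, J)`
    set c₁ := ∏ α ∈ Finset.univ \ {(r, J, J)}, (Set.Ioc (-R) R).indicator (fun _ => (1 : ℝ≥0∞)) (x α)
      with hc₁
    set c₂ := ∏ q ∈ Finset.univ \ {r}, minorWeight (b q) (k q) (Zmat x q) with hc₂
    have hbox : ∀ t, ∏ α, (Set.Ioc (-R) R).indicator (fun _ => (1 : ℝ≥0∞))
        (Function.update x (r, J, J) t α)
        = (Set.Ioc (-R) R).indicator (fun _ => (1 : ℝ≥0∞)) t * c₁ := fun t => by
      rw [hc₁, ← Finset.prod_update_of_mem (Finset.mem_univ _)]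
      refine Finset.prod_congr rfl fun α _ => ?_
      by_cases hα : α = (r, J, J)
      · subst hα; simp
      · simp [hα]
    have hZne : ∀ t q, q ≠ r → Zmat (Function.update x (r, J, J) t) q = Zmat x q := fun t q hq => by
      ext u v
      exact Zmat_update_diag _ _ _ _ _ _ _ (by simp [hq])
    have hprod : ∀ (κ : Fin n → ℕ) (t : ℝ), (∀ q, q ≠ r → κ q = k q) →
        ∏ q, minorWeight (b q) (κ q) (Zmat (Function.update x (r, J, J) t) q)
        = minorWeight (b r) (κ r) (Zmat (Function.update x (r, J, J) t) r) * c₂ := by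
      intro κ t hκ
      rw [hc₂, ← Finset.prod_update_of_mem (Finset.mem_univ _)]
      refine Finset.prod_congr rfl fun q _ => ?_
      by_cases hq : q = r
      · subst hq; simp
      · simp [hq, hZne t q hq, hκ q hq]
    have hminor : ∀ t, ∀ i ≤ j, leadingMinor i (Zmat (Function.update x (r, J, J) t) r)
        = leadingMinor i (Zmat x r) := fun t i hi => by
      refine leadingMinor_congr fun u v hu hv => Zmat_update_diag _ _ _ _ _ _ _ ?_
      rintro ⟨-, rfl, -⟩
      simp [hJ] at hu
      omega
    have hweight' : ∀ t, minorWeight (b r) j (Zmat (Function.update x (r, J, J) t) r)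
        = minorWeight (b r) j (Zmat x r) := fun t => by
      unfold minorWeight
      rw [hminor t j le_rfl]
      refine if_congr (forall₂_congr fun i hi => ?_) rfl rfl
      rw [hminor t i hi]
    simp only [boxWeight, hbox, hprod k _ (fun _ _ => rfl), hprod k' _ hk'ne, hk'r, hweight', hj]
    have hR2 : 1 ≤ ∫⁻ t, (Set.Ioc (-R) R).indicator (fun _ => (1 : ℝ≥0∞)) t := by
      rw [lintegral_indicator measurableSet_Ioc, setLIntegral_one, Real.volume_Ioc]
      rw [ENNReal.one_le_ofReal]
      linarith
    have hright : c₁ * (minorWeight (b r) j (Zmat x r) * c₂)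
        ≤ ∫⁻ t, (Set.Ioc (-R) R).indicator (fun _ => (1 : ℝ≥0∞)) t * c₁
          * (minorWeight (b r) j (Zmat x r) * c₂) := by
      simp only [mul_assoc]
      rw [lintegral_mul_const _ (measurable_const.indicator measurableSet_Ioc)]
      exact le_mul_of_one_le_left zero_le hR2
    refine le_trans ?_ (mul_le_mul_right hright _)
    by_cases hpos : ∀ i ≤ j, 0 < leadingMinor i (Zmat x r)
    · obtain ⟨c, hc⟩ := exists_leadingMinor_succ_eq x r J
      have hw : ∀ t, minorWeight (b r) (j + 1) (Zmat (Function.update x (r, J, J) t) r)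
          = if 0 < c + t * leadingMinor j (Zmat x r) then
            ENNReal.ofReal ((c + t * leadingMinor j (Zmat x r)) ^ (b r - 1)) else 0 := fun t => by
        unfold minorWeight
        have hc' := hc t
        rw [show J.1 = j from rfl] at hc'
        rw [hc']
        refine if_congr ⟨fun h => hc' ▸ h (j + 1) le_rfl, fun h i hi => ?_⟩ rfl rfl
        rcases Nat.lt_or_ge j i with hi' | hi'
        · rw [show i = j + 1 by omega, hc']; exact h
        · rw [hminor t i hi']; exact hpos i hi'
      have hw' : minorWeight (b r) j (Zmat x r)
          = ENNReal.ofReal (leadingMinor j (Zmat x r) ^ (b r - 1)) := if_pos hpos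
      have hint := lintegral_affine_rpow_le (hb1 r) R c (hpos j le_rfl)
      have heq : ∀ t, (Set.Ioc (-R) R).indicator (fun _ => (1 : ℝ≥0∞)) t * c₁
            * (minorWeight (b r) (j + 1) (Zmat (Function.update x (r, J, J) t) r) * c₂)
          = (Set.Ioc (-R) R).indicator (fun t => if 0 < c + t * leadingMinor j (Zmat x r) then
            ENNReal.ofReal ((c + t * leadingMinor j (Zmat x r)) ^ (b r - 1)) else 0) t
            * (c₁ * c₂) := fun t => by
        rw [hw]
        by_cases ht : t ∈ Set.Ioc (-R) R
        · simp only [Set.indicator_of_mem ht]; ring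
        · simp [Set.indicator_of_notMem ht]
      simp only [heq]
      rw [lintegral_mul_const]
      · calc _ ≤ _ := mul_le_mul_left hint _
          _ = _ := by rw [hw']; ring
      · refine Measurable.indicator (Measurable.ite ?_ ?_ measurable_const) measurableSet_Ioc
        · exact (isOpen_lt continuous_const (by fun_prop)).measurableSet
        · fun_prop
    · have hw : ∀ t, minorWeight (b r) (j + 1) (Zmat (Function.update x (r, J, J) t) r) = 0 :=
        fun t => if_neg fun h => hpos fun i hi => hminor t i hi ▸ h i (by omega)
      simp [hw]

end Integrability

section TotalMass

open scoped ENNReal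

variable {n d : ℕ}

/-- The tuple `(X^{(1)}, …, X^{(n)}, S - ∑ X^{(p)})`, in real coordinates. -/
def completeTuple : ((Idx n d → ℝ) × (Idx 1 d → ℝ)) ≃ₗ[ℝ] (Idx (n + 1) d → ℝ) where
  toFun z := fun α => Fin.lastCases (motive := fun _ => ℝ)
    (z.2 (0, α.2) - ∑ p, z.1 (p, α.2)) (fun p => z.1 (p, α.2)) α.1
  map_add' z w := by
    funext ⟨r, u⟩
    refine Fin.lastCases ?_ (fun p => ?_) r
    · simp [Finset.sum_add_distrib]; ring
    · simp
  map_smul' c z := by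
    funext ⟨r, u⟩
    refine Fin.lastCases ?_ (fun p => ?_) r
    · simp [← Finset.mul_sum]; ring
    · simp
  invFun y := (fun α => y (α.1.castSucc, α.2), fun α => ∑ r, y (r, α.2))
  left_inv z := by
    ext α
    · simp
    · obtain ⟨q, u⟩ := α
      simp [Fin.sum_univ_castSucc, Subsingleton.elim q 0]
  right_inv y := by
    funext ⟨r, u⟩
    refine Fin.lastCases ?_ (fun p => ?_) r
    · simp [Fin.sum_univ_castSucc]
    · simp

lemma Zmat_completeTuple_castSucc (z : (Idx n d → ℝ) × (Idx 1 d → ℝ)) (p : Fin n) :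
    Zmat (completeTuple z) p.castSucc = Zmat z.1 p := by
  ext i j
  simp [Zmat, completeTuple]

lemma Zmat_completeTuple_last (z : (Idx n d → ℝ) × (Idx 1 d → ℝ)) :
    Zmat (completeTuple z) (Fin.last n) = Zmat z.2 0 - ∑ p, Zmat z.1 p := by
  ext i j
  rw [Matrix.sub_apply, Matrix.sum_apply]
  by_cases h : i = j
  · simp [Zmat, completeTuple, h]
  · by_cases h' : i < j
    · simp [Zmat, completeTuple, h, h', Finset.sum_add_distrib, ← Finset.mul_sum]; ring
    · simp [Zmat, completeTuple, h, h', Finset.sum_sub_distrib, ← Finset.mul_sum]; ring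

/-- For almost every `S`, the fibre integral over `{X^{(1)} + ⋯ + X^{(n+1)} = S}` is finite. -/
lemma ae_lintegral_completeTuple_lt_top {F : (Idx (n + 1) d → ℝ) → ℝ≥0∞} (hF : Measurable F)
    (hfin : ∫⁻ y, F y < ⊤) :
    ∀ᵐ s : Idx 1 d → ℝ, ∫⁻ x : Idx n d → ℝ, F (completeTuple (x, s)) < ⊤ := by
  set e : ((Idx n d → ℝ) × (Idx 1 d → ℝ)) ≃L[ℝ] (Idx (n + 1) d → ℝ) :=
    completeTuple.toContinuousLinearEquiv with he
  have hmeas : Measurable fun z => F (e z) := hF.comp e.continuous.measurable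
  have hprod : ((volume : Measure (Idx n d → ℝ)).prod
      (volume : Measure (Idx 1 d → ℝ))).IsAddHaarMeasure := Measure.prod.instIsAddHaarMeasure _ _
  have : (Measure.map e ((volume : Measure (Idx n d → ℝ)).prod
      (volume : Measure (Idx 1 d → ℝ)))).IsAddHaarMeasure := e.isAddHaarMeasure_map _
  have hmap := Measure.isAddLeftInvariant_eq_smul (Measure.map e
    ((volume : Measure (Idx n d → ℝ)).prod (volume : Measure (Idx 1 d → ℝ)))) volume
  have h1 : ∫⁻ z, F (e z) ∂((volume : Measure (Idx n d → ℝ)).prod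
      (volume : Measure (Idx 1 d → ℝ))) < ⊤ := by
    rw [← lintegral_map hF e.continuous.measurable, hmap, lintegral_smul_measure]
    exact ENNReal.mul_lt_top ENNReal.coe_lt_top hfin
  rw [lintegral_prod_symm _ hmeas.aemeasurable] at h1
  exact ae_lt_top (hmeas.lintegral_prod_left') h1.ne

/-- The congruence `Z ↦ C Z C^*` on tuples of Hermitian matrices. -/
def congruence (C : Matrix (Fin d) (Fin d) ℂ) : (Idx n d → ℝ) →ₗ[ℝ] (Idx n d → ℝ) where
  toFun x := coordOf fun p => C * Zmat x p * C.conjTranspose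
  map_add' x y := by
    funext α
    have h : (fun β : Idx n d => (C * Zmat (x + y) β.1 * C.conjTranspose) β.2.1 β.2.2)
        = (fun β : Idx n d => (C * Zmat x β.1 * C.conjTranspose) β.2.1 β.2.2)
          + (fun β : Idx n d => (C * Zmat y β.1 * C.conjTranspose) β.2.1 β.2.2) := by
      funext β
      simp [Zmat_add, Matrix.mul_add, Matrix.add_mul]
    change (toRealCoordₗ (fun β : Idx n d => (C * Zmat (x + y) β.1 * C.conjTranspose) β.2.1 β.2.2)
      α).re = _
    rw [h, map_add]
    rfl
  map_smul' c x := by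
    funext α
    have h : (fun β : Idx n d => (C * Zmat (c • x) β.1 * C.conjTranspose) β.2.1 β.2.2)
        = (c : ℂ) • (fun β : Idx n d => (C * Zmat x β.1 * C.conjTranspose) β.2.1 β.2.2) := by
      funext β
      simp [Zmat_smul]
    change (toRealCoordₗ (fun β : Idx n d => (C * Zmat (c • x) β.1 * C.conjTranspose) β.2.1 β.2.2)
      α).re = _
    rw [h, map_smul, Pi.smul_apply, smul_eq_mul, Complex.re_ofReal_mul]
    rfl

lemma Zmat_congruence (C : Matrix (Fin d) (Fin d) ℂ) (x : Idx n d → ℝ) (p : Fin n) :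
    Zmat (congruence C x) p = C * Zmat x p * C.conjTranspose :=
  Zmat_coordOf (fun p => Matrix.isHermitian_mul_mul_conjTranspose C (Zmat_isHermitian x p)) p

lemma congruence_det_ne_zero {C : Matrix (Fin d) (Fin d) ℂ} (hC : IsUnit C) :
    LinearMap.det (congruence (n := n) C) ≠ 0 := by
  intro h
  have hinj : LinearMap.ker (congruence (n := n) C) = ⊥ := by
    rw [LinearMap.ker_eq_bot']
    intro x hx
    refine Zmat_injective (funext fun p => ?_)
    have h1 := Zmat_congruence C x p
    have hz : ∀ p, Zmat (0 : Idx n d → ℝ) p = 0 := fun p => by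
      have := Zmat_smul 0 (0 : Idx n d → ℝ) p
      simpa using this
    have hC' : IsUnit C.conjTranspose := by
      rw [Matrix.isUnit_iff_isUnit_det, Matrix.det_conjTranspose] at *
      exact hC.star
    rw [hx, hz] at h1
    rw [hz, ← hC.mul_right_eq_zero, ← hC'.mul_left_eq_zero, ← h1]
  exact (LinearMap.bot_lt_ker_of_det_eq_zero h).ne' hinj

/-- Finiteness of the Dirichlet integral for exponents at most one. The integral over `Δ` is, up
to a linear change of variables, the integral of `∏ det(X^{(r)})^{b_r - 1}` over the positive
tuples with `∑ X^{(r)} = S`; by Fubini it is finite for some `S`. -/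
lemma lintegral_dirichletWeight_lt_top_of_le_one (hn : 1 ≤ n) {b : Fin (n + 1) → ℝ}
    (hb : ∀ r, 0 < b r) (hb1 : ∀ r, b r ≤ 1) :
    ∫⁻ x in interior (matrixSimplex n d), ENNReal.ofReal (dirichletWeight b x) < ⊤ := by
  set R : ℝ := d + 1 with hR
  set F := boxWeight (n := n + 1) (d := d) R b (fun _ => d) with hFdef
  have hF : Measurable F := measurable_boxWeight R b _
  have hfin : ∫⁻ y, F y < ⊤ := lintegral_boxWeight_lt_top (by simp [hR]) hb hb1 _ fun _ => le_rfl
  -- a positive definite `S ≤ 1` with finite fibre integral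
  obtain ⟨s, hs, hsfin⟩ : ∃ s ∈ interior (matrixSimplex 1 d),
      ∫⁻ x : Idx n d → ℝ, F (completeTuple (x, s)) < ⊤ := by
    have hpos : 0 < volume (interior (matrixSimplex 1 d)) :=
      isOpen_interior.measure_pos _ (interior_matrixSimplex_nonempty le_rfl)
    by_contra! h
    have h0 : volume (interior (matrixSimplex 1 d)) = 0 := by
      refine measure_mono_null (fun s hs => ?_)
        (ae_iff.mp (ae_lintegral_completeTuple_lt_top hF hfin))
      exact not_lt.mpr (h s hs)
    exact hpos.ne' h0
  rw [mem_interior_matrixSimplex_iff le_rfl] at hs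
  have hS : (Zmat s 0).PosDef := Zfull_castSucc s 0 ▸ hs (Fin.castSucc 0)
  have hS1 : (1 - Zmat s 0).PosDef := by
    have := hs (Fin.last 1)
    rwa [Zfull_last, Fin.sum_univ_one] at this
  obtain ⟨C, hC, hCu⟩ := posDef_exists_eq_mul_conjTranspose hS
  set κ : ℝ := ‖C.det‖ ^ 2 with hκ
  have hκpos : 0 < κ := by
    have : C.det ≠ 0 := by
      rw [Matrix.isUnit_iff_isUnit_det] at hCu; exact hCu.ne_zero
    positivity
  set T := congruence (n := n) C with hT
  have hTdet := congruence_det_ne_zero (n := n) hCu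
  -- the entries of the complemented tuple
  have hY : ∀ (x : Idx n d → ℝ) (r : Fin (n + 1)),
      Zmat (completeTuple (T x, s)) r = C * Zfull x r * C.conjTranspose := by
    intro x r
    refine Fin.lastCases ?_ (fun p => ?_) r
    · rw [Zmat_completeTuple_last, Zfull_last, hC]
      simp only [hT, Zmat_congruence, Matrix.mul_sub, Matrix.sub_mul, Finset.mul_sum,
        Finset.sum_mul, Matrix.mul_one]
    · rw [Zmat_completeTuple_castSucc, Zfull_castSucc, hT, Zmat_congruence]
  have hdet : ∀ (x : Idx n d → ℝ) (r : Fin (n + 1)),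
      (Zmat (completeTuple (T x, s)) r).det.re = κ * (Zfull x r).det.re := by
    intro x r
    rw [hY, Matrix.det_mul, Matrix.det_mul, Matrix.det_conjTranspose, mul_right_comm,
      Complex.star_def, Complex.mul_conj', ← Complex.ofReal_pow, Complex.re_ofReal_mul]
  set K : ℝ := ∏ r, κ ^ (b r - 1) with hK
  have hKpos : 0 < K := Finset.prod_pos fun r _ => Real.rpow_pos_of_pos hκpos _
  have hbound : ∀ x ∈ interior (matrixSimplex n d),
      ENNReal.ofReal (dirichletWeight b x)
        ≤ ENNReal.ofReal K⁻¹ * F (completeTuple (T x, s)) := by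
    intro x hx
    rw [mem_interior_matrixSimplex_iff hn] at hx
    have hYpos : ∀ r, (Zmat (completeTuple (T x, s)) r).PosDef := fun r => by
      rw [hY]
      exact (Matrix.IsUnit.posDef_star_right_conjugate_iff hCu).mpr (hx r)
    have hsum : ∑ r, (Zmat (completeTuple (T x, s)) r).trace.re ≤ d := by
      have h1 : ∑ r, Zmat (completeTuple (T x, s)) r = Zmat s 0 := by
        rw [Fin.sum_univ_castSucc, Zmat_completeTuple_last]
        simp only [Zmat_completeTuple_castSucc]
        abel
      rw [← Complex.re_sum, ← Matrix.trace_sum, h1]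
      have h2 := (Complex.le_def.mp hS1.posSemidef.trace_nonneg).1
      rw [Matrix.trace_sub, Matrix.trace_one] at h2
      simpa using h2
    have hbox : ∀ α, completeTuple (T x, s) α ∈ Set.Ioc (-R) R := by
      intro α
      have h1 := abs_coord_le (x := completeTuple (T x, s)) (p := α.1) (C := d) (fun i j =>
        (norm_apply_le_trace (hYpos α.1).posSemidef i j).trans (le_trans
          (Finset.single_le_sum (f := fun r => (Zmat (completeTuple (T x, s)) r).trace.re)
            (fun r _ => (Complex.le_def.mp (hYpos r).posSemidef.trace_nonneg).1)
            (Finset.mem_univ α.1)) hsum)) α.2.1 α.2.2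
      have h2 := abs_le.mp h1
      constructor <;> rw [hR]
      · have : completeTuple (T x, s) α = completeTuple (T x, s) (α.1, α.2.1, α.2.2) := rfl
        linarith [h2.1]
      · have : completeTuple (T x, s) α = completeTuple (T x, s) (α.1, α.2.1, α.2.2) := rfl
        linarith [h2.2]
    have hFx : F (completeTuple (T x, s)) = ENNReal.ofReal (K * dirichletWeight b x) := by
      rw [hFdef, boxWeight, Finset.prod_eq_one fun α _ => Set.indicator_of_mem (hbox α) _, one_mul,
        hK, dirichletWeight, ← Finset.prod_mul_distrib, ENNReal.ofReal_prod_of_nonneg]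
      · refine Finset.prod_congr rfl fun r _ => ?_
        rw [minorWeight, if_pos fun j _ => leadingMinor_pos j (hYpos r), leadingMinor,
          leadingBlock_self, hdet, Real.mul_rpow hκpos.le (det_re_pos (hx r)).le]
      · intro r _
        exact mul_nonneg (Real.rpow_nonneg hκpos.le _) (Real.rpow_nonneg (det_re_pos (hx r)).le _)
    rw [hFx, ← ENNReal.ofReal_mul (inv_nonneg.mpr hKpos.le), inv_mul_cancel_left₀ hKpos.ne']
  have hFs : Measurable fun x : Idx n d → ℝ => F (completeTuple (x, s)) := by
    refine hF.comp ?_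
    exact (completeTuple (n := n) (d := d)).toLinearMap.continuous_of_finiteDimensional.measurable.comp
      (measurable_id.prodMk measurable_const)
  have hTm : Measurable T := T.continuous_of_finiteDimensional.measurable
  calc ∫⁻ x in interior (matrixSimplex n d), ENNReal.ofReal (dirichletWeight b x)
      ≤ ∫⁻ x in interior (matrixSimplex n d), ENNReal.ofReal K⁻¹ * F (completeTuple (T x, s)) :=
        setLIntegral_mono' isOpen_interior.measurableSet hbound
    _ ≤ ∫⁻ x, ENNReal.ofReal K⁻¹ * F (completeTuple (T x, s)) := setLIntegral_le_lintegral _ _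
    _ = ENNReal.ofReal K⁻¹ * ∫⁻ x, F (completeTuple (T x, s)) :=
        lintegral_const_mul _ (hFs.comp hTm)
    _ = ENNReal.ofReal K⁻¹ * (ENNReal.ofReal |(LinearMap.det T)⁻¹|
          * ∫⁻ x, F (completeTuple (x, s))) := by
        rw [← lintegral_map hFs hTm, Measure.map_linearMap_addHaar_eq_smul_addHaar _ hTdet,
          lintegral_smul_measure, smul_eq_mul]
    _ < ⊤ := ENNReal.mul_lt_top ENNReal.ofReal_lt_top
        (ENNReal.mul_lt_top ENNReal.ofReal_lt_top hsfin)

lemma lintegral_dirichletWeight_lt_top (hn : 1 ≤ n) {a : Fin (n + 1) → ℝ} (ha : ∀ r, 0 < a r) :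
    ∫⁻ x in matrixSimplex n d, ENNReal.ofReal (dirichletWeight a x) < ⊤ := by
  rw [← setLIntegral_congr interior_ae_eq_matrixSimplex]
  set b : Fin (n + 1) → ℝ := fun r => min (a r) 1 with hb
  -- on the compact simplex the determinants are bounded, so exponents above one can be lowered
  have hK : ∀ r, ∃ K : ℝ, ∀ x ∈ matrixSimplex n d, (Zfull x r).det.re ≤ K := fun r => by
    have hc : Continuous fun x : Idx n d → ℝ => (Zfull x r).det.re :=
      (contDiff_det_re (k := 0) fun i j => contDiff_Zfull r i j).continuous
    obtain ⟨K, hK⟩ := (isCompact_matrixSimplex.image hc).isBounded.bddAbove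
    exact ⟨K, fun x hx => hK ⟨x, hx, rfl⟩⟩
  choose K hK using hK
  have hbound : ∀ x ∈ interior (matrixSimplex n d), ENNReal.ofReal (dirichletWeight a x)
      ≤ ENNReal.ofReal (∏ r, K r ^ (a r - b r)) * ENNReal.ofReal (dirichletWeight b x) := by
    intro x hx
    have hpos := fun r => det_re_pos ((mem_interior_matrixSimplex_iff hn x).mp hx r)
    have hKx := fun r => hK r x (interior_subset hx)
    rw [← ENNReal.ofReal_mul (Finset.prod_nonneg fun r _ =>
      Real.rpow_nonneg ((hpos r).le.trans (hKx r)) _)]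
    refine ENNReal.ofReal_le_ofReal ?_
    rw [dirichletWeight, dirichletWeight, ← Finset.prod_mul_distrib]
    refine Finset.prod_le_prod (fun r _ => Real.rpow_nonneg (hpos r).le _) fun r _ => ?_
    have h1 : a r - 1 = (a r - b r) + (b r - 1) := by ring
    rw [h1, Real.rpow_add (hpos r)]
    refine mul_le_mul_of_nonneg_right ?_ (Real.rpow_nonneg (hpos r).le _)
    exact Real.rpow_le_rpow (hpos r).le (hKx r) (sub_nonneg.mpr (min_le_left _ _))
  refine lt_of_le_of_lt (setLIntegral_mono' isOpen_interior.measurableSet hbound) ?_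
  rw [lintegral_const_mul _ (measurable_dirichletWeight b).ennreal_ofReal]
  exact ENNReal.mul_lt_top ENNReal.ofReal_lt_top (lintegral_dirichletWeight_lt_top_of_le_one hn
    (fun r => lt_min (ha r) one_pos) fun r => min_le_right _ _)

lemma lintegral_dirichletWeight_pos (hn : 1 ≤ n) (a : Fin (n + 1) → ℝ) :
    0 < ∫⁻ x in matrixSimplex n d, ENNReal.ofReal (dirichletWeight a x) := by
  rw [← setLIntegral_congr interior_ae_eq_matrixSimplex,
    setLIntegral_pos_iff (measurable_dirichletWeight a).ennreal_ofReal]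
  refine lt_of_lt_of_le (isOpen_interior.measure_pos volume
    (interior_matrixSimplex_nonempty (d := d) hn)) (measure_mono fun x hx => ⟨?_, hx⟩)
  simpa using dirichletWeight_pos hn a hx

/-- The normalized density of the Dirichlet measure. -/
def dirichletDensity (a : Fin (n + 1) → ℝ) (x : Idx n d → ℝ) : ℝ :=
  (∫⁻ x in matrixSimplex n d, ENNReal.ofReal (dirichletWeight a x)).toReal⁻¹ * dirichletWeight a x

lemma dirichletMeasure_eq_withDensity (hn : 1 ≤ n) {a : Fin (n + 1) → ℝ} (ha : ∀ r, 0 < a r) :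
    dirichletMeasure n d a = (volume.restrict (interior (matrixSimplex n d))).withDensity
      (fun x => ENNReal.ofReal (dirichletDensity a x)) := by
  have hpos := lintegral_dirichletWeight_pos (d := d) hn a
  have hfin := lintegral_dirichletWeight_lt_top (d := d) hn ha
  rw [dirichletMeasure, ← Measure.restrict_congr_set interior_ae_eq_matrixSimplex,
    ← withDensity_smul _ (measurable_dirichletWeight a).ennreal_ofReal]
  congr 1
  funext x
  rw [dirichletDensity, ENNReal.ofReal_mul (by positivity),
    ENNReal.ofReal_inv_of_pos (ENNReal.toReal_pos hpos.ne' hfin.ne), ENNReal.ofReal_toReal hfin.ne]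
  rw [Measure.restrict_congr_set interior_ae_eq_matrixSimplex]
  rfl

lemma isProbabilityMeasure_dirichletMeasure (hn : 1 ≤ n) {a : Fin (n + 1) → ℝ}
    (ha : ∀ r, 0 < a r) : IsProbabilityMeasure (dirichletMeasure n d a) := by
  refine ⟨?_⟩
  rw [dirichletMeasure, Measure.smul_apply, withDensity_apply _ MeasurableSet.univ,
    Measure.restrict_univ, smul_eq_mul]
  exact ENNReal.inv_mul_cancel (lintegral_dirichletWeight_pos hn a).ne'
    (lintegral_dirichletWeight_lt_top hn ha).ne

end TotalMass

/-! ### Regular boundary points -/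

section RegularPoints

variable {n d : ℕ}

/-- If `Z + v v^*` is positive definite, then `Z` has at most one nonpositive eigenvalue, so that
its positivity is decided by the sign of the determinant. -/
lemma posDef_of_det_pos {Z : Matrix (Fin d) (Fin d) ℂ} (v : Fin d → ℂ) (hZ : Z.IsHermitian)
    (hW : (Z + Matrix.vecMulVec v (star v)).PosDef) (hdet : 0 < Z.det.re) : Z.PosDef := by
  set W := Z + Matrix.vecMulVec v (star v) with hWdef
  set V : Matrix (Fin d) Unit ℂ := Matrix.replicateCol Unit v with hV
  have hVV : V * (1 : Matrix Unit Unit ℂ)⁻¹ * V.conjTranspose = Matrix.vecMulVec v (star v) := by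
    rw [inv_one, Matrix.mul_one, hV, Matrix.conjTranspose_replicateCol, Matrix.vecMulVec_eq Unit]
  have hZW : W - V * (1 : Matrix Unit Unit ℂ)⁻¹ * V.conjTranspose = Z := by
    rw [hVV, hWdef, add_sub_cancel_right]
  have hWu : Invertible W := hW.isUnit.invertible
  set S := (1 : Matrix Unit Unit ℂ) - V.conjTranspose * W⁻¹ * V with hS
  -- both Schur complements of the block matrix `[W, V; V^*, 1]`
  have hdet2 : Z.det = W.det * S.det := by
    have h1 := Matrix.det_fromBlocks₁₁ W V V.conjTranspose 1
    have h2 := Matrix.det_fromBlocks_one₂₂ W V V.conjTranspose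
    rw [inv_one, Matrix.mul_one] at hZW
    rw [h2, hZW] at h1
    rw [h1, hS, Matrix.invOf_eq_nonsing_inv]
  have hWd := hW.det_pos
  have hZd : 0 < Z.det := by
    rw [← ofReal_det_re hZ]; exact_mod_cast hdet
  have hSd : 0 < S.det := by
    rw [hdet2] at hZd
    exact (pos_iff_pos_of_mul_pos hZd).mp hWd
  have hSpsd : S.PosSemidef := by
    have : S = Matrix.diagonal fun _ => S.det := by
      ext i j
      rw [Subsingleton.elim i j, Matrix.diagonal_apply_eq, Matrix.det_unique]
    rw [this]
    exact Matrix.PosSemidef.diagonal fun _ => hSd.le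
  have hblock := (Matrix.PosDef.fromBlocks₁₁ V (1 : Matrix Unit Unit ℂ) hW).mpr hSpsd
  have : Invertible (1 : Matrix Unit Unit ℂ) := invertibleOne
  have hZpsd := (Matrix.PosDef.fromBlocks₂₂ W V Matrix.PosDef.one).mp hblock
  rw [hZW] at hZpsd
  exact hZpsd.posDef_iff_det_ne_zero.mpr hZd.ne'

lemma vecMulVec_star_isHermitian (v : Fin d → ℂ) : (Matrix.vecMulVec v (star v)).IsHermitian :=
  (Matrix.posSemidef_vecMulVec_self_star v).isHermitian

/-- The derivative of `t ↦ det (Z + t)` at a matrix with kernel spanned by `v`: from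
`(Z + t + v v^*) v = (|v|^2 + t) v` one gets `(|v|^2 + t) det (Z + t) = t det (Z + t + v v^*)`. -/
lemma deriv_det_add_smul_one_ne_zero {Z : Matrix (Fin d) (Fin d) ℂ} (v : Fin d → ℂ)
    (hW : (Z + Matrix.vecMulVec v (star v)).PosDef) (hZv : Z.mulVec v = 0) (hv : v ≠ 0) {f' : ℝ}
    (hf : HasDerivAt (fun t : ℝ => (Z + (t : ℂ) • (1 : Matrix (Fin d) (Fin d) ℂ)).det.re) f' 0) :
    f' ≠ 0 := by
  set c : ℂ := star v ⬝ᵥ v with hc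
  have hcpos : 0 < c := Matrix.dotProduct_star_self_pos_iff.mpr hv
  have hcre : ((c.re : ℝ) : ℂ) = c := (Complex.eq_re_of_ofReal_le hcpos.le).symm
  have hcre0 : 0 < c.re := (Complex.lt_def.mp hcpos).1
  set W : ℝ → Matrix (Fin d) (Fin d) ℂ := fun t =>
    Z + (t : ℂ) • (1 : Matrix (Fin d) (Fin d) ℂ) + Matrix.vecMulVec v (star v) with hWt
  have hsmooth : ContDiff ℝ 1 fun t : ℝ => (W t).det.re := by
    refine contDiff_det_re fun i j => ?_
    simp only [hWt, Matrix.add_apply, Matrix.smul_apply, smul_eq_mul]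
    exact (contDiff_const.add (Complex.ofRealCLM.contDiff.mul contDiff_const)).add contDiff_const
  have hW0 : 0 < (W 0).det.re := by
    simp only [hWt, Complex.ofReal_zero, zero_smul, add_zero]
    exact det_re_pos hW
  have hWv : ∀ t : ℝ, (W t).mulVec v = (c + t) • v := by
    intro t
    simp only [hWt, Matrix.add_mulVec, hZv, Matrix.smul_mulVec, Matrix.one_mulVec,
      Matrix.vecMulVec_mulVec]
    rw [zero_add, add_comm, add_smul]
    simp [hc]
  have hident : ∀ᶠ t : ℝ in 𝓝 0, (c.re + t) * (Z + (t : ℂ) • (1 : Matrix (Fin d) (Fin d) ℂ)).det.re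
      = t * (W t).det.re := by
    have h1 : ∀ᶠ t : ℝ in 𝓝 0, 0 < (W t).det.re :=
      hsmooth.continuous.continuousAt.eventually (lt_mem_nhds hW0)
    have h2 : ∀ᶠ t : ℝ in 𝓝 0, 0 < c.re + t := by
      have : Continuous fun t : ℝ => c.re + t := by fun_prop
      exact this.continuousAt.eventually (lt_mem_nhds (by simpa using hcre0))
    filter_upwards [h1, h2] with t ht1 ht2
    have hu : IsUnit (W t).det := by
      rw [isUnit_iff_ne_zero]
      intro h
      rw [h] at ht1
      simp at ht1
    have hct : c + (t : ℂ) ≠ 0 := by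
      rw [← hcre, ← Complex.ofReal_add]
      exact_mod_cast ht2.ne'
    have hinv : (W t)⁻¹.mulVec v = (c + t)⁻¹ • v := by
      have h3 := congrArg (fun u => (c + (t : ℂ))⁻¹ • (W t)⁻¹.mulVec u) (hWv t)
      simp only [Matrix.mulVec_mulVec, Matrix.nonsing_inv_mul _ hu, Matrix.one_mulVec,
        Matrix.mulVec_smul, smul_smul, inv_mul_cancel₀ hct, one_smul] at h3
      exact h3.symm
    have h4 := Matrix.det_add_replicateCol_mul_replicateRow (ι := Unit) hu (-v) (star v)
    have h5 : W t + Matrix.replicateCol Unit (-v) * Matrix.replicateRow Unit (star v)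
        = Z + (t : ℂ) • (1 : Matrix (Fin d) (Fin d) ℂ) := by
      rw [← Matrix.vecMulVec_eq Unit, Matrix.neg_vecMulVec]
      simp [hWt]
    rw [h5] at h4
    have h6 : (1 + Matrix.replicateRow Unit (star v) * (W t)⁻¹
        * Matrix.replicateCol Unit (-v)).det = (t : ℂ) / (c + t) := by
      rw [Matrix.det_unique]
      have h7 : (Matrix.replicateRow Unit (star v) * (W t)⁻¹ * Matrix.replicateCol Unit (-v))
          default default = -(star v ⬝ᵥ (W t)⁻¹.mulVec v) := by
        rw [Matrix.mul_assoc, ← Matrix.replicateCol_mulVec]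
        simp [Matrix.mul_apply, dotProduct, Matrix.mulVec_neg]
      rw [Matrix.add_apply, h7, hinv, dotProduct_smul, ← hc]
      simp only [Matrix.one_apply_eq, smul_eq_mul]
      field_simp
      ring
    rw [h6] at h4
    have h8 : ((c.re + t : ℝ) : ℂ) * (Z + (t : ℂ) • (1 : Matrix (Fin d) (Fin d) ℂ)).det
        = (t : ℂ) * (W t).det := by
      rw [h4, Complex.ofReal_add, hcre]
      field_simp
    have h9 := congrArg Complex.re h8
    rwa [Complex.re_ofReal_mul, Complex.re_ofReal_mul] at h9
  have hZ0 : Z.det = 0 := Matrix.exists_mulVec_eq_zero_iff.mp ⟨v, hv, hZv⟩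
  have hd1 := ((hasDerivAt_id (0 : ℝ)).const_add c.re).mul hf
  have hd2 := (hasDerivAt_id (0 : ℝ)).mul
    (hsmooth.differentiable (by norm_num) 0).hasDerivAt
  have huniq := (hd1.congr_of_eventuallyEq (Filter.EventuallyEq.symm hident)).unique hd2
  simp [hZ0] at huniq
  intro h0
  rw [h0] at huniq
  simp at huniq
  exact hW0.ne' huniq.symm

/-- Near a boundary point of total corank one, the simplex is bounded by the smooth hypersurface
`det Z^{(r)} = 0`. -/
lemma exists_defining_function (hn : 1 ≤ n) {x : Idx n d → ℝ} {r : Fin (n + 1)} {v : Fin d → ℂ}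
    (hv : v ≠ 0) (hZv : (Zfull x r).mulVec v = 0)
    (hW : (Zfull x r + Matrix.vecMulVec v (star v)).PosDef)
    (hs : ∀ s, s ≠ r → (Zfull x s).PosDef) :
    ∃ U : Set (Idx n d → ℝ), IsOpen U ∧ x ∈ U ∧ ∃ φ : (Idx n d → ℝ) → ℝ, ContDiffOn ℝ 1 φ U ∧
      (∀ y ∈ U, fderiv ℝ φ y ≠ 0) ∧ ∀ y ∈ U, y ∈ interior (matrixSimplex n d) ↔ 0 < φ y := by
  set φ : (Idx n d → ℝ) → ℝ := fun y => (Zfull y r).det.re with hφ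
  have hφs : ContDiff ℝ 1 φ := contDiff_det_re fun i j => contDiff_Zfull r i j
  set U₁ : Set (Idx n d → ℝ) := {y | (Zfull y r + Matrix.vecMulVec v (star v)).PosDef} ∩
    ⋂ s : {s // s ≠ r}, {y | (Zfull y s).PosDef} with hU₁
  have hU₁o : IsOpen U₁ := by
    refine IsOpen.inter ?_ (isOpen_iInter_of_finite fun s =>
      isOpen_setOf_posDef (continuous_Zfull s.1) fun y => Zfull_isHermitian y s.1)
    exact isOpen_setOf_posDef ((continuous_Zfull r).add continuous_const) fun y =>
      (Zfull_isHermitian y r).add (vecMulVec_star_isHermitian v)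
  set U₂ : Set (Idx n d → ℝ) := {y | fderiv ℝ φ y ≠ 0} with hU₂
  have hU₂o : IsOpen U₂ := isOpen_ne_fun (hφs.continuous_fderiv (by norm_num)) continuous_const
  refine ⟨U₁ ∩ U₂, hU₁o.inter hU₂o, ⟨⟨hW, ?_⟩, ?_⟩, φ, hφs.contDiffOn, fun y hy => hy.2, ?_⟩
  · simpa using hs
  · intro h0
    obtain ⟨e, he⟩ := exists_shift (d := d) hn r
    have hline : HasDerivAt (fun t : ℝ => x + t • e) e 0 := by
      simpa using ((hasDerivAt_id (0 : ℝ)).smul_const e).const_add x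
    have hx0 : x + (0 : ℝ) • e = x := by simp
    have hder : HasFDerivAt φ (fderiv ℝ φ x) (x + (0 : ℝ) • e) := by
      rw [hx0]; exact (hφs.differentiable (by norm_num) x).hasFDerivAt
    have hcomp := hder.comp_hasDerivAt (0 : ℝ) hline
    rw [h0] at hcomp
    have hcomp' : HasDerivAt
        (fun t : ℝ => (Zfull x r + (t : ℂ) • (1 : Matrix (Fin d) (Fin d) ℂ)).det.re) 0 0 := by
      have : (fun t : ℝ => (Zfull x r + (t : ℂ) • (1 : Matrix (Fin d) (Fin d) ℂ)).det.re)
          = φ ∘ fun t : ℝ => x + t • e := by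
        funext t; simp [hφ, he]
      rw [this]
      simpa using hcomp
    exact deriv_det_add_smul_one_ne_zero v hW hZv hv hcomp' rfl
  · rintro y ⟨⟨hy1, hy2⟩, -⟩
    rw [mem_interior_matrixSimplex_iff hn]
    constructor
    · exact fun h => det_re_pos (h r)
    · intro h s
      by_cases hsr : s = r
      · subst hsr
        exact posDef_of_det_pos v (Zfull_isHermitian y s) hy1 h
      · exact Set.mem_iInter.mp hy2 ⟨s, hsr⟩

/-- Total corank at least two: two of the matrices are singular, or one of them has a kernel of
dimension at least two. -/
def IsDeepPoint (x : Idx n d → ℝ) : Prop :=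
  (∃ r s, r ≠ s ∧ (∃ v, v ≠ 0 ∧ (Zfull x r).mulVec v = 0) ∧ ∃ w, w ≠ 0 ∧ (Zfull x s).mulVec w = 0) ∨
  ∃ r v w, v ≠ 0 ∧ (∀ c : ℂ, w ≠ c • v) ∧ (Zfull x r).mulVec v = 0 ∧ (Zfull x r).mulVec w = 0

/-- At a boundary point which is not deep exactly one `Z^{(r)}` is singular, with a kernel spanned by
one vector `v`, so that `Z^{(r)} + v v^*` is positive definite. -/
lemma exists_defining_function_of_not_isDeepPoint (hn : 1 ≤ n) {x : Idx n d → ℝ}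
    (hx : x ∈ frontier (interior (matrixSimplex n d))) (hdeep : ¬ IsDeepPoint x) :
    ∃ U : Set (Idx n d → ℝ), IsOpen U ∧ x ∈ U ∧ ∃ φ : (Idx n d → ℝ) → ℝ, ContDiffOn ℝ 1 φ U ∧
      (∀ y ∈ U, fderiv ℝ φ y ≠ 0) ∧ ∀ y ∈ U, y ∈ interior (matrixSimplex n d) ↔ 0 < φ y := by
  have hxΔ : x ∈ matrixSimplex n d :=
    (closure_minimal interior_subset isClosed_matrixSimplex) (frontier_subset_closure hx)
  have hxi : x ∉ interior (matrixSimplex n d) := by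
    rw [isOpen_interior.frontier_eq] at hx; exact hx.2
  rw [mem_matrixSimplex_iff] at hxΔ
  rw [mem_interior_matrixSimplex_iff hn] at hxi
  push Not at hxi
  obtain ⟨r, hr⟩ := hxi
  have hker : ∀ s, ¬ (Zfull x s).PosDef → ∃ v, v ≠ 0 ∧ (Zfull x s).mulVec v = 0 := fun s hs => by
    rw [(hxΔ s).posDef_iff_det_ne_zero, not_not] at hs
    exact Matrix.exists_mulVec_eq_zero_iff.mpr hs
  obtain ⟨v, hv, hZv⟩ := hker r hr
  refine exists_defining_function hn hv hZv ?_ fun s hs => ?_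
  · have hpsd := (hxΔ r).add (Matrix.posSemidef_vecMulVec_self_star v)
    rw [hpsd.posDef_iff_det_ne_zero]
    intro hdet
    obtain ⟨w, hw, hw0⟩ := Matrix.exists_mulVec_eq_zero_iff.mpr hdet
    have h1 : star w ⬝ᵥ (Zfull x r).mulVec w
        + star w ⬝ᵥ (Matrix.vecMulVec v (star v)).mulVec w = 0 := by
      rw [← dotProduct_add, ← Matrix.add_mulVec, hw0, dotProduct_zero]
    have h2 := (hxΔ r).dotProduct_mulVec_nonneg w
    have h3 := (Matrix.posSemidef_vecMulVec_self_star v).dotProduct_mulVec_nonneg w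
    obtain ⟨h4, h5⟩ := (add_eq_zero_iff_of_nonneg h2 h3).mp h1
    rw [(hxΔ r).dotProduct_mulVec_zero_iff] at h4
    rw [(Matrix.posSemidef_vecMulVec_self_star v).dotProduct_mulVec_zero_iff,
      Matrix.vecMulVec_mulVec] at h5
    refine hdeep (Or.inr ⟨r, v, w, hv, fun c hc => ?_, hZv, h4⟩)
    have hvw : star v ⬝ᵥ w = 0 := by
      by_contra hne
      refine hv ?_
      funext i
      have := congrFun h5 i
      simpa [hne] using this
    rw [hc, dotProduct_smul, smul_eq_mul, mul_eq_zero] at hvw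
    rcases hvw with hc0 | hvv
    · exact hw (by rw [hc, hc0, zero_smul])
    · exact hv (dotProduct_star_self_eq_zero.mp hvv)
  · by_contra hs'
    exact hdeep (Or.inl ⟨r, s, hs.symm, ⟨v, hv, hZv⟩, hker s hs'⟩)

end RegularPoints

/-! ### Parametrization of singular Hermitian matrices -/

section SingularParametrization

variable {d : ℕ}

/-- The orthogonal projection onto the `i`-th coordinate axis. -/
def axisProj (i : Fin d) : Matrix (Fin d) (Fin d) ℂ :=
  Matrix.diagonal fun a => if a = i then 1 else 0

/-- The matrix `v e_i^*`, where `v_i = 1` and the other entries of `v` are those of the `i`-th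
column of `X`. -/
def columnMatrix (i : Fin d) (X : Matrix (Fin d) (Fin d) ℂ) : Matrix (Fin d) (Fin d) ℂ :=
  axisProj i + (1 - axisProj i) * X * axisProj i

/-- The Hermitian matrix whose kernel contains the vector `v` of `columnMatrix i X`, and which
agrees with `X` outside of the `i`-th row and column. The entry `X i i` is not used. -/
def singularOf (i : Fin d) (X : Matrix (Fin d) (Fin d) ℂ) : Matrix (Fin d) (Fin d) ℂ :=
  (1 - columnMatrix i X).conjTranspose * X * (1 - columnMatrix i X)

/-- A right inverse of `singularOf`. -/
def singularLift (i : Fin d) (Z : Matrix (Fin d) (Fin d) ℂ) (v : Fin d → ℂ) :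
    Matrix (Fin d) (Fin d) ℂ :=
  (1 - axisProj i) * Z * (1 - axisProj i) + (1 - axisProj i) * Matrix.vecMulVec v (Pi.single i 1)
    + (Matrix.vecMulVec v (Pi.single i 1)).conjTranspose * (1 - axisProj i)

lemma axisProj_conjTranspose (i : Fin d) : (axisProj i).conjTranspose = axisProj i := by
  rw [axisProj, Matrix.diagonal_conjTranspose]
  congr 1
  funext a
  by_cases h : a = i <;> simp [h]

lemma axisProj_mul_self (i : Fin d) : axisProj i * axisProj i = axisProj i := by
  rw [axisProj, Matrix.diagonal_mul_diagonal]
  congr 1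
  funext a
  by_cases h : a = i <;> simp [h]

lemma compl_mul_axisProj (i : Fin d) : (1 - axisProj i) * axisProj i = 0 := by
  rw [Matrix.sub_mul, Matrix.one_mul, axisProj_mul_self, sub_self]

lemma compl_mul_compl (i : Fin d) : (1 - axisProj i) * (1 - axisProj i) = 1 - axisProj i := by
  rw [Matrix.mul_sub, Matrix.mul_one, compl_mul_axisProj, sub_zero]

lemma compl_conjTranspose (i : Fin d) : (1 - axisProj i).conjTranspose = 1 - axisProj i := by
  rw [Matrix.conjTranspose_sub, Matrix.conjTranspose_one, axisProj_conjTranspose]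

lemma compl_mul_apply (i : Fin d) (X : Matrix (Fin d) (Fin d) ℂ) (a b : Fin d) :
    ((1 - axisProj i) * X) a b = if a = i then 0 else X a b := by
  rw [Matrix.sub_mul, Matrix.one_mul, axisProj, Matrix.sub_apply, Matrix.diagonal_mul]
  by_cases h : a = i <;> simp [h]

lemma mul_compl_apply (i : Fin d) (X : Matrix (Fin d) (Fin d) ℂ) (a b : Fin d) :
    (X * (1 - axisProj i)) a b = if b = i then 0 else X a b := by
  rw [Matrix.mul_sub, Matrix.mul_one, axisProj, Matrix.sub_apply, Matrix.mul_diagonal]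
  by_cases h : b = i <;> simp [h]

lemma mul_axisProj_apply (i : Fin d) (X : Matrix (Fin d) (Fin d) ℂ) (a b : Fin d) :
    (X * axisProj i) a b = if b = i then X a b else 0 := by
  rw [axisProj, Matrix.mul_diagonal]
  by_cases h : b = i <;> simp [h]

lemma compl_mul_one_sub_columnMatrix (i : Fin d) (X : Matrix (Fin d) (Fin d) ℂ) :
    (1 - axisProj i) * (1 - columnMatrix i X) = 1 - columnMatrix i X := by
  rw [columnMatrix, Matrix.mul_sub, Matrix.mul_add, compl_mul_axisProj, Matrix.mul_one,
    Matrix.mul_assoc (1 - axisProj i) X, ← Matrix.mul_assoc (1 - axisProj i) (1 - axisProj i),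
    compl_mul_compl]
  abel

lemma columnMatrix_congr {i : Fin d} {X Y : Matrix (Fin d) (Fin d) ℂ}
    (h : ∀ a, a ≠ i → X a i = Y a i) : columnMatrix i X = columnMatrix i Y := by
  rw [columnMatrix, columnMatrix]
  congr 1
  ext a b
  rw [mul_axisProj_apply, mul_axisProj_apply, compl_mul_apply, compl_mul_apply]
  by_cases hb : b = i
  · by_cases ha : a = i
    · simp [ha]
    · simp [ha, hb, h a ha]
  · simp [hb]

lemma singularOf_congr {i : Fin d} {X Y : Matrix (Fin d) (Fin d) ℂ}
    (h : ∀ a b, ¬ (a = i ∧ b = i) → X a b = Y a b) : singularOf i X = singularOf i Y := by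
  have hc : columnMatrix i X = columnMatrix i Y :=
    columnMatrix_congr fun a ha => h a i fun h' => ha h'.1
  have hP : (1 - axisProj i) * X = (1 - axisProj i) * Y := by
    ext a b
    rw [compl_mul_apply, compl_mul_apply]
    by_cases ha : a = i
    · simp [ha]
    · simp [ha, h a b fun h' => ha h'.1]
  have key : ∀ W, (1 - columnMatrix i Y).conjTranspose * W
      = (1 - columnMatrix i Y).conjTranspose * ((1 - axisProj i) * W) := fun W => by
    nth_rw 1 [← compl_mul_one_sub_columnMatrix]
    rw [Matrix.conjTranspose_mul, compl_conjTranspose, Matrix.mul_assoc]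
  rw [singularOf, singularOf, hc, key X, key Y, hP]

section Lift

variable {i : Fin d} {Z : Matrix (Fin d) (Fin d) ℂ} {v : Fin d → ℂ}

lemma axisProj_mul_vecMulVec (hv : v i = 1) :
    axisProj i * Matrix.vecMulVec v (Pi.single i 1) = axisProj i := by
  ext a b
  rw [axisProj, Matrix.diagonal_mul, Matrix.vecMulVec_apply, Matrix.diagonal_apply, Pi.single_apply]
  by_cases ha : a = i
  · subst ha; simp [hv, eq_comm]
  · simp [ha]

lemma vecMulVec_mul_axisProj :
    Matrix.vecMulVec v (Pi.single i 1) * axisProj i = Matrix.vecMulVec v (Pi.single i 1) := by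
  ext a b
  rw [mul_axisProj_apply, Matrix.vecMulVec_apply, Pi.single_apply]
  by_cases hb : b = i <;> simp [hb]

lemma singularLift_isHermitian (hZ : Z.IsHermitian) : (singularLift i Z v).IsHermitian := by
  rw [Matrix.IsHermitian, singularLift]
  simp only [Matrix.conjTranspose_add, Matrix.conjTranspose_mul, compl_conjTranspose, hZ.eq,
    Matrix.conjTranspose_conjTranspose, Matrix.mul_assoc]
  abel

lemma compl_mul_singularLift_mul_axisProj (hv : v i = 1) :
    (1 - axisProj i) * singularLift i Z v * axisProj i
      = Matrix.vecMulVec v (Pi.single i 1) - axisProj i := by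
  have h1 := compl_mul_axisProj i
  have h2 := compl_mul_compl i
  set P := 1 - axisProj i with hP
  set V := Matrix.vecMulVec v (Pi.single i 1) with hV
  rw [singularLift, ← hP, ← hV]
  have : P * (P * Z * P + P * V + V.conjTranspose * P) * axisProj i
      = (P * P) * Z * (P * axisProj i) + (P * P) * (V * axisProj i)
        + P * V.conjTranspose * (P * axisProj i) := by
    noncomm_ring
  have h3 : V * axisProj i = V := vecMulVec_mul_axisProj
  have h4 : P * V = V - axisProj i := by
    rw [hP, Matrix.sub_mul, Matrix.one_mul, hV, axisProj_mul_vecMulVec hv]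
  rw [this, h1, h2, h3, h4]
  simp

lemma columnMatrix_singularLift (hv : v i = 1) :
    columnMatrix i (singularLift i Z v) = Matrix.vecMulVec v (Pi.single i 1) := by
  rw [columnMatrix, compl_mul_singularLift_mul_axisProj hv]
  abel

/-- If `Z v = 0`, then `Z` is unchanged by the congruence by `1 - v e_i^*`. -/
lemma conjTranspose_mul_mul_of_mulVec_eq_zero (hZ : Z.IsHermitian) (hZv : Z.mulVec v = 0) :
    (1 - Matrix.vecMulVec v (Pi.single i 1)).conjTranspose * Z
      * (1 - Matrix.vecMulVec v (Pi.single i 1)) = Z := by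
  have h1 : Z * (1 - Matrix.vecMulVec v (Pi.single i 1)) = Z := by
    rw [Matrix.mul_sub, Matrix.mul_one, Matrix.mul_vecMulVec, hZv, Matrix.zero_vecMulVec, sub_zero]
  have h2 := congrArg Matrix.conjTranspose h1
  rw [Matrix.conjTranspose_mul, hZ.eq] at h2
  rw [h2, h1]

lemma singularOf_singularLift (hZ : Z.IsHermitian) (hv : v i = 1) (hZv : Z.mulVec v = 0) :
    singularOf i (singularLift i Z v) = Z := by
  have hred := compl_mul_one_sub_columnMatrix i (singularLift i Z v)
  have hred' := congrArg Matrix.conjTranspose hred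
  rw [Matrix.conjTranspose_mul, compl_conjTranspose] at hred'
  rw [singularOf]
  rw [columnMatrix_singularLift hv] at *
  have hVV : Matrix.vecMulVec v (Pi.single i 1) * (1 - Matrix.vecMulVec v (Pi.single i 1)) = 0 := by
    rw [Matrix.mul_sub, Matrix.mul_one, Matrix.vecMulVec_mul_vecMulVec]
    simp [hv]
  have hVV' := congrArg Matrix.conjTranspose hVV
  rw [Matrix.conjTranspose_mul, Matrix.conjTranspose_zero] at hVV'
  rw [singularLift]
  set P := 1 - axisProj i
  set V := Matrix.vecMulVec v (Pi.single i 1) with hV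
  have : (1 - V).conjTranspose * (P * Z * P + P * V + V.conjTranspose * P) * (1 - V)
      = (1 - V).conjTranspose * P * Z * (P * (1 - V)) + (1 - V).conjTranspose * P * (V * (1 - V))
        + ((1 - V).conjTranspose * V.conjTranspose) * P * (1 - V) := by
    noncomm_ring
  rw [this, hred, hred', hVV, hVV', hV, conjTranspose_mul_mul_of_mulVec_eq_zero hZ hZv]
  simp

end Lift

/-- Hermitian matrices `Z` with a vector `v` in the kernel, such that the compression of
`Z - ε (1 - v v^* / |v|^2)` to `v^⊥` is singular. For `ε = 0` this means that the kernel of `Z` has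
dimension at least two; for `ε = 1` that `0` and `1` are eigenvalues of `Z`. The entries `X i i`
and `X j j` are not used. -/
def doublySingularOf (ε : ℝ) (i j : Fin d) (X : Matrix (Fin d) (Fin d) ℂ) :
    Matrix (Fin d) (Fin d) ℂ :=
  (1 - columnMatrix i X).conjTranspose *
    (singularOf j ((1 - axisProj i) * X * (1 - axisProj i)) + (ε : ℂ) • (1 -
      (columnMatrix i X * (columnMatrix i X).conjTranspose).trace⁻¹ •
        (columnMatrix i X * (columnMatrix i X).conjTranspose))) * (1 - columnMatrix i X)

lemma doublySingularOf_congr {ε : ℝ} {i j : Fin d} {X Y : Matrix (Fin d) (Fin d) ℂ}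
    (h : ∀ a b, ¬ (a = i ∧ b = i) → ¬ (a = j ∧ b = j) → X a b = Y a b) :
    doublySingularOf ε i j X = doublySingularOf ε i j Y := by
  have hc : columnMatrix i X = columnMatrix i Y := columnMatrix_congr fun a ha =>
    h a i (fun h' => ha h'.1) fun h' => ha (h'.1.trans h'.2.symm)
  have hs : singularOf j ((1 - axisProj i) * X * (1 - axisProj i))
      = singularOf j ((1 - axisProj i) * Y * (1 - axisProj i)) := by
    refine singularOf_congr fun a b hab => ?_
    rw [mul_compl_apply, mul_compl_apply, compl_mul_apply, compl_mul_apply]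
    by_cases ha : a = i
    · simp [ha]
    · simp [ha, h a b (fun h' => ha h'.1) hab]
  rw [doublySingularOf, doublySingularOf, hc, hs]

/-- Surjectivity of `doublySingularOf` on the matrices it describes. The preimage carries the kernel
vector `v` in its `i`-th column, and lifts the compression of `Z - ε (1 - v v^* / |v|^2)` to the
coordinates other than `i`, whose kernel contains `y`, by `singularLift j`. -/
lemma exists_doublySingularOf_eq {ε : ℝ} {i j : Fin d} {Z : Matrix (Fin d) (Fin d) ℂ}
    (hZ : Z.IsHermitian) {v y : Fin d → ℂ} (hv : v i = 1) (hZv : Z.mulVec v = 0) (hyi : y i = 0)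
    (hyj : y j = 1)
    (hy : (Z - (ε : ℂ) • (1 - (Matrix.vecMulVec v (star v)).trace⁻¹ •
      Matrix.vecMulVec v (star v))).mulVec y = 0) :
    ∃ X : Matrix (Fin d) (Fin d) ℂ, X.IsHermitian ∧ doublySingularOf ε i j X = Z := by
  set V := Matrix.vecMulVec v (Pi.single i (1 : ℂ)) with hV
  set P := 1 - axisProj i with hP
  have hVVh : V * V.conjTranspose = Matrix.vecMulVec v (star v) := by
    rw [hV, Matrix.conjTranspose_vecMulVec, Matrix.vecMulVec_mul_vecMulVec]
    simp
  set Q := 1 - (Matrix.vecMulVec v (star v)).trace⁻¹ • Matrix.vecMulVec v (star v) with hQ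
  have hQh : Q.IsHermitian := by
    have h1 := vecMulVec_star_isHermitian v
    have h2 : star (Matrix.vecMulVec v (star v)).trace = (Matrix.vecMulVec v (star v)).trace := by
      rw [← Matrix.trace_conjTranspose, h1.eq]
    rw [Matrix.IsHermitian, hQ, Matrix.conjTranspose_sub, Matrix.conjTranspose_smul, h1.eq,
      Matrix.conjTranspose_one, star_inv₀, h2]
  have hKh' : (Z - (ε : ℂ) • Q).IsHermitian := by
    rw [Matrix.IsHermitian, Matrix.conjTranspose_sub, Matrix.conjTranspose_smul, hZ.eq, hQh.eq]
    simp
  set K := P * (Z - (ε : ℂ) • Q) * P with hK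
  have hPh : P.conjTranspose = P := compl_conjTranspose i
  have hPP : P * P = P := compl_mul_compl i
  have hKh : K.IsHermitian := by
    have := Matrix.isHermitian_mul_mul_conjTranspose P hKh'
    rwa [hPh] at this
  have hPy : P.mulVec y = y := by
    rw [hP, Matrix.sub_mulVec, Matrix.one_mulVec, axisProj]
    funext a
    rw [Pi.sub_apply, Matrix.mulVec_diagonal]
    by_cases ha : a = i
    · subst ha; simp [hyi]
    · simp [ha]
  have hKy : K.mulVec y = 0 := by
    rw [hK, ← Matrix.mulVec_mulVec, hPy, ← Matrix.mulVec_mulVec, hy, Matrix.mulVec_zero]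
  set X₁ := singularLift j K y with hX₁
  have hX₁h : X₁.IsHermitian := singularLift_isHermitian hKh
  have hcomm : P * (1 - axisProj j) = (1 - axisProj j) * P := by
    ext a b
    rw [hP, compl_mul_apply, mul_compl_apply, Matrix.sub_apply, axisProj, Matrix.diagonal_apply]
    by_cases hab : a = b
    · subst hab; rfl
    · simp [hab]
  have hPX₁ : P * X₁ = X₁ := by
    have h1 : P * K = K := by rw [hK, ← Matrix.mul_assoc, ← Matrix.mul_assoc, hPP]
    have h2 : P * Matrix.vecMulVec y (Pi.single j 1) = Matrix.vecMulVec y (Pi.single j 1) := by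
      rw [Matrix.mul_vecMulVec, hPy]
    have h3 : (Matrix.vecMulVec y (Pi.single j (1 : ℂ))).conjTranspose * (1 - axisProj j)
        = Matrix.vecMulVec (Pi.single j 1) (star y) * (1 - axisProj j) := by
      rw [Matrix.conjTranspose_vecMulVec]; simp
    by_cases hij : j = i
    · subst hij; rw [hyi] at hyj; exact absurd hyj zero_ne_one
    have h4 : P * Matrix.vecMulVec (Pi.single j 1) (star y) = Matrix.vecMulVec (Pi.single j 1) (star y) := by
      ext a b
      rw [hP, compl_mul_apply, Matrix.vecMulVec_apply]
      by_cases ha : a = i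
      · subst ha; simp [Ne.symm hij]
      · simp [ha]
    rw [hX₁, singularLift, h3, Matrix.mul_add, Matrix.mul_add, ← Matrix.mul_assoc P _ (1 - axisProj j),
      ← Matrix.mul_assoc P _ K, hcomm, Matrix.mul_assoc _ P K, h1, ← Matrix.mul_assoc P _ (Matrix.vecMulVec y _),
      hcomm, Matrix.mul_assoc _ P (Matrix.vecMulVec y _), h2, ← Matrix.mul_assoc P _ (1 - axisProj j), h4]
  have hX₁P : X₁ * P = X₁ := by
    have := congrArg Matrix.conjTranspose hPX₁
    rwa [Matrix.conjTranspose_mul, hX₁h.eq, hPh] at this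
  -- `X` carries the vector `v` in its `i`-th column, `y` in its `j`-th column
  set X := X₁ + P * V + V.conjTranspose * P with hX
  have hPE : P * axisProj i = 0 := compl_mul_axisProj i
  have hVE : V * axisProj i = V := vecMulVec_mul_axisProj
  have hVP : V * P = 0 := by rw [hP, Matrix.mul_sub, Matrix.mul_one, hVE, sub_self]
  have hPVh : P * V.conjTranspose = 0 := by
    have := congrArg Matrix.conjTranspose hVP
    rwa [Matrix.conjTranspose_mul, hPh, Matrix.conjTranspose_zero] at this
  have hPXP : P * X * P = X₁ := by
    have : P * X * P = P * X₁ * P + P * P * (V * P) + P * V.conjTranspose * P * P := by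
      rw [hX]; noncomm_ring
    rw [this, hVP, hPVh, hPX₁, hX₁P]; simp
  have hcol : columnMatrix i X = V := by
    have h1 : P * X * axisProj i = P * X₁ * axisProj i + P * P * (V * axisProj i)
        + P * V.conjTranspose * (P * axisProj i) := by
      rw [hX]; noncomm_ring
    have h2 : X₁ * axisProj i = 0 := by rw [← hX₁P, Matrix.mul_assoc, hPE, Matrix.mul_zero]
    rw [columnMatrix, ← hP, h1, hPE, hVE, hPX₁, h2, hPP, hP, Matrix.sub_mul, hV,
      axisProj_mul_vecMulVec hv]
    simp
  refine ⟨X, ?_, ?_⟩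
  · rw [Matrix.IsHermitian, hX, Matrix.conjTranspose_add, Matrix.conjTranspose_add, hX₁h.eq,
      Matrix.conjTranspose_mul, Matrix.conjTranspose_mul, hPh, Matrix.conjTranspose_conjTranspose]
    abel
  · have hred := compl_mul_one_sub_columnMatrix i X
    rw [hcol, ← hP] at hred
    have hred' := congrArg Matrix.conjTranspose hred
    rw [Matrix.conjTranspose_mul, hPh] at hred'
    rw [doublySingularOf, hcol, ← hP, hPXP, hX₁, singularOf_singularLift hKh hyj hKy, hVVh, ← hQ]
    have : (1 - V).conjTranspose * (K + (ε : ℂ) • Q) * (1 - V)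
        = ((1 - V).conjTranspose * P) * (Z - (ε : ℂ) • Q) * (P * (1 - V))
          + (1 - V).conjTranspose * ((ε : ℂ) • Q) * (1 - V) := by
      rw [hK]; noncomm_ring
    rw [this, hred, hred', ← Matrix.add_mul, ← Matrix.mul_add, sub_add_cancel, hV,
      conjTranspose_mul_mul_of_mulVec_eq_zero hZ hZv]

end SingularParametrization

/-! ### The deep boundary points form a negligible set -/

section SmoothMatrices

variable {X : Type*} [NormedAddCommGroup X] [NormedSpace ℝ X] {d : ℕ}

/-- A matrix-valued map with entries of class `C¹`. -/
def ContDiffMatrix (M : X → Matrix (Fin d) (Fin d) ℂ) : Prop :=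
  ∀ i j, ContDiff ℝ 1 fun x => M x i j

lemma contDiffMatrix_const (C : Matrix (Fin d) (Fin d) ℂ) : ContDiffMatrix fun _ : X => C :=
  fun _ _ => contDiff_const

lemma trace_columnMatrix_mul_conjTranspose_ne_zero (i : Fin d) (Y : Matrix (Fin d) (Fin d) ℂ) :
    (columnMatrix i Y * (columnMatrix i Y).conjTranspose).trace ≠ 0 := by
  rw [Ne, Matrix.trace_mul_conjTranspose_self_eq_zero_iff]
  intro h
  have := congrFun (congrFun h i) i
  rw [columnMatrix, Matrix.add_apply, mul_axisProj_apply, compl_mul_apply] at this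
  simp [axisProj] at this

namespace ContDiffMatrix

variable {M N : X → Matrix (Fin d) (Fin d) ℂ}

lemma add (hM : ContDiffMatrix M) (hN : ContDiffMatrix N) : ContDiffMatrix fun x => M x + N x :=
  fun i j => (hM i j).add (hN i j)

lemma sub (hM : ContDiffMatrix M) (hN : ContDiffMatrix N) : ContDiffMatrix fun x => M x - N x :=
  fun i j => (hM i j).sub (hN i j)

lemma mul (hM : ContDiffMatrix M) (hN : ContDiffMatrix N) : ContDiffMatrix fun x => M x * N x :=
  fun i j => by
    simp only [Matrix.mul_apply]
    exact ContDiff.sum fun k _ => (hM i k).mul (hN k j)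

lemma smul {c : X → ℂ} (hc : ContDiff ℝ 1 c) (hM : ContDiffMatrix M) :
    ContDiffMatrix fun x => c x • M x :=
  fun i j => by
    simp only [Matrix.smul_apply, smul_eq_mul]
    exact hc.mul (hM i j)

lemma conjTranspose (hM : ContDiffMatrix M) : ContDiffMatrix fun x => (M x).conjTranspose :=
  fun i j => by
    simp only [Matrix.conjTranspose_apply]
    exact Complex.conjCLE.contDiff.comp (hM j i)

lemma trace (hM : ContDiffMatrix M) : ContDiff ℝ 1 fun x => (M x).trace := by
  simp only [Matrix.trace, Matrix.diag]
  exact ContDiff.sum fun i _ => hM i i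

lemma columnMatrix (hM : ContDiffMatrix M) (i : Fin d) :
    ContDiffMatrix fun x => columnMatrix i (M x) :=
  (contDiffMatrix_const _).add (((contDiffMatrix_const _).mul hM).mul (contDiffMatrix_const _))

lemma singularOf (hM : ContDiffMatrix M) (i : Fin d) :
    ContDiffMatrix fun x => singularOf i (M x) :=
  (((contDiffMatrix_const _).sub (hM.columnMatrix i)).conjTranspose.mul hM).mul
    ((contDiffMatrix_const _).sub (hM.columnMatrix i))

lemma doublySingularOf (hM : ContDiffMatrix M) (ε : ℝ) (i j : Fin d) :
    ContDiffMatrix fun x => doublySingularOf ε i j (M x) := by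
  have hc := (contDiffMatrix_const (1 : Matrix (Fin d) (Fin d) ℂ)).sub (hM.columnMatrix i)
  have hV := (hM.columnMatrix i).mul (hM.columnMatrix i).conjTranspose
  have hinv : ContDiff ℝ 1 fun x =>
      (_root_.columnMatrix i (M x) * (_root_.columnMatrix i (M x)).conjTranspose).trace⁻¹ :=
    hV.trace.inv fun x => trace_columnMatrix_mul_conjTranspose_ne_zero i (M x)
  refine (hc.conjTranspose.mul (ContDiffMatrix.add (ContDiffMatrix.singularOf
    (((contDiffMatrix_const _).mul hM).mul (contDiffMatrix_const _)) j) ?_)).mul hc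
  exact ContDiffMatrix.smul contDiff_const ((contDiffMatrix_const 1).sub (ContDiffMatrix.smul hinv hV))

end ContDiffMatrix

variable {n : ℕ}

lemma contDiffMatrix_Zmat (p : Fin n) : ContDiffMatrix fun x : Idx n d → ℝ => Zmat x p :=
  fun i j => contDiff_Zmat p i j

lemma contDiff_coordOf {M : X → Fin n → Matrix (Fin d) (Fin d) ℂ}
    (hM : ∀ p, ContDiffMatrix fun x => M x p) : ContDiff ℝ 1 fun x => coordOf (M x) := by
  rw [contDiff_pi]
  intro α
  refine Complex.reCLM.contDiff.comp (?_ : ContDiff ℝ 1 fun x =>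
    toRealCoord (fun β : Idx n d => M x β.1 β.2.1 β.2.2) α)
  simp only [toRealCoord_apply]
  exact ContDiff.sum fun β _ => contDiff_const.mul (hM β.1 β.2.1 β.2.2)

end SmoothMatrices

section Hausdorff

/-- The range of a `C¹` map which does not depend on two of its variables is negligible in
codimension one. -/
lemma hausdorffMeasure_range_eq_zero {ι : Type*} [Fintype ι] [DecidableEq ι]
    {F : (ι → ℝ) → ι → ℝ} (hF : ContDiff ℝ 1 F) {α β : ι} (hαβ : α ≠ β)
    (hind : ∀ x y, (∀ γ, γ ≠ α → γ ≠ β → x γ = y γ) → F x = F y) :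
    Measure.hausdorffMeasure ((Fintype.card ι : ℝ) - 1) (Set.range F) = 0 := by
  let κ := {γ : ι // γ ≠ α ∧ γ ≠ β}
  let E : (κ → ℝ) → ι → ℝ := fun u γ => if h : γ ≠ α ∧ γ ≠ β then u ⟨γ, h⟩ else 0
  have hE : ContDiff ℝ 1 E := by
    rw [contDiff_pi]
    intro γ
    by_cases h : γ ≠ α ∧ γ ≠ β
    · simp only [E, h, ne_eq, not_false_eq_true, and_self, dite_true]
      exact contDiff_apply ℝ ℝ _
    · simp only [E, h, dite_false]
      exact contDiff_const
  have hrange : Set.range F ⊆ Set.range (F ∘ E) := by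
    rintro _ ⟨x, rfl⟩
    refine ⟨fun γ => x γ, hind _ _ fun γ h1 h2 => ?_⟩
    simp [E, h1, h2]
  have hcard : Fintype.card κ + 2 = Fintype.card ι := by
    have h1 : Fintype.card κ = (Finset.univ \ {α, β} : Finset ι).card := by
      rw [Fintype.card_subtype]
      congr 1
      ext γ; simp
    have h2 : ({α, β} : Finset ι).card = 2 := Finset.card_pair hαβ
    have h3 := Finset.card_sdiff_add_card_eq_card (Finset.subset_univ ({α, β} : Finset ι))
    rw [h2, ← h1] at h3
    exact h3
  have hdim : dimH (Set.range F) ≤ (Fintype.card κ : ENNReal) := by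
    refine (dimH_mono hrange).trans ?_
    have := (hF.comp hE).dimH_range_le
    rwa [Module.finrank_fintype_fun_eq_card] at this
  have hreal : ((Fintype.card ι : ℝ) - 1) = (((Fintype.card κ + 1 : ℕ) : NNReal) : ℝ) := by
    rw [← hcard]; push_cast; ring
  rw [hreal]
  refine hausdorffMeasure_of_dimH_lt (hdim.trans_lt ?_)
  simp only [ENNReal.coe_natCast]
  exact_mod_cast Nat.lt_succ_self _

variable {n d : ℕ}

lemma Zmat_apply_eq_of_eq {x y : Idx n d → ℝ} {p : Fin n} {a b : Fin d}
    (h1 : x (p, a, b) = y (p, a, b)) (h2 : x (p, b, a) = y (p, b, a)) :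
    Zmat x p a b = Zmat y p a b := by
  simp only [Zmat, Matrix.of_apply]
  by_cases hab : a = b
  · subst hab; simp [h1]
  · simp [hab, h1, h2]

lemma Function.update_isHermitian {M : Fin n → Matrix (Fin d) (Fin d) ℂ}
    (hM : ∀ t, (M t).IsHermitian) (p : Fin n) {N : Matrix (Fin d) (Fin d) ℂ}
    (hN : N.IsHermitian) (t : Fin n) : (Function.update M p N t).IsHermitian := by
  by_cases h : t = p
  · subst h; simpa using hN
  · simpa [h] using hM t

lemma contDiffMatrix_update {X : Type*} [NormedAddCommGroup X] [NormedSpace ℝ X]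
    {M : X → Fin n → Matrix (Fin d) (Fin d) ℂ} (hM : ∀ t, ContDiffMatrix fun x => M x t)
    (p : Fin n) {N : X → Matrix (Fin d) (Fin d) ℂ} (hN : ContDiffMatrix N) (t : Fin n) :
    ContDiffMatrix fun x => Function.update (M x) p (N x) t := by
  by_cases h : t = p
  · subst h; simpa using hN
  · simpa [h] using hM t

/-- Tuples in which `Z^{(p)}` and `Z^{(q)}`, `p ≠ q`, are singular, with kernel vectors normalized at
`i` and `j`. They are parametrized without the coordinates `(p, i, i)` and `(q, j, j)`. The map `T`
is there to be the exchange of some `Z^{(q)}` with `Z^{(n+1)}`. -/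
lemma hausdorffMeasure_image_singular_pair_pivot {T : (Idx n d → ℝ) → Idx n d → ℝ}
    (hT : ContDiff ℝ 1 T) {p q : Fin n} (hpq : p ≠ q) (i j : Fin d) :
    Measure.hausdorffMeasure ((Fintype.card (Idx n d) : ℝ) - 1)
      (T '' {x | (∃ v, v i = 1 ∧ (Zmat x p).mulVec v = 0) ∧
        ∃ w, w j = 1 ∧ (Zmat x q).mulVec w = 0}) = 0 := by
  let F : (Idx n d → ℝ) → Idx n d → ℝ := fun x => coordOf (Function.update
    (Function.update (Zmat x) p (singularOf i (Zmat x p))) q (singularOf j (Zmat x q)))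
  have hF : ContDiff ℝ 1 F := contDiff_coordOf (contDiffMatrix_update
    (contDiffMatrix_update contDiffMatrix_Zmat p ((contDiffMatrix_Zmat p).singularOf i)) q
    ((contDiffMatrix_Zmat q).singularOf j))
  have hne : ((p, i, i) : Idx n d) ≠ (q, j, j) := fun h => hpq (congrArg Prod.fst h)
  refine measure_mono_null ?_ (hausdorffMeasure_range_eq_zero (hT.comp hF) hne fun x y hxy => ?_)
  · rintro _ ⟨x, ⟨⟨v, hv, hZv⟩, w, hw, hZw⟩, rfl⟩
    have hp := Zmat_isHermitian x p
    have hq := Zmat_isHermitian x q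
    let M := Function.update (Function.update (Zmat x) p (singularLift i (Zmat x p) v)) q
      (singularLift j (Zmat x q) w)
    have hM : ∀ t, (M t).IsHermitian := Function.update_isHermitian (Function.update_isHermitian
      (Zmat_isHermitian x) p (singularLift_isHermitian hp)) q (singularLift_isHermitian hq)
    refine ⟨coordOf M, ?_⟩
    have hZM : Zmat (coordOf M) = M := funext (Zmat_coordOf hM)
    simp only [Function.comp_apply, F, hZM]
    congr 1
    rw [← coordOf_Zmat x]
    congr 1
    have h1 : M p = singularLift i (Zmat x p) v := by simp [M, hpq]
    have h2 : M q = singularLift j (Zmat x q) w := by simp [M]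
    rw [h1, h2, singularOf_singularLift hp hv hZv, singularOf_singularLift hq hw hZw]
    funext t
    by_cases h : t = q
    · subst h; simp
    · by_cases h' : t = p
      · subst h'; simp [h]
      · simp [h, h', M]
  · simp only [Function.comp_apply, F]
    have hZ : ∀ t a b, ((t, a, b) : Idx n d) ≠ (p, i, i) → ((t, a, b) : Idx n d) ≠ (q, j, j) →
        Zmat x t a b = Zmat y t a b := fun t a b h1 h2 => by
      refine Zmat_apply_eq_of_eq (hxy _ h1 h2) (hxy _ ?_ ?_)
      · rintro h; simp only [Prod.mk.injEq] at h; exact h1 (by rw [h.1, h.2.1, h.2.2])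
      · rintro h; simp only [Prod.mk.injEq] at h; exact h2 (by rw [h.1, h.2.1, h.2.2])
    have h1 : singularOf i (Zmat x p) = singularOf i (Zmat y p) := singularOf_congr fun a b hab =>
      hZ p a b (by simpa using hab) (by simp [hpq])
    have h2 : singularOf j (Zmat x q) = singularOf j (Zmat y q) := singularOf_congr fun a b hab =>
      hZ q a b (by simp [hpq.symm]) (by simpa using hab)
    rw [h1, h2]
    congr 2
    funext t
    by_cases h : t = q
    · subst h; simp
    · by_cases h' : t = p
      · subst h'; simp [h]
      · simp only [Function.update_of_ne h, Function.update_of_ne h']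
        ext a b
        exact hZ t a b (by simp [h']) (by simp [h])

lemma exists_normalize {v : Fin d → ℂ} (hv : v ≠ 0) : ∃ (i : Fin d) (c : ℂ), c ≠ 0 ∧ (c • v) i = 1 := by
  obtain ⟨i, hi⟩ := Function.ne_iff.mp hv
  exact ⟨i, (v i)⁻¹, inv_ne_zero hi, by simpa using inv_mul_cancel₀ hi⟩

lemma hausdorffMeasure_image_singular_pair {T : (Idx n d → ℝ) → Idx n d → ℝ}
    (hT : ContDiff ℝ 1 T) {p q : Fin n} (hpq : p ≠ q) :
    Measure.hausdorffMeasure ((Fintype.card (Idx n d) : ℝ) - 1)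
      (T '' {x | (∃ v, v ≠ 0 ∧ (Zmat x p).mulVec v = 0) ∧
        ∃ w, w ≠ 0 ∧ (Zmat x q).mulVec w = 0}) = 0 := by
  refine measure_mono_null ?_ (measure_iUnion_null fun i : Fin d => measure_iUnion_null
    fun j : Fin d => hausdorffMeasure_image_singular_pair_pivot hT hpq i j)
  rintro _ ⟨x, ⟨⟨v, hv, hZv⟩, w, hw, hZw⟩, rfl⟩
  obtain ⟨i, c, -, hi⟩ := exists_normalize hv
  obtain ⟨j, e, -, hj⟩ := exists_normalize hw
  refine Set.mem_iUnion.mpr ⟨i, Set.mem_iUnion.mpr ⟨j, x, ⟨⟨c • v, hi, ?_⟩, e • w, hj, ?_⟩, rfl⟩⟩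
  · rw [Matrix.mulVec_smul, hZv, smul_zero]
  · rw [Matrix.mulVec_smul, hZw, smul_zero]

/-- Tuples in which `Z^{(p)}` is of the form `doublySingularOf ε i j X`, hence parametrized without the
coordinates `(p, i, i)` and `(p, j, j)`. -/
lemma hausdorffMeasure_image_doubly_singular {T : (Idx n d → ℝ) → Idx n d → ℝ}
    (hT : ContDiff ℝ 1 T) (p : Fin n) (ε : ℝ) :
    Measure.hausdorffMeasure ((Fintype.card (Idx n d) : ℝ) - 1)
      (T '' {x | ∃ i j, ∃ v y : Fin d → ℂ, v i = 1 ∧ (Zmat x p).mulVec v = 0 ∧ y i = 0 ∧ y j = 1 ∧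
        (Zmat x p - (ε : ℂ) • (1 - (Matrix.vecMulVec v (star v)).trace⁻¹ •
          Matrix.vecMulVec v (star v))).mulVec y = 0}) = 0 := by
  let F : Fin d → Fin d → (Idx n d → ℝ) → Idx n d → ℝ := fun i j x => coordOf
    (Function.update (Zmat x) p (doublySingularOf ε i j (Zmat x p)))
  have hF : ∀ i j, ContDiff ℝ 1 (F i j) := fun i j => contDiff_coordOf
    (contDiffMatrix_update contDiffMatrix_Zmat p ((contDiffMatrix_Zmat p).doublySingularOf ε i j))
  have hnull : ∀ ij : {ij : Fin d × Fin d // ij.1 ≠ ij.2},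
      Measure.hausdorffMeasure ((Fintype.card (Idx n d) : ℝ) - 1)
        (Set.range (T ∘ F ij.1.1 ij.1.2)) = 0 := by
    rintro ⟨⟨i, j⟩, hij⟩
    have hne : ((p, i, i) : Idx n d) ≠ (p, j, j) := fun h => hij (by simpa using h)
    refine hausdorffMeasure_range_eq_zero (hT.comp (hF i j)) hne fun x y hxy => ?_
    simp only [Function.comp_apply, F]
    have hZ : ∀ t a b, ((t, a, b) : Idx n d) ≠ (p, i, i) → ((t, a, b) : Idx n d) ≠ (p, j, j) →
        Zmat x t a b = Zmat y t a b := fun t a b h1 h2 => by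
      refine Zmat_apply_eq_of_eq (hxy _ h1 h2) (hxy _ ?_ ?_)
      · rintro h; simp only [Prod.mk.injEq] at h; exact h1 (by rw [h.1, h.2.1, h.2.2])
      · rintro h; simp only [Prod.mk.injEq] at h; exact h2 (by rw [h.1, h.2.1, h.2.2])
    have h1 : doublySingularOf ε i j (Zmat x p) = doublySingularOf ε i j (Zmat y p) :=
      doublySingularOf_congr fun a b ha hb => hZ p a b (by simpa using ha) (by simpa using hb)
    rw [h1]
    congr 2
    funext t
    by_cases h' : t = p
    · subst h'; simp
    · simp only [Function.update_of_ne h']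
      ext a b
      exact hZ t a b (by simp [h']) (by simp [h'])
  refine measure_mono_null ?_ (measure_iUnion_null hnull)
  rintro _ ⟨x, ⟨i, j, v, y, hv, hZv, hyi, hyj, hy⟩, rfl⟩
  have hij : i ≠ j := by
    rintro rfl; rw [hyi] at hyj; exact zero_ne_one hyj
  obtain ⟨X, hX, hXZ⟩ := exists_doublySingularOf_eq (Zmat_isHermitian x p) hv hZv hyi hyj hy
  refine Set.mem_iUnion.mpr ⟨⟨(i, j), hij⟩, coordOf (Function.update (Zmat x) p X), ?_⟩
  have hZM : Zmat (coordOf (Function.update (Zmat x) p X)) = Function.update (Zmat x) p X :=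
    funext (Zmat_coordOf (Function.update_isHermitian (Zmat_isHermitian x) p hX))
  simp only [Function.comp_apply, F, hZM, Function.update_self, hXZ, Function.update_idem,
    Function.update_eq_self, coordOf_Zmat]

/-- Two independent vectors can be replaced by a basis of their span of the form `u`, `u'` with
`u_i = 1`, `u'_i = 0`, `u'_j = 1`. -/
lemma exists_independent_normalize {v w : Fin d → ℂ} (hv : v ≠ 0) (hvw : ∀ c : ℂ, w ≠ c • v) :
    ∃ (i j : Fin d) (c e f : ℂ), c ≠ 0 ∧ (c • v) i = 1 ∧ (e • (w - f • (c • v))) i = 0 ∧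
      (e • (w - f • (c • v))) j = 1 := by
  obtain ⟨i, c, hc, hi⟩ := exists_normalize hv
  have hne : w - w i • (c • v) ≠ 0 := by
    rw [sub_ne_zero, smul_smul]; exact hvw _
  obtain ⟨j, e, -, hj⟩ := exists_normalize hne
  refine ⟨i, j, c, e, w i, hc, hi, ?_, hj⟩
  rw [Pi.smul_apply, Pi.sub_apply, Pi.smul_apply, hi]
  simp

lemma hausdorffMeasure_image_corank_two {T : (Idx n d → ℝ) → Idx n d → ℝ}
    (hT : ContDiff ℝ 1 T) (p : Fin n) :
    Measure.hausdorffMeasure ((Fintype.card (Idx n d) : ℝ) - 1)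
      (T '' {x | ∃ v w, v ≠ 0 ∧ (∀ c : ℂ, w ≠ c • v) ∧ (Zmat x p).mulVec v = 0 ∧
        (Zmat x p).mulVec w = 0}) = 0 := by
  refine measure_mono_null (Set.image_mono ?_) (hausdorffMeasure_image_doubly_singular hT p 0)
  rintro x ⟨v, w, hv, hvw, hZv, hZw⟩
  obtain ⟨i, j, c, e, f, -, h1, h2, h3⟩ := exists_independent_normalize hv hvw
  refine ⟨i, j, _, _, h1, ?_, h2, h3, ?_⟩
  · rw [Matrix.mulVec_smul, hZv, smul_zero]
  · simp [Matrix.mulVec_smul, Matrix.mulVec_sub, hZv, hZw]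

/-- The eigenvalues `0` and `1` of `Z^{(p)}`. This is the case in which `Z^{(p)}` and `1 - Z^{(p)}` are
both singular, needed for `n = 1`. -/
lemma hausdorffMeasure_image_eigenvalues_zero_one {T : (Idx n d → ℝ) → Idx n d → ℝ}
    (hT : ContDiff ℝ 1 T) (p : Fin n) :
    Measure.hausdorffMeasure ((Fintype.card (Idx n d) : ℝ) - 1)
      (T '' {x | (∃ v, v ≠ 0 ∧ (Zmat x p).mulVec v = 0) ∧
        ∃ w, w ≠ 0 ∧ (Zmat x p).mulVec w = w}) = 0 := by
  refine measure_mono_null (Set.image_mono ?_) (hausdorffMeasure_image_doubly_singular hT p 1)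
  rintro x ⟨⟨v, hv, hZv⟩, w, hw, hZw⟩
  have hvw : ∀ c : ℂ, w ≠ c • v := fun c hc => hw <| by
    rw [← hZw, hc, Matrix.mulVec_smul, hZv, smul_zero]
  obtain ⟨i, j, c, e, f, hc, h1, h2, h3⟩ := exists_independent_normalize hv hvw
  refine ⟨i, j, _, _, h1, ?_, h2, h3, ?_⟩
  · rw [Matrix.mulVec_smul, hZv, smul_zero]
  · set u := c • v with hu
    have hZu : (Zmat x p).mulVec u = 0 := by rw [hu, Matrix.mulVec_smul, hZv, smul_zero]
    have horth : star u ⬝ᵥ w = 0 := by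
      have hstar := Matrix.star_mulVec (Zmat x p) u
      rw [hZu, star_zero, (Zmat_isHermitian x p).eq] at hstar
      rw [← hZw, Matrix.dotProduct_mulVec, ← hstar, zero_dotProduct]
    have hne : (Matrix.vecMulVec u (star u)).trace ≠ 0 := by
      rw [Matrix.trace_vecMulVec, Ne, dotProduct_self_star_eq_zero]
      exact smul_ne_zero hc hv
    have hE : (Matrix.vecMulVec u (star u)).mulVec (w - f • u)
        = (-f * (Matrix.vecMulVec u (star u)).trace) • u := by
      rw [Matrix.vecMulVec_mulVec, dotProduct_sub, horth, dotProduct_smul, Matrix.trace_vecMulVec,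
        dotProduct_comm u]
      ext t; simp; ring
    rw [Matrix.mulVec_smul, Matrix.sub_mulVec, Matrix.smul_mulVec, Matrix.sub_mulVec,
      Matrix.smul_mulVec, hE, Matrix.mulVec_sub, Matrix.mulVec_smul, hZu, hZw, Matrix.one_mulVec,
      smul_smul (Matrix.vecMulVec u (star u)).trace⁻¹]
    have : (Matrix.vecMulVec u (star u)).trace⁻¹ * (-f * (Matrix.vecMulVec u (star u)).trace) = -f := by
      field_simp
    rw [this]
    simp

/-- The affine involution which exchanges `Z^{(q)}` and `Z^{(n+1)}`. -/
def exchangeLast (q : Fin n) (x : Idx n d → ℝ) : Idx n d → ℝ :=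
  coordOf (Function.update (Zmat x) q (Zfull x (Fin.last n)))

lemma Zmat_exchangeLast (q : Fin n) (x : Idx n d → ℝ) :
    Zmat (exchangeLast q x) = Function.update (Zmat x) q (Zfull x (Fin.last n)) :=
  funext (Zmat_coordOf (Function.update_isHermitian (Zmat_isHermitian x) q (Zfull_isHermitian x _)))

lemma exchangeLast_exchangeLast (q : Fin n) (x : Idx n d → ℝ) :
    exchangeLast q (exchangeLast q x) = x := by
  have h : Zfull (exchangeLast q x) (Fin.last n) = Zmat x q := by
    rw [Zfull_last, Zmat_exchangeLast, Zfull_last, Finset.sum_update_of_mem (Finset.mem_univ q),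
      ← Finset.sum_erase_add _ _ (Finset.mem_univ q), Finset.sdiff_singleton_eq_erase]
    abel
  rw [exchangeLast, h, Zmat_exchangeLast, Function.update_idem, Function.update_eq_self,
    coordOf_Zmat]

lemma contDiff_exchangeLast (q : Fin n) : ContDiff ℝ 1 (exchangeLast (d := d) q) :=
  contDiff_coordOf (contDiffMatrix_update contDiffMatrix_Zmat q
    fun i j => contDiff_Zfull (Fin.last n) i j)

/-- The deep points are negligible in codimension one. The matrix `Z^{(n+1)}` is brought among the
free coordinates by an exchange with some `Z^{(q)}`; for `n = 1` there is no third matrix to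
exchange with, and `Z^{(1)}`, `1 - Z^{(1)}` both singular is treated by eigenvalues. -/
lemma hausdorffMeasure_isDeepPoint (hn : 1 ≤ n) :
    Measure.hausdorffMeasure ((Fintype.card (Idx n d) : ℝ) - 1)
      {x : Idx n d → ℝ | IsDeepPoint x} = 0 := by
  set ν : Measure (Idx n d → ℝ) :=
    Measure.hausdorffMeasure ((Fintype.card (Idx n d) : ℝ) - 1) with hν
  have hid : ContDiff ℝ 1 (id : (Idx n d → ℝ) → Idx n d → ℝ) := contDiff_id
  have hexch : ∀ (q : Fin n) {S : Set (Idx n d → ℝ)} {x : Idx n d → ℝ}, exchangeLast q x ∈ S →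
      x ∈ exchangeLast q '' S := fun q S x hx => ⟨_, hx, exchangeLast_exchangeLast q x⟩
  -- `Z^{(p)}` and `Z^{(n+1)}` are both singular
  have hlast : ∀ p : Fin n, ν {x | (∃ v, v ≠ 0 ∧ (Zmat x p).mulVec v = 0) ∧
      ∃ w, w ≠ 0 ∧ (Zfull x (Fin.last n)).mulVec w = 0} = 0 := fun p => by
    by_cases hq : ∃ q : Fin n, p ≠ q
    · obtain ⟨q, hpq⟩ := hq
      refine measure_mono_null ?_
        (hausdorffMeasure_image_singular_pair (contDiff_exchangeLast (d := d) q) hpq)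
      rintro x ⟨hp, hl⟩
      refine hexch q ⟨?_, ?_⟩
      · rw [Zmat_exchangeLast, Function.update_of_ne hpq]; exact hp
      · rw [Zmat_exchangeLast, Function.update_self]; exact hl
    · push Not at hq
      refine measure_mono_null ?_ (hausdorffMeasure_image_eigenvalues_zero_one (d := d) hid p)
      rintro x ⟨hp, w, hw, hw0⟩
      refine ⟨x, ⟨hp, w, hw, ?_⟩, rfl⟩
      have hsum : ∑ t, Zmat x t = Zmat x p :=
        Finset.sum_eq_single p (fun t _ ht => absurd (hq t).symm ht) (by simp)
      rw [Zfull_last, hsum, Matrix.sub_mulVec, Matrix.one_mulVec, sub_eq_zero] at hw0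
      exact hw0.symm
  have hpair : ∀ r s : Fin (n + 1), r ≠ s → ν {x | (∃ v, v ≠ 0 ∧ (Zfull x r).mulVec v = 0) ∧
      ∃ w, w ≠ 0 ∧ (Zfull x s).mulVec w = 0} = 0 := by
    intro r s
    refine Fin.lastCases ?_ (fun p => ?_) r <;> refine Fin.lastCases ?_ (fun q => ?_) s
    · exact fun h => absurd rfl h
    · intro _
      simp only [Zfull_castSucc]
      exact measure_mono_null (fun x hx => (And.symm hx :)) (hlast q)
    · intro _
      simp only [Zfull_castSucc]
      exact hlast p
    · intro hpq
      simp only [Zfull_castSucc]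
      have := hausdorffMeasure_image_singular_pair (d := d) hid
        (fun h => hpq (congrArg Fin.castSucc h) : p ≠ q)
      rwa [Set.image_id] at this
  have hcorank : ∀ r : Fin (n + 1), ν {x | ∃ v w, v ≠ 0 ∧ (∀ c : ℂ, w ≠ c • v) ∧
      (Zfull x r).mulVec v = 0 ∧ (Zfull x r).mulVec w = 0} = 0 := by
    intro r
    refine Fin.lastCases ?_ (fun p => ?_) r
    · let q : Fin n := ⟨0, hn⟩
      refine measure_mono_null ?_
        (hausdorffMeasure_image_corank_two (contDiff_exchangeLast (d := d) q) q)
      intro x hx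
      refine hexch q ?_
      simp only [Set.mem_ofPred_eq, Zmat_exchangeLast, Function.update_self]
      exact hx
    · simp only [Zfull_castSucc]
      have := hausdorffMeasure_image_corank_two (d := d) hid p
      rwa [Set.image_id] at this
  refine measure_mono_null ?_ (measure_union_null
    (measure_iUnion_null fun rs : {rs : Fin (n + 1) × Fin (n + 1) // rs.1 ≠ rs.2} =>
      hpair rs.1.1 rs.1.2 rs.2) (measure_iUnion_null hcorank))
  rintro x (⟨r, s, hrs, h⟩ | ⟨r, v, w, h⟩)
  · exact Or.inl (Set.mem_iUnion.mpr ⟨⟨(r, s), hrs⟩, h⟩)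
  · exact Or.inr (Set.mem_iUnion.mpr ⟨r, v, w, h⟩)

/-- The interior of the matrix simplex has a piecewise `C¹` boundary: away from the deep points the
boundary is the regular zero set of a determinant. -/
lemma hasPiecewiseC1Boundary_matrixSimplex (hn : 1 ≤ n) :
    HasPiecewiseC1Boundary (interior (matrixSimplex n d)) := by
  let good : Set (Set (Idx n d → ℝ)) := {U | IsOpen U ∧ ∃ φ : (Idx n d → ℝ) → ℝ,
    ContDiffOn ℝ 1 φ U ∧ (∀ y ∈ U, fderiv ℝ φ y ≠ 0) ∧
      ∀ y ∈ U, y ∈ interior (matrixSimplex n d) ↔ 0 < φ y}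
  refine ⟨frontier (interior (matrixSimplex n d)) \ ⋃₀ good, Set.sdiff_subset,
    isClosed_frontier.sdiff (isOpen_sUnion fun U hU => hU.1), ?_, ?_⟩
  · refine measure_mono_null ?_ (hausdorffMeasure_isDeepPoint hn)
    rintro x ⟨hx, hxU⟩
    by_contra hdeep
    obtain ⟨U, hU, hxmem, φ, h⟩ := exists_defining_function_of_not_isDeepPoint hn hx hdeep
    exact hxU ⟨U, ⟨hU, φ, h⟩, hxmem⟩
  · rintro x ⟨hx, hxS⟩
    have : x ∈ ⋃₀ good := by
      by_contra h
      exact hxS ⟨hx, h⟩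
    obtain ⟨U, ⟨hU, φ, h1, h2, h3⟩, hxU⟩ := this
    exact ⟨U, hU, hxU, φ, h1, h2 x hxU, h3⟩

end Hausdorff

/-! ### The co-metric applied to determinants -/

section Determinants

variable {n d : ℕ} {A : Matrix (Fin d) (Fin d) ℂ} {B : Matrix (Fin d × Fin d) (Fin d × Fin d) ℂ}

/-- Jacobi's formula. -/
lemma pd_det {ι : Type*} [Fintype ι] [DecidableEq ι] {M : (ι → ℝ) → Matrix (Fin d) (Fin d) ℂ}
    {x : ι → ℝ} (hM : ∀ k l, DifferentiableAt ℝ (fun y => M y k l) x) (i : ι) :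
    pd i (fun y => (M y).det) x
      = ∑ k, ∑ l, (M x).adjugate l k * pd i (fun y => M y k l) x := by
  let D : ContinuousMultilinearMap ℂ (fun _ : Fin d => Fin d → ℂ) ℂ :=
    ⟨(Matrix.detRowAlternating (n := Fin d) (R := ℂ)).toMultilinearMap,
      Continuous.matrix_det (A := fun M : Matrix (Fin d) (Fin d) ℂ => M) continuous_id⟩
  let N : (ι → ℝ) → Fin d → Fin d → ℂ := fun y k l => M y k l
  have hN : HasFDerivAt N (ContinuousLinearMap.pi fun k => ContinuousLinearMap.pi fun l =>
      fderiv ℝ (fun y => M y k l) x) x :=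
    hasFDerivAt_pi.mpr fun k => hasFDerivAt_pi.mpr fun l => (hM k l).hasFDerivAt
  have h : HasFDerivAt (fun y => (M y).det) _ x :=
    ((D.restrictScalars ℝ).hasFDerivAt (N x)).comp x hN
  rw [pd, h.fderiv, ContinuousLinearMap.comp_apply, ContinuousMultilinearMap.linearDeriv_apply]
  refine Finset.sum_congr rfl fun k _ => ?_
  change ((M x).updateRow k fun l => pd i (fun y => M y k l) x).det = _
  rw [← Matrix.cramer_transpose_apply, Matrix.cramer_eq_adjugate_mulVec, ← Matrix.adjugate_transpose]
  rfl

/-- The part of `Γ_{A,B}(P_{ij}, X_{kl})` which is bilinear in `P` and `X`. -/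
def bilinearAB (A : Matrix (Fin d) (Fin d) ℂ) (B : Matrix (Fin d × Fin d) (Fin d × Fin d) ℂ)
    (P X : Matrix (Fin d) (Fin d) ℂ) (i j k l : Fin d) : ℂ :=
  - (A k j * (P * X) i l) - A i l * (X * P) k j
    + ∑ a, ∑ b, (B (i, a) (l, b) * P a j * X k b + B (a, j) (b, k) * P i a * X b l
      - B (a, j) (l, b) * P i a * X k b - B (i, a) (b, k) * P a j * X b l)

lemma gammaAB_eq_bilinearAB (Z : Fin n → Matrix (Fin d) (Fin d) ℂ) (p q : Fin n)
    (i j k l : Fin d) :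
    gammaAB A B Z (p, i, j) (q, k, l)
      = (if p = q then A i l * Z p k j + A k j * Z p i l else 0)
        + bilinearAB A B (Z p) (Z q) i j k l := by
  rw [gammaAB, bilinearAB]; ring

lemma bilinearAB_sub (P X Y : Matrix (Fin d) (Fin d) ℂ) (i j k l : Fin d) :
    bilinearAB A B P (X - Y) i j k l = bilinearAB A B P X i j k l - bilinearAB A B P Y i j k l := by
  simp only [bilinearAB, Matrix.sub_mul, Matrix.sub_apply, mul_sub,
    Finset.sum_add_distrib, Finset.sum_sub_distrib]
  ring

lemma bilinearAB_sum (P : Matrix (Fin d) (Fin d) ℂ) (Z : Fin n → Matrix (Fin d) (Fin d) ℂ)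
    (i j k l : Fin d) :
    bilinearAB A B P (∑ q, Z q) i j k l = ∑ q, bilinearAB A B P (Z q) i j k l := by
  have h : ∀ s : Finset (Fin n), bilinearAB A B P (∑ q ∈ s, Z q) i j k l
      = ∑ q ∈ s, bilinearAB A B P (Z q) i j k l := fun s => by
    induction s using Finset.induction_on with
    | empty => simp [bilinearAB]
    | insert q s hq ih =>
      have h2 := bilinearAB_sub (A := A) (B := B) P (∑ q ∈ insert q s, Z q) (Z q) i j k l
      rw [Finset.sum_insert hq, add_sub_cancel_left, ih] at h2
      rw [Finset.sum_insert hq, Finset.sum_insert hq, h2]; ring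
  exact h _

/-- The commutator structure makes the `B`-terms cancel when the second matrix is the identity. -/
lemma bilinearAB_one (P : Matrix (Fin d) (Fin d) ℂ) (i j k l : Fin d) :
    bilinearAB A B P 1 i j k l = -(A k j * P i l) - A i l * P k j := by
  simp [bilinearAB, Matrix.one_apply, Finset.sum_add_distrib, Finset.sum_sub_distrib]

/-- Since `∑_q Z^{(q)} = 1 - Z^{(n+1)}`, the co-metric of `Z^{(p)}_{ij}` and `Z^{(n+1)}_{kl}` is
`bilinearAB` of `Z^{(p)}` and `Z^{(n+1)}`. -/
lemma sum_gammaAB (x : Idx n d → ℝ) (p : Fin n) (i j k l : Fin d) :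
    ∑ q, gammaAB A B (Zmat x) (p, i, j) (q, k, l)
      = -bilinearAB A B (Zmat x p) (Zfull x (Fin.last n)) i j k l := by
  simp only [gammaAB_eq_bilinearAB, Finset.sum_add_distrib, Finset.sum_ite_eq, Finset.mem_univ,
    if_true, Zfull_last, bilinearAB_sub, bilinearAB_one, bilinearAB_sum]
  ring

lemma sum_adjugate_mul_left (X : Matrix (Fin d) (Fin d) ℂ) (c : Fin d → Fin d → Fin d → ℂ) :
    ∑ k, ∑ l, X.adjugate l k * ∑ a, ∑ b, c a l b * X k b = X.det * ∑ a, ∑ b, c a b b := by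
  have h : ∀ l b, ∑ k, X.adjugate l k * X k b = if l = b then X.det else 0 := fun l b => by
    rw [← Matrix.mul_apply, Matrix.adjugate_mul, Matrix.smul_apply, Matrix.one_apply]; simp
  have e : ∀ k l, X.adjugate l k * ∑ a, ∑ b, c a l b * X k b
      = ∑ a, ∑ b, c a l b * (X.adjugate l k * X k b) := fun k l => by
    simp only [Finset.mul_sum]
    exact Finset.sum_congr rfl fun _ _ => Finset.sum_congr rfl fun _ _ => by ring
  simp only [e]
  rw [Finset.sum_comm]
  calc _ = ∑ l, ∑ a, ∑ b, c a l b * ∑ k, X.adjugate l k * X k b := by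
        refine Finset.sum_congr rfl fun l _ => ?_
        rw [Finset.sum_comm]
        refine Finset.sum_congr rfl fun a _ => ?_
        rw [Finset.sum_comm]
        simp only [Finset.mul_sum]
    _ = _ := by
        simp only [h, mul_ite, mul_zero, Finset.sum_ite_eq, Finset.mem_univ, if_true]
        rw [Finset.sum_comm]
        simp only [Finset.mul_sum]
        exact Finset.sum_congr rfl fun _ _ => Finset.sum_congr rfl fun _ _ => mul_comm _ _

lemma sum_adjugate_mul_right (X : Matrix (Fin d) (Fin d) ℂ) (c : Fin d → Fin d → Fin d → ℂ) :
    ∑ k, ∑ l, X.adjugate l k * ∑ a, ∑ b, c a b k * X b l = X.det * ∑ a, ∑ b, c a b b := by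
  have h : ∀ b k, ∑ l, X b l * X.adjugate l k = if b = k then X.det else 0 := fun b k => by
    rw [← Matrix.mul_apply, Matrix.mul_adjugate, Matrix.smul_apply, Matrix.one_apply]; simp
  have e : ∀ k l, X.adjugate l k * ∑ a, ∑ b, c a b k * X b l
      = ∑ a, ∑ b, c a b k * (X b l * X.adjugate l k) := fun k l => by
    simp only [Finset.mul_sum]
    exact Finset.sum_congr rfl fun _ _ => Finset.sum_congr rfl fun _ _ => by ring
  simp only [e]
  calc _ = ∑ k, ∑ a, ∑ b, c a b k * ∑ l, X b l * X.adjugate l k := by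
        refine Finset.sum_congr rfl fun k _ => ?_
        rw [Finset.sum_comm]
        refine Finset.sum_congr rfl fun a _ => ?_
        rw [Finset.sum_comm]
        simp only [Finset.mul_sum]
    _ = _ := by
        simp only [h, mul_ite, mul_zero, Finset.sum_ite_eq', Finset.mem_univ, if_true]
        rw [Finset.sum_comm]
        simp only [Finset.mul_sum]
        exact Finset.sum_congr rfl fun _ _ => Finset.sum_congr rfl fun _ _ => mul_comm _ _

/-- The contribution of `B` disappears, since it is a commutator with `X`. -/
lemma sum_adjugate_mul_bilinearAB (P X : Matrix (Fin d) (Fin d) ℂ) (i j : Fin d) :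
    ∑ k, ∑ l, X.adjugate l k * bilinearAB A B P X i j k l
      = -(X.det * ((A * P) i j + (P * A) i j)) := by
  have e1 : ∑ k, ∑ l, X.adjugate l k * (A k j * (P * X) i l) = X.det * (P * A) i j := by
    have : X.det * (P * A) i j = (P * X * X.adjugate * A) i j := by
      rw [Matrix.mul_assoc P X, Matrix.mul_adjugate, Matrix.mul_smul, Matrix.mul_one,
        Matrix.smul_mul, Matrix.smul_apply, smul_eq_mul]
    rw [this, Matrix.mul_apply]
    refine Finset.sum_congr rfl fun k _ => ?_
    rw [Matrix.mul_apply, Finset.sum_mul]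
    exact Finset.sum_congr rfl fun l _ => by ring
  have e2 : ∑ k, ∑ l, X.adjugate l k * (A i l * (X * P) k j) = X.det * (A * P) i j := by
    have : X.det * (A * P) i j = (A * X.adjugate * (X * P)) i j := by
      rw [Matrix.mul_assoc A, ← Matrix.mul_assoc _ X, Matrix.adjugate_mul, Matrix.smul_mul,
        Matrix.one_mul, Matrix.mul_smul, Matrix.smul_apply, smul_eq_mul]
    rw [this, Matrix.mul_apply]
    refine Finset.sum_congr rfl fun k _ => ?_
    rw [Matrix.mul_apply (M := A), Finset.sum_mul]
    exact Finset.sum_congr rfl fun l _ => by ring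
  simp only [bilinearAB, mul_add, mul_sub, mul_neg, Finset.sum_add_distrib, Finset.sum_sub_distrib,
    Finset.sum_neg_distrib, e1, e2]
  rw [sum_adjugate_mul_left X (fun a l b => B (i, a) (l, b) * P a j),
    sum_adjugate_mul_left X (fun a l b => B (a, j) (l, b) * P i a),
    sum_adjugate_mul_right X (fun a b k => B (a, j) (b, k) * P i a),
    sum_adjugate_mul_right X (fun a b k => B (i, a) (b, k) * P a j)]
  ring

/-- `Γ_{A,B}(Z^{(p)}_{ij}, log det Z^{(r)})`. -/
def logDetGamma (A : Matrix (Fin d) (Fin d) ℂ) (Z : Fin n → Matrix (Fin d) (Fin d) ℂ)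
    (r : Fin (n + 1)) : Idx n d → ℂ
  | (p, i, j) => (if p.castSucc = r then 2 * A i j else 0) - ((A * Z p) i j + (Z p * A) i j)

lemma wirtinger_det_Zmat (x : Idx n d → ℝ) (s : Fin n) (β : Idx n d) :
    wirtinger β (fun y => (Zmat y s).det) x
      = if β.1 = s then (Zmat x s).adjugate β.2.2 β.2.1 else 0 := by
  have hd : ∀ k l, DifferentiableAt ℝ (fun y : Idx n d → ℝ => Zmat y s k l) x := fun k l =>
    (hasFDerivAt_entry (s, k, l) x).differentiableAt
  have h : wirtinger β (fun y => (Zmat y s).det) x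
      = ∑ k, ∑ l, (Zmat x s).adjugate l k * wirtinger β (entry (s, k, l)) x := by
    simp only [wirtinger, pd_det hd, Finset.mul_sum]
    rw [Finset.sum_comm]
    refine Finset.sum_congr rfl fun k _ => ?_
    rw [Finset.sum_comm]
    exact Finset.sum_congr rfl fun l _ => Finset.sum_congr rfl fun α _ => by
      rw [mul_left_comm]; rfl
  obtain ⟨q, k, l⟩ := β
  rw [h]
  simp only [wirtinger_entry, Prod.mk.injEq, ite_and, mul_ite, mul_one, mul_zero,
    Finset.sum_ite_irrel, Finset.sum_ite_eq', Finset.mem_univ, if_true, Finset.sum_const_zero]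
  by_cases hqs : s = q
  · simp [hqs]
  · simp [hqs, Ne.symm hqs]

/-- Each `Z^{(q)}` enters `Z^{(n+1)} = 1 - ∑ Z^{(q)}` with a minus sign. -/
lemma wirtinger_det_last (x : Idx n d → ℝ) (β : Idx n d) :
    wirtinger β (fun y => (Zfull y (Fin.last n)).det) x
      = -(Zfull x (Fin.last n)).adjugate β.2.2 β.2.1 := by
  have hd : ∀ γ : Idx n d, DifferentiableAt ℝ (entry γ) x := fun γ =>
    (hasFDerivAt_entry γ x).differentiableAt
  have hd' : ∀ k l, DifferentiableAt ℝ (fun y : Idx n d → ℝ => Zfull y (Fin.last n) k l) x :=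
    fun k l => (contDiff_Zfull (Fin.last n) k l (k := 1)).differentiable (by simp) x
  have h : wirtinger β (fun y => (Zfull y (Fin.last n)).det) x
      = ∑ k, ∑ l, (Zfull x (Fin.last n)).adjugate l k
          * wirtinger β (fun y => Zfull y (Fin.last n) k l) x := by
    simp only [wirtinger, pd_det hd', Finset.mul_sum]
    rw [Finset.sum_comm]
    refine Finset.sum_congr rfl fun k _ => ?_
    rw [Finset.sum_comm]
    exact Finset.sum_congr rfl fun l _ => Finset.sum_congr rfl fun α _ => by rw [mul_left_comm]
  have hw : ∀ k l, wirtinger β (fun y => Zfull y (Fin.last n) k l) x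
      = -∑ s : Fin n, if (s, k, l) = β then 1 else 0 := fun k l => by
    have e : (fun y : Idx n d → ℝ => Zfull y (Fin.last n) k l)
        = fun y => (1 : Matrix (Fin d) (Fin d) ℂ) k l - ∑ s : Fin n, entry (s, k, l) y := by
      funext y; simp [entry, Matrix.sum_apply]
    rw [e, wirtinger_sub (differentiableAt_const _) (DifferentiableAt.fun_sum fun s _ => hd _),
      wirtinger_const, wirtinger_sum _ (fun s _ => hd _), zero_sub]
    simp only [wirtinger_entry]
  obtain ⟨q, k, l⟩ := β
  rw [h]
  simp only [hw, Prod.mk.injEq, ite_and, Finset.sum_ite_eq', Finset.mem_univ, if_true, mul_neg,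
    mul_ite, mul_one, mul_zero, Finset.sum_neg_distrib, Finset.sum_ite_irrel,
    Finset.sum_const_zero]

/-- The boundary equation: `Γ_{A,B}(Z^{(p)}_{ij}, det Z^{(r)})` is divisible by `det Z^{(r)}`, with a
quotient of degree one. -/
lemma sum_gammaAB_mul_wirtinger_det (x : Idx n d → ℝ) (r : Fin (n + 1)) (γ : Idx n d) :
    ∑ β, gammaAB A B (Zmat x) γ β * wirtinger β (fun y => (Zfull y r).det) x
      = (Zfull x r).det * logDetGamma A (Zmat x) r γ := by
  obtain ⟨p, i, j⟩ := γ
  refine Fin.lastCases ?_ (fun s => ?_) r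
  · simp only [wirtinger_det_last, logDetGamma, Fin.castSucc_ne_last, if_false]
    have h := sum_adjugate_mul_bilinearAB (A := A) (B := B) (Zmat x p) (Zfull x (Fin.last n)) i j
    have hg : ∀ k l, bilinearAB A B (Zmat x p) (Zfull x (Fin.last n)) i j k l
        = -∑ q, gammaAB A B (Zmat x) (p, i, j) (q, k, l) := fun k l => by rw [sum_gammaAB, neg_neg]
    simp only [Fintype.sum_prod_type]
    rw [zero_sub, mul_neg, ← h, Finset.sum_comm]
    refine Finset.sum_congr rfl fun k _ => ?_
    rw [Finset.sum_comm]
    refine Finset.sum_congr rfl fun l _ => ?_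
    rw [hg, mul_neg, Finset.mul_sum, ← Finset.sum_neg_distrib]
    exact Finset.sum_congr rfl fun q _ => by ring
  · simp only [Zfull_castSucc, wirtinger_det_Zmat, Fintype.sum_prod_type, mul_ite, mul_zero,
      Finset.sum_ite_irrel, Finset.sum_const_zero, Finset.sum_ite_eq', Finset.mem_univ, if_true,
      gammaAB_eq_bilinearAB, add_mul, Finset.sum_add_distrib, logDetGamma]
    have h := sum_adjugate_mul_bilinearAB (A := A) (B := B) (Zmat x p) (Zmat x s) i j
    simp only [mul_comm ((Zmat x s).adjugate _ _) (bilinearAB _ _ _ _ _ _ _ _)] at h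
    rw [h]
    by_cases hps : p = s
    · subst hps
      have e1 : ∑ k, ∑ l, A i l * Zmat x p k j * (Zmat x p).adjugate l k
          = (Zmat x p).det * A i j := by
        have : (Zmat x p).det * A i j = (A * ((Zmat x p).adjugate * Zmat x p)) i j := by
          rw [Matrix.adjugate_mul, Matrix.mul_smul, Matrix.mul_one, Matrix.smul_apply, smul_eq_mul]
        rw [this, ← Matrix.mul_assoc, Matrix.mul_apply]
        refine Finset.sum_congr rfl fun k _ => ?_
        rw [Matrix.mul_apply, Finset.sum_mul]
        exact Finset.sum_congr rfl fun l _ => by ring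
      have e2 : ∑ k, ∑ l, A k j * Zmat x p i l * (Zmat x p).adjugate l k
          = (Zmat x p).det * A i j := by
        have : (Zmat x p).det * A i j = (Zmat x p * (Zmat x p).adjugate * A) i j := by
          rw [Matrix.mul_adjugate, Matrix.smul_mul, Matrix.one_mul, Matrix.smul_apply, smul_eq_mul]
        rw [this, Matrix.mul_apply]
        refine Finset.sum_congr rfl fun k _ => ?_
        rw [Matrix.mul_apply, Finset.sum_mul]
        exact Finset.sum_congr rfl fun l _ => by ring
      simp only [if_true, add_mul, Finset.sum_add_distrib, e1, e2]
      ring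
    · have hps' : ¬ p.castSucc = s.castSucc := fun h => hps (Fin.castSucc_injective n h)
      simp only [hps, hps', if_false, zero_mul, Finset.sum_const_zero]
      ring

end Determinants

/-! ### The divergence of the co-metric and the drift -/

section Drift

variable {n d : ℕ} {A : Matrix (Fin d) (Fin d) ℂ} {B : Matrix (Fin d × Fin d) (Fin d × Fin d) ℂ}

@[fun_prop]
lemma differentiableAt_entry (γ : Idx n d) (x : Idx n d → ℝ) : DifferentiableAt ℝ (entry γ) x :=
  (hasFDerivAt_entry γ x).differentiableAt

lemma wirtinger_const_mul_entry (β γ : Idx n d) (c : ℂ) (x : Idx n d → ℝ) :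
    wirtinger β (fun y => c * entry γ y) x = if γ = β then c else 0 := by
  rw [wirtinger_const_mul c (differentiableAt_entry γ x), wirtinger_entry]; simp

lemma wirtinger_const_mul_entry_mul_entry (β γ δ : Idx n d) (c : ℂ) (x : Idx n d → ℝ) :
    wirtinger β (fun y => c * (entry γ y * entry δ y)) x
      = (if δ = β then c * entry γ x else 0) + if γ = β then c * entry δ x else 0 := by
  rw [wirtinger_const_mul c (by fun_prop), wirtinger_mul (by fun_prop) (by fun_prop),
    wirtinger_entry, wirtinger_entry]
  simp [mul_add]

lemma wirtinger_sum_quadratic {κ : Type*} [Fintype κ] (β : Idx n d) (γ δ : κ → Idx n d)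
    (c : κ → ℂ) (x : Idx n d → ℝ) :
    wirtinger β (fun y => ∑ a, c a * (entry (γ a) y * entry (δ a) y)) x
      = ∑ a, ((if δ a = β then c a * entry (γ a) x else 0)
          + if γ a = β then c a * entry (δ a) x else 0) := by
  rw [wirtinger_sum _ fun _ _ => by fun_prop]
  simp only [wirtinger_const_mul_entry_mul_entry]

lemma wirtinger_sum_sum {κ : Type*} [Fintype κ] (β : Idx n d) (γ δ : κ → κ → Idx n d)
    (c : κ → κ → ℂ) (x : Idx n d → ℝ) :
    wirtinger β (fun y => ∑ a, ∑ b, c a b * (entry (γ a b) y * entry (δ a b) y)) x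
      = ∑ a, ∑ b, ((if δ a b = β then c a b * entry (γ a b) x else 0)
          + if γ a b = β then c a b * entry (δ a b) x else 0) := by
  rw [wirtinger_sum _ fun _ _ => by fun_prop]
  simp only [wirtinger_sum_quadratic]

lemma sum_wirtinger_bilinearAB (x : Idx n d → ℝ) (p : Fin n) (i j : Fin d) :
    ∑ q, ∑ k, ∑ l, wirtinger (q, k, l) (fun y => bilinearAB A B (Zmat y p) (Zmat y q) i j k l) x
      = - n * d * ((A * Zmat x p) i j + (Zmat x p * A) i j) - 2 * A i j * (Zmat x p).trace
        + ∑ u, ∑ v, (B (i, u) (j, v) * Zmat x p u v + B (v, j) (u, i) * Zmat x p u v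
          - B (i, u) (v, u) * Zmat x p v j - B (v, j) (v, u) * Zmat x p i u) := by
  have hfun : ∀ q k l, (fun y : Idx n d → ℝ => bilinearAB A B (Zmat y p) (Zmat y q) i j k l)
      = fun y => (∑ a, ∑ b, B (i, a) (l, b) * (entry (p, a, j) y * entry (q, k, b) y)
        + ∑ a, ∑ b, B (a, j) (b, k) * (entry (p, i, a) y * entry (q, b, l) y))
        - (∑ a, ∑ b, B (a, j) (l, b) * (entry (p, i, a) y * entry (q, k, b) y)
        + ∑ a, ∑ b, B (i, a) (b, k) * (entry (p, a, j) y * entry (q, b, l) y))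
        - (∑ m, A k j * (entry (p, i, m) y * entry (q, m, l) y)
          + ∑ m, A i l * (entry (q, k, m) y * entry (p, m, j) y)) := fun q k l => by
    funext y
    simp only [bilinearAB, Matrix.mul_apply, Finset.mul_sum, Finset.sum_add_distrib,
      Finset.sum_sub_distrib, entry, mul_assoc]
    ring
  have hw : ∀ q k l, wirtinger (q, k, l)
      (fun y => bilinearAB A B (Zmat y p) (Zmat y q) i j k l) x
      = (∑ a, B (i, a) (l, l) * Zmat x p a j
          + (if p = q then if j = l then ∑ b, B (i, k) (l, b) * Zmat x q k b else 0 else 0)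
        + (∑ a, B (a, j) (k, k) * Zmat x p i a
          + (if p = q then if i = k then ∑ b, B (l, j) (b, k) * Zmat x q b l else 0 else 0)))
        - (∑ a, B (a, j) (l, l) * Zmat x p i a
          + (if p = q then if i = k then ∑ b, B (l, j) (l, b) * Zmat x q k b else 0 else 0)
        + (∑ a, B (i, a) (k, k) * Zmat x p a j
          + (if p = q then if j = l then ∑ b, B (i, k) (b, k) * Zmat x q b l else 0 else 0)))
        - (A k j * Zmat x p i k + (if p = q then if i = k then A k j * Zmat x q l l else 0 else 0)
          + ((if p = q then if j = l then A i l * Zmat x q k k else 0 else 0)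
            + A i l * Zmat x p l j)) := fun q k l => by
    rw [hfun, wirtinger_sub (by fun_prop) (by fun_prop), wirtinger_sub (by fun_prop) (by fun_prop),
      wirtinger_add (by fun_prop) (by fun_prop), wirtinger_add (by fun_prop) (by fun_prop),
      wirtinger_add (by fun_prop) (by fun_prop), wirtinger_sum_sum, wirtinger_sum_sum,
      wirtinger_sum_sum, wirtinger_sum_sum, wirtinger_sum_quadratic, wirtinger_sum_quadratic]
    simp only [Prod.mk.injEq, ite_and, true_and, if_true, Finset.sum_add_distrib, entry,
      Finset.sum_ite_irrel, Finset.sum_ite_eq', Finset.mem_univ,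
      Finset.sum_const_zero]
  simp only [hw]
  simp only [Finset.sum_add_distrib, Finset.sum_sub_distrib,
    Finset.sum_ite_irrel, Finset.sum_ite_eq, Finset.mem_univ, if_true,
    Finset.sum_const_zero, Finset.sum_const, Finset.card_univ, Fintype.card_fin, ← Finset.mul_sum,
    Matrix.mul_apply, Matrix.trace, Matrix.diag, nsmul_eq_mul]
  have e1 : ∑ u, ∑ v, B (v, j) (u, i) * Zmat x p u v = ∑ u, ∑ v, B (u, j) (v, i) * Zmat x p v u :=
    Finset.sum_comm
  have e2 : ∑ u, ∑ v, B (v, j) (v, u) * Zmat x p i u = ∑ u, ∑ v, B (u, j) (u, v) * Zmat x p i v :=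
    Finset.sum_comm
  have e3 : ∑ u, Zmat x p i u * A u j = ∑ u, A u j * Zmat x p i u :=
    Finset.sum_congr rfl fun _ _ => mul_comm _ _
  rw [e1, e2, e3]
  ring

lemma contDiff_gammaAB (γ β : Idx n d) {k : WithTop ℕ∞} :
    ContDiff ℝ k fun x : Idx n d → ℝ => gammaAB A B (Zmat x) γ β := by
  obtain ⟨p, i, j⟩ := γ
  obtain ⟨q, k', l⟩ := β
  have hZ : ∀ (p : Fin n) (i j : Fin d), ContDiff ℝ k fun x : Idx n d → ℝ => Zmat x p i j :=
    fun p i j => contDiff_Zmat p i j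
  by_cases hpq : p = q <;>
  · simp only [gammaAB, Matrix.mul_apply, hpq, if_true, if_false]
    fun_prop

lemma contDiff_cometricAB (α β : Idx n d) {k : WithTop ℕ∞} :
    ContDiff ℝ k fun x : Idx n d → ℝ => cometricAB A B x α β := by
  simp only [cometricAB, Matrix.of_apply, toRealCoord_apply]
  exact Complex.reCLM.contDiff.comp (ContDiff.sum fun _ _ => contDiff_const.mul
    (ContDiff.sum fun _ _ => contDiff_const.mul (contDiff_gammaAB _ _)))

/-- The divergence of the co-metric and the logarithmic derivative of the Dirichlet density add up to
`generatorAB`, the drift on the entries. -/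
lemma sum_wirtinger_gammaAB_add (a : Fin (n + 1) → ℝ) (x : Idx n d → ℝ) (p : Fin n)
    (i j : Fin d) :
    ∑ β, wirtinger β (fun y => gammaAB A B (Zmat y) (p, i, j) β) x
      + ∑ r, ((a r - 1 : ℝ) : ℂ) * logDetGamma A (Zmat x) r (p, i, j)
      = generatorAB A B a (Zmat x) p i j := by
  have hbil : ∀ q k l, Differentiable ℝ fun y : Idx n d → ℝ =>
      bilinearAB A B (Zmat y p) (Zmat y q) i j k l := fun q k l => by
    simp only [bilinearAB, Matrix.mul_apply]
    have hZ : ∀ (p : Fin n) (i j : Fin d), Differentiable ℝ fun x : Idx n d → ℝ => Zmat x p i j :=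
      fun p i j y => differentiableAt_entry (p, i, j) y
    fun_prop
  have hw : ∀ q k l, wirtinger (q, k, l) (fun y => gammaAB A B (Zmat y) (p, i, j) (q, k, l)) x
      = (if p = q then (if j = l then A i l else 0) + (if i = k then A k j else 0) else 0)
        + wirtinger (q, k, l) (fun y => bilinearAB A B (Zmat y p) (Zmat y q) i j k l) x := by
    intro q k l
    simp only [gammaAB_eq_bilinearAB]
    by_cases hpq : p = q
    · subst hpq
      simp only [if_true]
      have h := wirtinger_add (β := (p, k, l)) (x := x)
        (f := fun y => A i l * entry (p, k, j) y + A k j * entry (p, i, l) y)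
        (h := fun y => bilinearAB A B (Zmat y p) (Zmat y p) i j k l) (by fun_prop) (hbil p k l x)
      have h2 : wirtinger (p, k, l) (fun y => A i l * entry (p, k, j) y + A k j * entry (p, i, l) y)
          x = (if j = l then A i l else 0) + (if i = k then A k j else 0) := by
        rw [wirtinger_add (by fun_prop) (by fun_prop), wirtinger_const_mul_entry,
          wirtinger_const_mul_entry]
        simp
      rw [h2] at h
      exact h
    · simp [hpq]
  simp only [Fintype.sum_prod_type, hw, Finset.sum_add_distrib]
  rw [sum_wirtinger_bilinearAB, Fin.sum_univ_castSucc]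
  have hne : ∀ q : Fin n, (p.castSucc = q.castSucc) = (p = q) := fun q => by simp
  simp only [logDetGamma, Fin.castSucc_ne_last, hne, if_false, generatorAB, Complex.ofReal_sub,
    Complex.ofReal_one, Finset.sum_ite_irrel, Finset.sum_ite_eq, Finset.mem_univ, if_true,
    Finset.sum_const_zero, Finset.sum_const, Finset.card_univ, Fintype.card_fin, nsmul_eq_mul,
    mul_sub, mul_ite, mul_zero, Finset.sum_sub_distrib, ← Finset.sum_mul, Finset.sum_add_distrib,
    add_mul, sub_mul, zero_sub, one_mul]
  ring

lemma eq_toRealCoord_of_sum_entryCoeff {u v : Idx n d → ℂ}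
    (h : ∀ γ, ∑ α, entryCoeff γ α * u α = v γ) (α : Idx n d) : u α = toRealCoord v α := by
  have : toEntries u = v := funext fun γ => (toEntries_apply u γ).trans (h γ)
  rw [← this, toRealCoord_toEntries]

/-- `Γ_{A,B}(x_α, log det Z^{(r)})`, for a real coordinate `x_α`. -/
def logDetGammaCoord (A : Matrix (Fin d) (Fin d) ℂ) (r : Fin (n + 1)) (x : Idx n d → ℝ)
    (α : Idx n d) : ℝ :=
  (toRealCoord (logDetGamma A (Zmat x) r) α).re

/-- The drift of `L_{A,B,a}` in the real coordinates. -/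
def driftAB (A : Matrix (Fin d) (Fin d) ℂ) (B : Matrix (Fin d × Fin d) (Fin d × Fin d) ℂ)
    (a : Fin (n + 1) → ℝ) (x : Idx n d → ℝ) (α : Idx n d) : ℝ :=
  (toRealCoord (fun γ => generatorAB A B a (Zmat x) γ.1 γ.2.1 γ.2.2) α).re

lemma contDiff_logDetGammaCoord (r : Fin (n + 1)) (α : Idx n d) {k : WithTop ℕ∞} :
    ContDiff ℝ k fun x : Idx n d → ℝ => logDetGammaCoord A r x α := by
  simp only [logDetGammaCoord, toRealCoord_apply]
  refine Complex.reCLM.contDiff.comp (ContDiff.sum fun β _ => contDiff_const.mul ?_)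
  obtain ⟨p, i, j⟩ := β
  have hZ : ∀ (p : Fin n) (i j : Fin d), ContDiff ℝ k fun x : Idx n d → ℝ => Zmat x p i j :=
    fun p i j => contDiff_Zmat p i j
  simp only [logDetGamma, Matrix.mul_apply]
  fun_prop

lemma contDiff_driftAB (a : Fin (n + 1) → ℝ) (α : Idx n d) {k : WithTop ℕ∞} :
    ContDiff ℝ k fun x : Idx n d → ℝ => driftAB A B a x α := by
  simp only [driftAB, toRealCoord_apply]
  refine Complex.reCLM.contDiff.comp (ContDiff.sum fun β _ => contDiff_const.mul ?_)
  have hZ : ∀ (p : Fin n) (i j : Fin d), ContDiff ℝ k fun x : Idx n d → ℝ => Zmat x p i j :=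
    fun p i j => contDiff_Zmat p i j
  simp only [generatorAB, Matrix.mul_apply, Matrix.trace, Matrix.diag]
  fun_prop

lemma ofReal_logDetGammaCoord (hA : A.IsHermitian) (r : Fin (n + 1)) (x : Idx n d → ℝ) (α : Idx n d) :
    (logDetGammaCoord A r x α : ℂ) = toRealCoord (logDetGamma A (Zmat x) r) α := by
  refine ofReal_re_toRealCoord (fun γ => ?_) α
  obtain ⟨p, i, j⟩ := γ
  have hA' : ∀ u v, (starRingEnd ℂ) (A u v) = A v u := fun u v => hA.apply v u
  have hZ : ∀ r u v, (starRingEnd ℂ) (Zmat x r u v) = Zmat x r v u := fun r u v => star_Zmat x r u v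
  have e1 : ∑ u, Zmat x p i u * A u j = ∑ u, A u j * Zmat x p i u :=
    Finset.sum_congr rfl fun _ _ => mul_comm _ _
  have e2 : ∑ u, Zmat x p u j * A i u = ∑ u, A i u * Zmat x p u j :=
    Finset.sum_congr rfl fun _ _ => mul_comm _ _
  by_cases h : p.castSucc = r <;>
  · simp only [logDetGamma, swapIdx_mk, Matrix.mul_apply, Complex.star_def, map_add, map_sub,
      map_sum, map_mul, h, if_true, if_false, map_zero, hA', hZ, map_ofNat, e1, e2]
    ring

lemma sum_entryCoeff_logDetGammaCoord (hA : A.IsHermitian) (r : Fin (n + 1)) (x : Idx n d → ℝ) (γ : Idx n d) :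
    ∑ α, entryCoeff γ α * (logDetGammaCoord A r x α : ℂ) = logDetGamma A (Zmat x) r γ := by
  simp only [ofReal_logDetGammaCoord hA]
  rw [← toEntries_apply, toEntries_toRealCoord]

/-- The boundary equation of `sum_gammaAB_mul_wirtinger_det` in the real coordinates. -/
lemma sum_cometricAB_mul_pd_det (hA : A.IsHermitian) (hB : B.IsHermitian)
    (hsymm : ∀ (x : Idx n d → ℝ) (α β : Idx n d),
      gammaAB A B (Zmat x) α β = gammaAB A B (Zmat x) β α)
    (r : Fin (n + 1)) (x : Idx n d → ℝ) (α : Idx n d) :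
    ∑ β, cometricAB A B x α β * pd β (fun y => (Zfull y r).det.re) x
      = (Zfull x r).det.re * logDetGammaCoord A r x α := by
  have hdet : ∀ y : Idx n d → ℝ, ((Zfull y r).det.re : ℂ) = (Zfull y r).det := fun y =>
    ofReal_det_re (Zfull_isHermitian y r)
  have hdiff : Differentiable ℝ fun y : Idx n d → ℝ => (Zfull y r).det.re :=
    (contDiff_det_re (k := 1) fun i j => contDiff_Zfull r i j).differentiable (by simp)
  have hpd : ∀ β, ((pd β (fun y => (Zfull y r).det.re) x : ℝ) : ℂ)
      = pd β (fun y => (Zfull y r).det) x := fun β => by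
    rw [← pd_ofReal (hdiff x)]; simp only [hdet]
  have h1 := eq_toRealCoord_of_sum_entryCoeff
    (u := fun α => ((∑ β, cometricAB A B x α β * pd β (fun y => (Zfull y r).det.re) x : ℝ) : ℂ))
    (v := fun γ => (Zfull x r).det * logDetGamma A (Zmat x) r γ) (fun γ => by
      rw [← sum_gammaAB_mul_wirtinger_det]
      simp only [Complex.ofReal_sum, Complex.ofReal_mul, hpd, Finset.mul_sum, wirtinger]
      rw [Finset.sum_comm]
      calc _ = ∑ β, toRealCoord (fun β' => gammaAB A B (Zmat x) γ β') β
              * pd β (fun y => (Zfull y r).det) x := by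
            refine Finset.sum_congr rfl fun β _ => ?_
            rw [← sum_entryCoeff_cometricAB hA hB hsymm, Finset.sum_mul]
            exact Finset.sum_congr rfl fun _ _ => by ring
        _ = _ := by
            simp only [toRealCoord_apply, Finset.sum_mul]
            rw [Finset.sum_comm]
            exact Finset.sum_congr rfl fun _ _ => Finset.sum_congr rfl fun _ _ => by ring) α
  have h2 := eq_toRealCoord_of_sum_entryCoeff
    (u := fun α => (((Zfull x r).det.re * logDetGammaCoord A r x α : ℝ) : ℂ))
    (v := fun γ => (Zfull x r).det * logDetGamma A (Zmat x) r γ) (fun γ => by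
      rw [← sum_entryCoeff_logDetGammaCoord hA r x γ, Finset.mul_sum]
      refine Finset.sum_congr rfl fun _ _ => ?_
      rw [Complex.ofReal_mul, hdet]; ring) α
  exact_mod_cast h1.trans h2.symm

/-- The divergence of the co-metric, on the entries. The change to the entries is linear, so that it
commutes with the divergence. -/
lemma sum_entryCoeff_pd_cometricAB (hA : A.IsHermitian) (hB : B.IsHermitian)
    (hsymm : ∀ (x : Idx n d → ℝ) (α β : Idx n d),
      gammaAB A B (Zmat x) α β = gammaAB A B (Zmat x) β α)
    (x : Idx n d → ℝ) (γ : Idx n d) :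
    ∑ α, entryCoeff γ α * ((∑ β, pd β (fun y => cometricAB A B y α β) x : ℝ) : ℂ)
      = ∑ β, wirtinger β (fun y => gammaAB A B (Zmat y) γ β) x := by
  have hg : ∀ α β : Idx n d, Differentiable ℝ fun y => cometricAB A B y α β := fun α β =>
    (contDiff_cometricAB α β (k := 1)).differentiable (by simp)
  have hG : ∀ β : Idx n d, Differentiable ℝ fun y => gammaAB A B (Zmat y) γ β := fun β =>
    (contDiff_gammaAB γ β (k := 1)).differentiable (by simp)
  have hgc : ∀ α β : Idx n d, Differentiable ℝ fun y => (cometricAB A B y α β : ℂ) := fun α β y =>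
    (Complex.ofRealCLM.differentiableAt).comp y (hg α β y)
  have h : ∀ β, ∑ α, entryCoeff γ α * ((pd β (fun y => cometricAB A B y α β) x : ℝ) : ℂ)
      = ∑ β', realCoeff β β' * pd β (fun y => gammaAB A B (Zmat y) γ β') x := fun β => by
    have h1 : pd β (fun y => ∑ α, entryCoeff γ α * (cometricAB A B y α β : ℂ)) x
        = ∑ α, entryCoeff γ α * ((pd β (fun y => cometricAB A B y α β) x : ℝ) : ℂ) := by
      rw [pd_sum _ fun α _ => (hgc α β x).const_mul _]
      refine Finset.sum_congr rfl fun α _ => ?_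
      rw [pd_mul (differentiableAt_const _) (hgc α β x), pd_const, mul_zero, add_zero,
        pd_ofReal (hg α β x)]
    have h2 : pd β (fun y => ∑ β', realCoeff β β' * gammaAB A B (Zmat y) γ β') x
        = ∑ β', realCoeff β β' * pd β (fun y => gammaAB A B (Zmat y) γ β') x := by
      rw [pd_sum _ fun α _ => (hG α x).const_mul _]
      refine Finset.sum_congr rfl fun α _ => ?_
      rw [pd_mul (differentiableAt_const _) (hG α x), pd_const, mul_zero, add_zero]
    rw [← h1, ← h2]
    simp only [sum_entryCoeff_cometricAB hA hB hsymm, toRealCoord_apply]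
  simp only [Complex.ofReal_sum, Finset.mul_sum]
  rw [Finset.sum_comm]
  simp only [h, wirtinger]
  exact Finset.sum_comm

lemma ofReal_div_cometricAB_add (hA : A.IsHermitian) (hB : B.IsHermitian)
    (hsymm : ∀ (x : Idx n d → ℝ) (α β : Idx n d),
      gammaAB A B (Zmat x) α β = gammaAB A B (Zmat x) β α)
    (a : Fin (n + 1) → ℝ) (x : Idx n d → ℝ) (α : Idx n d) :
    ((∑ β, pd β (fun y => cometricAB A B y α β) x
      + ∑ r, (a r - 1) * logDetGammaCoord A r x α : ℝ) : ℂ)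
      = toRealCoord (fun γ => generatorAB A B a (Zmat x) γ.1 γ.2.1 γ.2.2) α := by
  refine eq_toRealCoord_of_sum_entryCoeff (u := fun α =>
    ((∑ β, pd β (fun y => cometricAB A B y α β) x
      + ∑ r, (a r - 1) * logDetGammaCoord A r x α : ℝ) : ℂ)) (fun γ => ?_) α
  rw [← sum_wirtinger_gammaAB_add, ← sum_entryCoeff_pd_cometricAB hA hB hsymm]
  simp only [Complex.ofReal_add, mul_add, Finset.sum_add_distrib]
  congr 1
  rw [← Finset.sum_congr rfl fun r _ => congrArg (((a r - 1 : ℝ) : ℂ) * ·)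
    (sum_entryCoeff_logDetGammaCoord hA r x γ)]
  simp only [Complex.ofReal_sum, Complex.ofReal_mul, Finset.mul_sum]
  rw [Finset.sum_comm]
  exact Finset.sum_congr rfl fun _ _ => Finset.sum_congr rfl fun _ _ => by ring

/-- The drift is the one prescribed by the co-metric and the density:
`b^α = ∑_β ∂_β g^{αβ} + Γ(x_α, log ρ)`. -/
lemma driftAB_eq (hA : A.IsHermitian) (hB : B.IsHermitian)
    (hsymm : ∀ (x : Idx n d → ℝ) (α β : Idx n d),
      gammaAB A B (Zmat x) α β = gammaAB A B (Zmat x) β α)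
    (a : Fin (n + 1) → ℝ) (x : Idx n d → ℝ) (α : Idx n d) :
    driftAB A B a x α = ∑ β, pd β (fun y => cometricAB A B y α β) x
      + ∑ r, (a r - 1) * logDetGammaCoord A r x α := by
  rw [driftAB, ← ofReal_div_cometricAB_add hA hB hsymm, Complex.ofReal_re]

lemma sum_entryCoeff_driftAB (hA : A.IsHermitian) (hB : B.IsHermitian)
    (hsymm : ∀ (x : Idx n d → ℝ) (α β : Idx n d),
      gammaAB A B (Zmat x) α β = gammaAB A B (Zmat x) β α)
    (a : Fin (n + 1) → ℝ) (x : Idx n d → ℝ) (γ : Idx n d) :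
    ∑ α, entryCoeff γ α * (driftAB A B a x α : ℂ)
      = generatorAB A B a (Zmat x) γ.1 γ.2.1 γ.2.2 := by
  have h : ∀ α, (driftAB A B a x α : ℂ)
      = toRealCoord (fun γ => generatorAB A B a (Zmat x) γ.1 γ.2.1 γ.2.2) α := fun α => by
    rw [driftAB_eq hA hB hsymm, ofReal_div_cometricAB_add hA hB hsymm]
  simp only [h]
  rw [← toEntries_apply, toEntries_toRealCoord]

end Drift

/-! ### Symmetry of diffusion operators up to the boundary -/

section Symmetry

variable {ι : Type*} [Fintype ι] [DecidableEq ι]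

lemma integral_pd_eq_zero {f : (ι → ℝ) → ℝ} (hf : ContDiff ℝ 1 f) (hc : HasCompactSupport f)
    (i : ι) : ∫ x, pd i f x = 0 := by
  have hcont : Continuous (fun x => fderiv ℝ f x (Pi.single i 1)) :=
    (hf.continuous_fderiv (by simp)).clm_apply continuous_const
  have h := integral_mul_fderiv_eq_neg_fderiv_mul_of_integrable (μ := (volume : Measure (ι → ℝ)))
    (f := fun _ => (1 : ℝ)) (g := f) (v := Pi.single i 1) (by simp)
    (by simpa using hcont.integrable_of_hasCompactSupport (hc.fderiv_apply ℝ _))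
    (by simpa using hf.continuous.integrable_of_hasCompactSupport hc)
    (fun _ _ => differentiableAt_const _) (fun x _ => hf.differentiable (by simp) x)
  simpa [pd] using h

variable {Ω : Set (ι → ℝ)} {g : (ι → ℝ) → Matrix ι ι ℝ} {ρ : (ι → ℝ) → ℝ} {b : (ι → ℝ) → ι → ℝ}

/-- `div (ρ Γ(f dh - h df)) = ρ (f L h - h L f)`. -/
lemma sum_pd_current (hΩ : IsOpen Ω) (hg : ∀ i j, ContDiff ℝ ∞ fun x => g x i j)
    (hgs : ∀ x i j, g x i j = g x j i) (hρ : ContDiffOn ℝ ∞ ρ Ω)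
    (hdiv : ∀ x ∈ Ω, ∀ i, ∑ j, pd j (fun y => ρ y * g y i j) x = ρ x * b x i)
    {f h : (ι → ℝ) → ℝ} (hf : ContDiff ℝ ∞ f) (hh : ContDiff ℝ ∞ h) {x : ι → ℝ} (hx : x ∈ Ω) :
    ∑ i, pd i (fun y => ρ y * ∑ j, g y i j * (f y * pd j h y - h y * pd j f y)) x
      = ρ x * (f x * diffusionOp g b h x - h x * diffusionOp g b f x) := by
  have hρx : DifferentiableAt ℝ ρ x :=
    (hρ.contDiffAt (hΩ.mem_nhds hx)).differentiableAt (by simp)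
  have hd : ∀ {u : (ι → ℝ) → ℝ}, ContDiff ℝ ∞ u → DifferentiableAt ℝ u x := fun hu =>
    hu.differentiable (by simp) x
  have hgx : ∀ i j, DifferentiableAt ℝ (fun y => g y i j) x := fun i j => hd (hg i j)
  have hw : ∀ j, DifferentiableAt ℝ (fun y => f y * pd j h y - h y * pd j f y) x := fun j =>
    hd ((hf.mul (contDiff_pd hh j)).sub (hh.mul (contDiff_pd hf j)))
  have hpw : ∀ i j, pd i (fun y => f y * pd j h y - h y * pd j f y) x
      = f x * pd i (pd j h) x - h x * pd i (pd j f) x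
        + (pd i f x * pd j h x - pd i h x * pd j f x) := fun i j => by
    rw [pd_sub ((hd hf).fun_mul (hd (contDiff_pd hh j))) ((hd hh).fun_mul (hd (contDiff_pd hf j))),
      pd_mul (hd hf) (hd (contDiff_pd hh j)), pd_mul (hd hh) (hd (contDiff_pd hf j))]
    ring
  have h1 : ∀ i, pd i (fun y => ρ y * ∑ j, g y i j * (f y * pd j h y - h y * pd j f y)) x
      = ∑ j, ρ x * g x i j * pd i (fun y => f y * pd j h y - h y * pd j f y) x
        + ∑ j, (f x * pd j h x - h x * pd j f x) * pd i (fun y => ρ y * g y i j) x := fun i => by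
    have e : (fun y => ρ y * ∑ j, g y i j * (f y * pd j h y - h y * pd j f y))
        = fun y => ∑ j, (ρ y * g y i j) * (f y * pd j h y - h y * pd j f y) := by
      funext y
      rw [Finset.mul_sum]
      exact Finset.sum_congr rfl fun _ _ => (mul_assoc _ _ _).symm
    rw [e, pd_sum _ fun j _ => (hρx.fun_mul (hgx i j)).fun_mul (hw j), ← Finset.sum_add_distrib]
    exact Finset.sum_congr rfl fun j _ => pd_mul (hρx.fun_mul (hgx i j)) (hw j)
  have h2 : ∑ i, ∑ j, (f x * pd j h x - h x * pd j f x) * pd i (fun y => ρ y * g y i j) x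
      = ∑ j, (f x * pd j h x - h x * pd j f x) * (ρ x * b x j) := by
    rw [Finset.sum_comm]
    refine Finset.sum_congr rfl fun j _ => ?_
    rw [← hdiv x hx j, Finset.mul_sum]
    refine Finset.sum_congr rfl fun i _ => ?_
    simp only [hgs _ i j]
  have h3 : ∑ i, ∑ j, g x i j * (pd i f x * pd j h x) = ∑ i, ∑ j, g x i j * (pd i h x * pd j f x) := by
    rw [Finset.sum_comm]
    refine Finset.sum_congr rfl fun i _ => Finset.sum_congr rfl fun j _ => ?_
    rw [hgs x j i]; ring
  have h4 : ∑ i, ∑ j, ρ x * g x i j * pd i (fun y => f y * pd j h y - h y * pd j f y) x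
      = ρ x * (f x * ∑ i, ∑ j, g x i j * pd i (pd j h) x
        - h x * ∑ i, ∑ j, g x i j * pd i (pd j f) x) := by
    have e : ∀ i j, ρ x * g x i j * pd i (fun y => f y * pd j h y - h y * pd j f y) x
        = ρ x * (f x * (g x i j * pd i (pd j h) x)) - ρ x * (h x * (g x i j * pd i (pd j f) x))
          + (ρ x * (g x i j * (pd i f x * pd j h x)) - ρ x * (g x i j * (pd i h x * pd j f x))) :=
      fun i j => by rw [hpw]; ring
    simp only [e, Finset.sum_add_distrib, Finset.sum_sub_distrib, ← Finset.mul_sum, h3]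
    ring
  simp only [h1, Finset.sum_add_distrib, h2, h4, diffusionOp, smul_eq_mul]
  have h5 : ∑ j, (f x * pd j h x - h x * pd j f x) * (ρ x * b x j)
      = ρ x * (f x * ∑ j, b x j * pd j h x - h x * ∑ j, b x j * pd j f x) := by
    simp only [mul_sub, sub_mul, Finset.mul_sum, Finset.sum_sub_distrib]
    congr 1 <;> exact Finset.sum_congr rfl fun _ _ => by ring
  rw [h5]
  ring

lemma continuous_diffusionOp (hg : ∀ i j, ContDiff ℝ ∞ fun x => g x i j)
    (hb : ∀ i, Continuous fun x => b x i) {f : (ι → ℝ) → ℝ} (hf : ContDiff ℝ ∞ f) :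
    Continuous (diffusionOp g b f) := by
  unfold diffusionOp
  refine Continuous.add ?_ ?_
  · exact continuous_finsetSum _ fun i _ => continuous_finsetSum _ fun j _ =>
      (hg i j).continuous.smul (contDiff_pd (contDiff_pd hf j) i).continuous
  · exact continuous_finsetSum _ fun i _ => (hb i).smul (contDiff_pd hf i).continuous

/-- A smooth cutoff: zero for `t ≤ 1` and one for `t ≥ 2`. -/
def cutoff (t : ℝ) : ℝ := Real.smoothTransition (t - 1)

lemma contDiff_cutoff : ContDiff ℝ ∞ cutoff :=
  Real.smoothTransition.contDiff.comp (contDiff_id.sub contDiff_const)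

lemma cutoff_of_le_one {t : ℝ} (ht : t ≤ 1) : cutoff t = 0 :=
  Real.smoothTransition.zero_of_nonpos (by linarith)

lemma cutoff_of_two_le {t : ℝ} (ht : 2 ≤ t) : cutoff t = 1 :=
  Real.smoothTransition.one_of_one_le (by linarith)

lemma abs_cutoff_le (t : ℝ) : |cutoff t| ≤ 1 := by
  rw [cutoff, abs_of_nonneg (Real.smoothTransition.nonneg _)]
  exact Real.smoothTransition.le_one _

lemma deriv_cutoff_of_two_lt {t : ℝ} (ht : 2 < t) : deriv cutoff t = 0 := by
  have : cutoff =ᶠ[𝓝 t] fun _ => 1 := by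
    filter_upwards [lt_mem_nhds ht] with s hs using cutoff_of_two_le hs.le
  rw [this.deriv_eq, deriv_const]

/-- The scale-invariant bound which keeps the boundary terms bounded when the cutoff is rescaled. -/
lemma exists_abs_mul_deriv_cutoff_le : ∃ K : ℝ, ∀ t, 0 < t → |t * deriv cutoff t| ≤ K := by
  have hc : Continuous fun t => t * deriv cutoff t :=
    continuous_id.mul (contDiff_cutoff.continuous_deriv (by simp))
  obtain ⟨K, hK⟩ := (isCompact_Icc (a := (0 : ℝ)) (b := 2)).exists_bound_of_continuousOn
    hc.continuousOn
  refine ⟨K, fun t ht => ?_⟩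
  by_cases h : t ≤ 2
  · exact hK t ⟨ht.le, h⟩
  · rw [deriv_cutoff_of_two_lt (not_le.mp h), mul_zero, abs_zero]
    exact (norm_nonneg _).trans (hK 0 ⟨le_rfl, by norm_num⟩)

/-- If `Γ(x_i, D)` is divisible by a defining function `D` of the boundary, then there are no
boundary terms: the operator with co-metric `g` and density `ρ` is symmetric on all functions which
are smooth up to the boundary. -/
lemma integral_mul_diffusionOp_sub_eq_zero (hΩ : IsOpen Ω) (hcomp : IsCompact (closure Ω))
    (hg : ∀ i j, ContDiff ℝ ∞ fun x => g x i j) (hgs : ∀ x i j, g x i j = g x j i)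
    (hρ : ContDiffOn ℝ ∞ ρ Ω) (hρint : IntegrableOn ρ Ω) (hb : ∀ i, Continuous fun x => b x i)
    (hdiv : ∀ x ∈ Ω, ∀ i, ∑ j, pd j (fun y => ρ y * g y i j) x = ρ x * b x i)
    {D : (ι → ℝ) → ℝ} (hD : ContDiff ℝ ∞ D) (hDpos : ∀ x ∈ Ω, 0 < D x)
    (hD0 : ∀ x ∈ frontier Ω, D x = 0) {C : (ι → ℝ) → ι → ℝ} (hC : ∀ i, Continuous fun x => C x i)
    (hCD : ∀ x ∈ Ω, ∀ i, ∑ j, g x i j * pd j D x = D x * C x i)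
    {f h : (ι → ℝ) → ℝ} (hf : ContDiff ℝ ∞ f) (hh : ContDiff ℝ ∞ h) :
    ∫ x in Ω, ρ x * (f x * diffusionOp g b h x - h x * diffusionOp g b f x) = 0 := by
  set w : ι → (ι → ℝ) → ℝ := fun j y => f y * pd j h y - h y * pd j f y with hw
  have hws : ∀ j, ContDiff ℝ ∞ (w j) := fun j =>
    (hf.mul (contDiff_pd hh j)).sub (hh.mul (contDiff_pd hf j))
  set F : (ι → ℝ) → ℝ := fun x => f x * diffusionOp g b h x - h x * diffusionOp g b f x with hF
  set G : (ι → ℝ) → ℝ := fun x => ∑ j, w j x * C x j with hG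
  have hFc : Continuous F := (hf.continuous.mul (continuous_diffusionOp hg hb hh)).sub
    (hh.continuous.mul (continuous_diffusionOp hg hb hf))
  have hGc : Continuous G := continuous_finsetSum _ fun j _ => (hws j).continuous.mul (hC j)
  obtain ⟨MF, hMF⟩ := hcomp.exists_bound_of_continuousOn hFc.continuousOn
  obtain ⟨MG, hMG⟩ := hcomp.exists_bound_of_continuousOn hGc.continuousOn
  obtain ⟨K, hK⟩ := exists_abs_mul_deriv_cutoff_le
  let t : ℕ → (ι → ℝ) → ℝ := fun m x => ((m : ℝ) + 1) * D x
  have ht : ∀ m, ContDiff ℝ ∞ (t m) := fun m => contDiff_const.mul hD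
  have htpos : ∀ m, ∀ x ∈ Ω, 0 < t m x := fun m x hx => mul_pos (by positivity) (hDpos x hx)
  let J : ℕ → (ι → ℝ) → ℝ := fun m x =>
    ρ x * (cutoff (t m x) * F x + t m x * deriv cutoff (t m x) * G x)
  -- the integrals of the divergences of the truncated currents vanish
  have hJ : ∀ m, ∫ x in Ω, J m x = 0 := by
    intro m
    set V : ι → (ι → ℝ) → ℝ := fun i y => ρ y * ∑ j, g y i j * w j y with hV
    set η : (ι → ℝ) → ℝ := fun y => cutoff (t m y) with hη
    have hηs : ContDiff ℝ ∞ η := contDiff_cutoff.comp (ht m)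
    have hVs : ∀ i, ContDiffOn ℝ ∞ (V i) Ω := fun i => hρ.mul (ContDiff.sum fun j _ =>
      (hg i j).mul (hws j)).contDiffOn
    let Φ : ι → (ι → ℝ) → ℝ := fun i => Ω.indicator fun y => η y * V i y
    have hclosed : IsClosed (closure Ω ∩ {y | 1 ≤ t m y}) :=
      isClosed_closure.inter (isClosed_le continuous_const (ht m).continuous)
    have hsub : closure Ω ∩ {y | 1 ≤ t m y} ⊆ Ω := by
      rintro y ⟨hy, hy1⟩
      by_contra hyΩ
      have : D y = 0 := hD0 y ⟨hy, by rwa [hΩ.interior_eq]⟩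
      simp only [t, this, Set.mem_ofPred_eq, mul_zero] at hy1
      linarith
    have hsupp : ∀ i, tsupport (Φ i) ⊆ closure Ω ∩ {y | 1 ≤ t m y} := fun i => by
      refine closure_minimal (fun y hy => ?_) hclosed
      have hyΩ : y ∈ Ω := by
        by_contra hn
        exact hy (Set.indicator_of_notMem hn _)
      refine ⟨subset_closure hyΩ, ?_⟩
      by_contra hn
      refine hy ?_
      change Ω.indicator _ y = 0
      rw [Set.indicator_of_mem hyΩ, hη]
      simp only [cutoff_of_le_one (not_le.mp hn).le, zero_mul]
    have hΦe : ∀ i, ∀ y ∈ Ω, Φ i =ᶠ[𝓝 y] fun z => η z * V i z := fun i y hy => by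
      filter_upwards [hΩ.mem_nhds hy] with z hz using Set.indicator_of_mem hz _
    have hΦs : ∀ i, ContDiff ℝ 1 (Φ i) := fun i => by
      refine contDiff_iff_contDiffAt.mpr fun y => ?_
      by_cases hy : y ∉ tsupport (Φ i)
      · exact contDiffAt_const.congr_of_eventuallyEq (notMem_tsupport_iff_eventuallyEq.mp hy)
      rw [not_not] at hy
      have hyΩ := hsub (hsupp i hy)
      have h1 : ContDiffAt ℝ 1 (fun z => η z * V i z) y :=
        (hηs.contDiffAt.mul ((hVs i).contDiffAt (hΩ.mem_nhds hyΩ))).of_le (by simp)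
      exact h1.congr_of_eventuallyEq (hΦe i y hyΩ)
    have hΦc : ∀ i, HasCompactSupport (Φ i) := fun i =>
      hcomp.of_isClosed_subset (isClosed_tsupport _) ((hsupp i).trans Set.inter_subset_left)
    have hcontpd : ∀ i, Integrable (pd i (Φ i)) := fun i =>
      Continuous.integrable_of_hasCompactSupport
        (((hΦs i).continuous_fderiv (by simp)).clm_apply continuous_const)
        ((hΦc i).fderiv_apply ℝ _)
    have hsum : ∫ x, ∑ i, pd i (Φ i) x = 0 := by
      rw [integral_finsetSum _ fun i _ => hcontpd i]
      exact Finset.sum_eq_zero fun i _ => integral_pd_eq_zero (hΦs i) (hΦc i) i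
    rw [← hsum, ← integral_indicator hΩ.measurableSet]
    congr 1
    funext x
    by_cases hx : x ∈ Ω
    · rw [Set.indicator_of_mem hx]
      have hηx : DifferentiableAt ℝ η x := hηs.differentiable (by simp) x
      have hVx : ∀ i, DifferentiableAt ℝ (V i) x := fun i =>
        ((hVs i).contDiffAt (hΩ.mem_nhds hx)).differentiableAt (by simp)
      have hpdη : ∀ i, pd i η x = deriv cutoff (t m x) * (((m : ℝ) + 1) * pd i D x) := fun i => by
        have h1 : HasFDerivAt (t m) (((m : ℝ) + 1) • fderiv ℝ D x) x :=
          (hD.differentiable (by simp) x).hasFDerivAt.const_mul _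
        have h2 : HasDerivAt cutoff (deriv cutoff (t m x)) (t m x) :=
          (contDiff_cutoff.differentiable (by simp) _).hasDerivAt
        have h3 := h2.comp_hasFDerivAt x h1
        rw [pd, show η = cutoff ∘ t m from rfl, h3.fderiv]; rfl
      have e : ∀ i, pd i (Φ i) x = η x * pd i (V i) x + V i x * pd i η x := fun i => by
        rw [pd_congr (hΦe i x hx), pd_mul hηx (hVx i)]
      simp only [e, Finset.sum_add_distrib, ← Finset.mul_sum]
      rw [sum_pd_current hΩ hg hgs hρ hdiv hf hh hx]
      have e2 : ∑ i, V i x * pd i η x = ρ x * (t m x * deriv cutoff (t m x) * G x) := by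
        have : ∀ i, V i x * pd i η x = ∑ j, ρ x * deriv cutoff (t m x) * ((m : ℝ) + 1) * w j x
            * (g x j i * pd i D x) := fun i => by
          rw [hV, hpdη]
          simp only [Finset.mul_sum, Finset.sum_mul]
          refine Finset.sum_congr rfl fun j _ => ?_
          rw [hgs x i j]; ring
        simp only [this]
        rw [Finset.sum_comm]
        simp only [← Finset.mul_sum, hCD x hx]
        simp only [hG, Finset.mul_sum, t]
        exact Finset.sum_congr rfl fun _ _ => by ring
      rw [e2]
      simp only [J, hη, hF]
      ring
    · rw [Set.indicator_of_notMem hx]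
      symm
      refine Finset.sum_eq_zero fun i _ => ?_
      have hxs : x ∉ tsupport (Φ i) := fun h' => hx (hsub (hsupp i h'))
      rw [pd_congr (notMem_tsupport_iff_eventuallyEq.mp hxs)]
      exact pd_const i 0 x
  have hbd : ∀ m, ∀ x ∈ Ω, ‖J m x‖ ≤ |ρ x| * (MF + K * MG) := fun m x hx => by
    have hF1 := hMF x (subset_closure hx)
    have hG1 := hMG x (subset_closure hx)
    have hK1 := hK _ (htpos m x hx)
    rw [Real.norm_eq_abs] at *
    rw [abs_mul]
    refine mul_le_mul_of_nonneg_left ((abs_add_le _ _).trans (add_le_add ?_ ?_)) (abs_nonneg _)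
    · rw [abs_mul]
      exact (mul_le_of_le_one_left (abs_nonneg _) (abs_cutoff_le _)).trans hF1
    · rw [abs_mul]
      exact mul_le_mul hK1 hG1 (abs_nonneg _) ((abs_nonneg _).trans hK1)
  have hlim : ∀ x ∈ Ω, Filter.Tendsto (fun m => J m x) Filter.atTop (𝓝 (ρ x * F x)) := by
    intro x hx
    have hev : ∀ᶠ m : ℕ in Filter.atTop, J m x = ρ x * F x := by
      have h1 : Filter.Tendsto (fun m : ℕ => t m x) Filter.atTop Filter.atTop :=
        Filter.Tendsto.atTop_mul_const (hDpos x hx)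
          (Filter.tendsto_atTop_add_const_right _ _ tendsto_natCast_atTop_atTop)
      filter_upwards [h1.eventually_gt_atTop 2] with m hm
      simp only [J, cutoff_of_two_le hm.le, deriv_cutoff_of_two_lt hm]
      ring
    exact tendsto_const_nhds.congr' (hev.mono fun _ h => h.symm)
  have hmeas : ∀ m, AEStronglyMeasurable (J m) (volume.restrict Ω) := fun m => by
    refine ContinuousOn.aestronglyMeasurable ?_ hΩ.measurableSet
    refine hρ.continuousOn.mul (Continuous.continuousOn ?_)
    exact ((contDiff_cutoff.continuous.comp (ht m).continuous).mul hFc).add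
      (((ht m).continuous.mul ((contDiff_cutoff.continuous_deriv (by simp)).comp
        (ht m).continuous)).mul hGc)
  have htend := tendsto_integral_of_dominated_convergence (μ := volume.restrict Ω) (F := J)
    (f := fun x => ρ x * F x) (fun x => |ρ x| * (MF + K * MG)) hmeas (hρint.abs.mul_const _)
    (fun m => (ae_restrict_iff' hΩ.measurableSet).mpr (Filter.Eventually.of_forall (hbd m)))
    ((ae_restrict_iff' hΩ.measurableSet).mpr (Filter.Eventually.of_forall hlim))
  simp only [hJ] at htend
  exact tendsto_nhds_unique htend tendsto_const_nhds

end Symmetry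

/-! ### Symmetry of `L_{A,B,a}` -/

section WeightedMeasure

variable {ι : Type*} [Fintype ι] {Ω : Set (ι → ℝ)} {ρ : (ι → ℝ) → ℝ} {μ : Measure (ι → ℝ)}

lemma ae_mem_of_eq_withDensity (hΩ : IsOpen Ω)
    (hμ : μ = (volume.restrict Ω).withDensity fun x => ENNReal.ofReal (ρ x)) : ∀ᵐ x ∂μ, x ∈ Ω := by
  rw [hμ]
  exact (withDensity_absolutelyContinuous _ _).ae_le (ae_restrict_mem hΩ.measurableSet)

lemma integral_eq_of_eq_withDensity (hΩ : IsOpen Ω) (hρc : ContinuousOn ρ Ω)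
    (hρ : ∀ x ∈ Ω, 0 < ρ x)
    (hμ : μ = (volume.restrict Ω).withDensity fun x => ENNReal.ofReal (ρ x))
    (F : (ι → ℝ) → ℝ) : ∫ x, F x ∂μ = ∫ x in Ω, ρ x * F x := by
  have hm : AEMeasurable (fun x => ENNReal.ofReal (ρ x)) (volume.restrict Ω) :=
    (hρc.aemeasurable hΩ.measurableSet).ennreal_ofReal
  rw [hμ, integral_withDensity_eq_integral_toReal_smul₀ hm (by simp)]
  refine setIntegral_congr_fun hΩ.measurableSet fun x hx => ?_
  simp only [ENNReal.toReal_ofReal (hρ x hx).le, smul_eq_mul]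

lemma integrableOn_of_eq_withDensity [IsFiniteMeasure μ] (hΩ : IsOpen Ω) (hρc : ContinuousOn ρ Ω)
    (hρ : ∀ x ∈ Ω, 0 < ρ x)
    (hμ : μ = (volume.restrict Ω).withDensity fun x => ENNReal.ofReal (ρ x)) :
    IntegrableOn ρ Ω := by
  refine ⟨hρc.aestronglyMeasurable hΩ.measurableSet, ?_⟩
  rw [hasFiniteIntegral_iff_ofReal ((ae_restrict_iff' hΩ.measurableSet).mpr
    (Filter.Eventually.of_forall fun x hx => (hρ x hx).le))]
  have h := measure_lt_top μ Set.univ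
  rwa [hμ, withDensity_apply _ MeasurableSet.univ, Measure.restrict_univ] at h

lemma integrable_of_eq_withDensity [IsFiniteMeasure μ] (hΩ : IsOpen Ω)
    (hcomp : IsCompact (closure Ω))
    (hμ : μ = (volume.restrict Ω).withDensity fun x => ENNReal.ofReal (ρ x))
    {F : (ι → ℝ) → ℝ} (hF : Continuous F) : Integrable F μ := by
  obtain ⟨M, hM⟩ := hcomp.exists_bound_of_continuousOn hF.continuousOn
  exact Integrable.of_bound hF.aestronglyMeasurable M
    ((ae_mem_of_eq_withDensity hΩ hμ).mono fun x hx => hM x (subset_closure hx))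

end WeightedMeasure

section DirichletSymmetry

variable {n d : ℕ} {A : Matrix (Fin d) (Fin d) ℂ} {B : Matrix (Fin d × Fin d) (Fin d × Fin d) ℂ}
  {a : Fin (n + 1) → ℝ}

lemma contDiffOn_dirichletDensity (hn : 1 ≤ n) (a : Fin (n + 1) → ℝ) :
    ContDiffOn ℝ ∞ (dirichletDensity a) (interior (matrixSimplex n d)) :=
  contDiffOn_const.mul (contDiffOn_dirichletWeight hn a)

lemma dirichletDensity_pos (hn : 1 ≤ n) (ha : ∀ r, 0 < a r) {x : Idx n d → ℝ}
    (hx : x ∈ interior (matrixSimplex n d)) : 0 < dirichletDensity a x :=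
  mul_pos (inv_pos.mpr (ENNReal.toReal_pos (lintegral_dirichletWeight_pos hn a).ne'
    (lintegral_dirichletWeight_lt_top hn ha).ne)) (dirichletWeight_pos hn a hx)

lemma isCompact_closure_interior_matrixSimplex :
    IsCompact (closure (interior (matrixSimplex n d))) :=
  isCompact_matrixSimplex.of_isClosed_subset isClosed_closure
    (closure_minimal interior_subset isClosed_matrixSimplex)

lemma pd_dirichletDensity (hn : 1 ≤ n) (a : Fin (n + 1) → ℝ) {x : Idx n d → ℝ}
    (hx : x ∈ interior (matrixSimplex n d)) (β : Idx n d) :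
    pd β (dirichletDensity a) x = dirichletDensity a x *
      ∑ r, (a r - 1) * ((Zfull x r).det.re⁻¹ * pd β (fun y => (Zfull y r).det.re) x) := by
  have hdiff : ∀ r, HasFDerivAt (fun y : Idx n d → ℝ => (Zfull y r).det.re)
      (fderiv ℝ (fun y : Idx n d → ℝ => (Zfull y r).det.re) x) x := fun r =>
    ((contDiff_det_re (k := 1) fun i j => contDiff_Zfull r i j).differentiable
      (by simp) x).hasFDerivAt
  have hpos : ∀ y ∈ interior (matrixSimplex n d), ∀ r, 0 < (Zfull y r).det.re := fun y hy r =>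
    det_re_pos ((mem_interior_matrixSimplex_iff hn y).mp hy r)
  have hlog := HasFDerivAt.fun_sum (u := Finset.univ) fun (r : Fin (n + 1)) _ =>
    ((hdiff r).log (hpos x hx r).ne').const_mul (a r - 1)
  have hexp := hlog.exp
  have heq : dirichletWeight a =ᶠ[𝓝 x]
      fun y => Real.exp (∑ r, (a r - 1) * Real.log (Zfull y r).det.re) := by
    filter_upwards [isOpen_interior.mem_nhds hx] with y hy
    rw [Real.exp_sum, dirichletWeight]
    refine Finset.prod_congr rfl fun r _ => ?_
    rw [Real.rpow_def_of_pos (hpos y hy r), mul_comm]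
  have hval := heq.eq_of_nhds
  have hW : pd β (dirichletWeight a) x = dirichletWeight a x *
      ∑ r, (a r - 1) * ((Zfull x r).det.re⁻¹ * pd β (fun y => (Zfull y r).det.re) x) := by
    rw [pd_congr heq, pd, hexp.fderiv, hval]
    simp [pd]
  have hWd : DifferentiableAt ℝ (dirichletWeight a) x :=
    ((contDiffOn_dirichletWeight hn a).contDiffAt
      (isOpen_interior.mem_nhds hx)).differentiableAt (by simp)
  change pd β (fun y => _ * dirichletWeight a y) x = _
  rw [pd_mul (differentiableAt_const _) hWd, pd_const, hW, dirichletDensity]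
  ring

/-- `div (ρ Γ) = ρ b` for the Dirichlet density `ρ`: the operator with drift `driftAB` is in divergence
form. -/
lemma sum_pd_dirichletDensity_mul_cometricAB (hn : 1 ≤ n) (hA : A.IsHermitian) (hB : B.IsHermitian)
    (hsymm : ∀ (x : Idx n d → ℝ) (α β : Idx n d),
      gammaAB A B (Zmat x) α β = gammaAB A B (Zmat x) β α) {x : Idx n d → ℝ}
    (hx : x ∈ interior (matrixSimplex n d)) (α : Idx n d) :
    ∑ β, pd β (fun y => dirichletDensity a y * cometricAB A B y α β) x
      = dirichletDensity a x * driftAB A B a x α := by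
  have hρd : DifferentiableAt ℝ (dirichletDensity a) x :=
    ((contDiffOn_dirichletDensity hn a).contDiffAt
      (isOpen_interior.mem_nhds hx)).differentiableAt (by simp)
  have hg : ∀ β, DifferentiableAt ℝ (fun y => cometricAB A B y α β) x := fun β =>
    (contDiff_cometricAB α β (k := 1)).differentiable (by simp) x
  have hne : ∀ r, (Zfull x r).det.re ≠ 0 := fun r =>
    (det_re_pos ((mem_interior_matrixSimplex_iff hn x).mp hx r)).ne'
  have h1 : ∑ β, cometricAB A B x α β * ∑ r, (a r - 1) * ((Zfull x r).det.re⁻¹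
      * pd β (fun y => (Zfull y r).det.re) x) = ∑ r, (a r - 1) * logDetGammaCoord A r x α := by
    simp only [Finset.mul_sum]
    rw [Finset.sum_comm]
    refine Finset.sum_congr rfl fun r _ => ?_
    have h2 := sum_cometricAB_mul_pd_det hA hB hsymm r x α
    calc _ = (a r - 1) * ((Zfull x r).det.re⁻¹ *
          ∑ β, cometricAB A B x α β * pd β (fun y => (Zfull y r).det.re) x) := by
          simp only [Finset.mul_sum]
          exact Finset.sum_congr rfl fun _ _ => by ring
      _ = _ := by rw [h2, inv_mul_cancel_left₀ (hne r)]
  simp only [fun β => pd_mul (i := β) hρd (hg β), Finset.sum_add_distrib, ← Finset.mul_sum]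
  rw [driftAB_eq hA hB hsymm, mul_add, ← h1, Finset.mul_sum]
  congr 1
  rw [Finset.mul_sum]
  refine Finset.sum_congr rfl fun β _ => ?_
  rw [pd_dirichletDensity hn a hx]; ring

/-- `L_{A,B,a}` is symmetric on the functions which are smooth up to the boundary. -/
theorem integral_mul_diffusionOp_driftAB_comm (hn : 1 ≤ n) (hA : A.IsHermitian)
    (hB : B.IsHermitian) (hsymm : ∀ (x : Idx n d → ℝ) (α β : Idx n d),
      gammaAB A B (Zmat x) α β = gammaAB A B (Zmat x) β α) (ha : ∀ r, 0 < a r)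
    {f h : (Idx n d → ℝ) → ℝ} (hf : ContDiff ℝ ∞ f) (hh : ContDiff ℝ ∞ h) :
    ∫ x, f x * diffusionOp (cometricAB A B) (driftAB A B a) h x ∂(dirichletMeasure n d a)
      = ∫ x, h x * diffusionOp (cometricAB A B) (driftAB A B a) f x ∂(dirichletMeasure n d a) := by
  have hμ := dirichletMeasure_eq_withDensity (d := d) hn ha
  have := isProbabilityMeasure_dirichletMeasure (d := d) hn ha
  have hρc := (contDiffOn_dirichletDensity (d := d) hn a).continuousOn
  have hρp : ∀ x ∈ interior (matrixSimplex n d), 0 < dirichletDensity a x :=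
    fun x hx => dirichletDensity_pos hn ha hx
  have hg : ∀ α β, ContDiff ℝ ∞ fun x : Idx n d → ℝ => cometricAB A B x α β :=
    fun α β => contDiff_cometricAB α β
  have hb : ∀ α, Continuous fun x : Idx n d → ℝ => driftAB A B a x α :=
    fun α => (contDiff_driftAB a α (k := 0)).continuous
  have hDr : ∀ r, ContDiff ℝ ∞ fun x : Idx n d → ℝ => (Zfull x r).det.re := fun r =>
    contDiff_det_re fun i j => contDiff_Zfull r i j
  have hint : ∀ {u v : (Idx n d → ℝ) → ℝ}, ContDiff ℝ ∞ u → ContDiff ℝ ∞ v →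
      Integrable (fun x => u x * diffusionOp (cometricAB A B) (driftAB A B a) v x)
        (dirichletMeasure n d a) := fun hu hv =>
    integrable_of_eq_withDensity isOpen_interior isCompact_closure_interior_matrixSimplex hμ
      (hu.continuous.mul (continuous_diffusionOp hg hb hv))
  rw [← sub_eq_zero, ← integral_sub (hint hf hh) (hint hh hf),
    integral_eq_of_eq_withDensity isOpen_interior hρc hρp hμ]
  refine integral_mul_diffusionOp_sub_eq_zero isOpen_interior
    isCompact_closure_interior_matrixSimplex hg (fun x α β => cometricAB_symm hsymm x α β)
    (contDiffOn_dirichletDensity hn a)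
    (integrableOn_of_eq_withDensity isOpen_interior hρc hρp hμ) hb
    (fun x hx α => sum_pd_dirichletDensity_mul_cometricAB hn hA hB hsymm hx α)
    (D := fun x => ∏ r, (Zfull x r).det.re) (contDiff_prod fun r _ => hDr r)
    (fun x hx => Finset.prod_pos fun r _ =>
      det_re_pos ((mem_interior_matrixSimplex_iff hn x).mp hx r)) (fun x hx => ?_)
    (C := fun x α => ∑ r, logDetGammaCoord A r x α)
    (fun α => continuous_finsetSum _ fun r _ => (contDiff_logDetGammaCoord r α (k := 0)).continuous)
    (fun x hx α => ?_) hf hh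
  · have hxΔ : x ∈ matrixSimplex n d :=
      closure_minimal interior_subset isClosed_matrixSimplex (frontier_subset_closure hx)
    have hxi : x ∉ interior (matrixSimplex n d) := by
      rw [isOpen_interior.frontier_eq] at hx; exact hx.2
    rw [mem_matrixSimplex_iff] at hxΔ
    rw [mem_interior_matrixSimplex_iff hn] at hxi
    push Not at hxi
    obtain ⟨r, hr⟩ := hxi
    rw [(hxΔ r).posDef_iff_det_ne_zero, not_not] at hr
    exact Finset.prod_eq_zero (Finset.mem_univ r) (by rw [hr, Complex.zero_re])
  · have hfd := HasFDerivAt.finsetProd (u := Finset.univ) (x := x) fun (r : Fin (n + 1)) _ =>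
      ((hDr r).differentiable (by simp) x).hasFDerivAt
    have hpd : ∀ β, pd β (fun x : Idx n d → ℝ => ∏ r, (Zfull x r).det.re) x
        = ∑ r, (∏ s ∈ Finset.univ.erase r, (Zfull x s).det.re)
          * pd β (fun y => (Zfull y r).det.re) x := fun β => by
      rw [pd, hfd.fderiv]; simp [pd]
    simp only [hpd, Finset.mul_sum]
    rw [Finset.sum_comm]
    refine Finset.sum_congr rfl fun r _ => ?_
    rw [← Finset.prod_erase_mul _ _ (Finset.mem_univ r), mul_assoc,
      ← sum_cometricAB_mul_pd_det hA hB hsymm r x α, Finset.mul_sum]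
    exact Finset.sum_congr rfl fun _ _ => by ring

lemma isGenerator_driftAB (hn : 1 ≤ n) (hA : A.IsHermitian)
    (hB : B.IsHermitian) (hsymm : ∀ (x : Idx n d → ℝ) (α β : Idx n d),
      gammaAB A B (Zmat x) α β = gammaAB A B (Zmat x) β α) (ha : ∀ r, 0 < a r) :
    IsGenerator (interior (matrixSimplex n d)) (cometricAB A B) (dirichletMeasure n d a)
      (driftAB A B a) where
  smooth_drift := (contDiff_pi.mpr fun α => contDiff_driftAB a α).contDiffOn
  symm _ _ hf hh _ _ _ _ := integral_mul_diffusionOp_driftAB_comm hn hA hB hsymm ha hf hh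

end DirichletSymmetry

/-! ### Diagonalization on polynomials -/

section Diagonalization

variable {ι : Type*}

lemma totalDegree_pderiv_le (i : ι) (P : MvPolynomial ι ℝ) :
    (MvPolynomial.pderiv i P).totalDegree ≤ P.totalDegree - 1 := by
  rw [P.as_sum, map_sum]
  refine (MvPolynomial.totalDegree_finsetSum_le fun s hs => ?_).trans
    (le_of_eq (congrArg (fun Q => MvPolynomial.totalDegree Q - 1) P.as_sum))
  rw [MvPolynomial.pderiv_monomial]
  by_cases hsi : s i = 0
  · simp [hsi]
  · refine (MvPolynomial.totalDegree_monomial_le _ _).trans ?_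
    have h1 : (s - Finsupp.single i 1) + Finsupp.single i 1 = s :=
      Finsupp.sub_add_single_one_cancel hsi
    have h2 := congrArg (fun t : ι →₀ ℕ => t.sum fun _ e => e) h1
    simp only [Finsupp.sum_add_index', implies_true, Finsupp.sum_single_index] at h2
    have h3 := MvPolynomial.le_totalDegree hs
    exact Nat.le_sub_of_add_le (h2.le.trans h3)

/-- The case in which the truncated `totalDegree - 1` says nothing. -/
lemma pderiv_eq_zero_of_totalDegree_eq_zero {i : ι} {P : MvPolynomial ι ℝ}
    (hP : P.totalDegree = 0) : MvPolynomial.pderiv i P = 0 := by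
  rw [MvPolynomial.totalDegree_eq_zero_iff_eq_C.mp hP, MvPolynomial.pderiv_C]

lemma totalDegree_mul_pderiv_le {i : ι} {P Q : MvPolynomial ι ℝ} (hP : P.totalDegree ≤ 1) :
    (P * MvPolynomial.pderiv i Q).totalDegree ≤ Q.totalDegree := by
  by_cases hQ : Q.totalDegree = 0
  · simp [pderiv_eq_zero_of_totalDegree_eq_zero hQ]
  · have h1 := MvPolynomial.totalDegree_mul P (MvPolynomial.pderiv i Q)
    have h2 := totalDegree_pderiv_le i Q
    omega

lemma totalDegree_mul_pderiv_pderiv_le {i j : ι} {P Q : MvPolynomial ι ℝ}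
    (hP : P.totalDegree ≤ 2) :
    (P * MvPolynomial.pderiv i (MvPolynomial.pderiv j Q)).totalDegree ≤ Q.totalDegree := by
  have h2 := totalDegree_pderiv_le j Q
  by_cases hQ : (MvPolynomial.pderiv j Q).totalDegree = 0
  · simp [pderiv_eq_zero_of_totalDegree_eq_zero hQ]
  · have h1 := MvPolynomial.totalDegree_mul P (MvPolynomial.pderiv i (MvPolynomial.pderiv j Q))
    have h3 := totalDegree_pderiv_le i (MvPolynomial.pderiv j Q)
    omega

variable [Fintype ι]

lemma contDiff_eval (P : MvPolynomial ι ℝ) {k : WithTop ℕ∞} :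
    ContDiff ℝ k fun x => MvPolynomial.eval x P := by
  induction P using MvPolynomial.induction_on with
  | C c => simpa using contDiff_const
  | add P Q hP hQ => simpa using hP.add hQ
  | mul_X P i hP => simpa using hP.mul (contDiff_apply ℝ ℝ i)

lemma pd_eval [DecidableEq ι] (i : ι) (P : MvPolynomial ι ℝ) :
    pd i (fun x => MvPolynomial.eval x P)
      = fun x => MvPolynomial.eval x (MvPolynomial.pderiv i P) := by
  funext x
  have hd : ∀ P : MvPolynomial ι ℝ, DifferentiableAt ℝ (fun x => MvPolynomial.eval x P) x :=
    fun P => (contDiff_eval P (k := 1)).differentiable (by simp) x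
  induction P using MvPolynomial.induction_on with
  | C c => simpa using pd_const i c x
  | add P Q hP hQ => simp only [map_add, ← hP, ← hQ, pd_add (hd P) (hd Q)]
  | mul_X P j hP =>
    have hX : pd i (fun x : ι → ℝ => x j) x = if j = i then 1 else 0 := by
      have h : HasFDerivAt (fun x : ι → ℝ => x j) (ContinuousLinearMap.proj j) x :=
        (ContinuousLinearMap.proj (R := ℝ) (φ := fun _ : ι => ℝ) j).hasFDerivAt
      rw [pd, h.fderiv, ContinuousLinearMap.proj_apply, Pi.single_apply]
    have e : (fun x : ι → ℝ => MvPolynomial.eval x (P * MvPolynomial.X j))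
        = fun x => MvPolynomial.eval x P * x j := by funext x; simp
    rw [e, pd_mul (hd P) (differentiableAt_apply j x), hP, hX, Derivation.leibniz,
      MvPolynomial.pderiv_X]
    by_cases hij : j = i
    · subst hij; simp
    · simp [hij]

/-- The action of a diffusion operator with polynomial coefficients on polynomials. -/
def polyDiffusion (G : ι → ι → MvPolynomial ι ℝ) (b : ι → MvPolynomial ι ℝ) :
    MvPolynomial ι ℝ →ₗ[ℝ] MvPolynomial ι ℝ :=
  ∑ i, ∑ j, LinearMap.mulLeft ℝ (G i j) ∘ₗ (MvPolynomial.pderiv i).toLinearMap ∘ₗ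
      (MvPolynomial.pderiv j).toLinearMap
    + ∑ i, LinearMap.mulLeft ℝ (b i) ∘ₗ (MvPolynomial.pderiv i).toLinearMap

lemma polyDiffusion_apply (G : ι → ι → MvPolynomial ι ℝ) (b : ι → MvPolynomial ι ℝ)
    (Q : MvPolynomial ι ℝ) :
    polyDiffusion G b Q = ∑ i, ∑ j, G i j * MvPolynomial.pderiv i (MvPolynomial.pderiv j Q)
      + ∑ i, b i * MvPolynomial.pderiv i Q := by
  simp [polyDiffusion, LinearMap.sum_apply]

lemma totalDegree_polyDiffusion_le {G : ι → ι → MvPolynomial ι ℝ} {b : ι → MvPolynomial ι ℝ}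
    (hG : ∀ i j, (G i j).totalDegree ≤ 2) (hb : ∀ i, (b i).totalDegree ≤ 1)
    (Q : MvPolynomial ι ℝ) : (polyDiffusion G b Q).totalDegree ≤ Q.totalDegree := by
  rw [polyDiffusion_apply]
  refine (MvPolynomial.totalDegree_add _ _).trans (max_le ?_ ?_)
  · exact MvPolynomial.totalDegree_finsetSum_le fun i _ =>
      MvPolynomial.totalDegree_finsetSum_le fun j _ => totalDegree_mul_pderiv_pderiv_le (hG i j)
  · exact MvPolynomial.totalDegree_finsetSum_le fun i _ => totalDegree_mul_pderiv_le (hb i)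

lemma diffusionOp_eval [DecidableEq ι] {g : (ι → ℝ) → Matrix ι ι ℝ} {b : (ι → ℝ) → ι → ℝ}
    {G : ι → ι → MvPolynomial ι ℝ} {b' : ι → MvPolynomial ι ℝ}
    (hG : ∀ x i j, g x i j = MvPolynomial.eval x (G i j))
    (hb : ∀ x i, b x i = MvPolynomial.eval x (b' i)) (Q : MvPolynomial ι ℝ) (x : ι → ℝ) :
    diffusionOp g b (fun y => MvPolynomial.eval y Q) x
      = MvPolynomial.eval x (polyDiffusion G b' Q) := by
  simp only [diffusionOp, pd_eval, polyDiffusion_apply, map_add, map_sum, map_mul, smul_eq_mul,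
    ← hG, ← hb]

variable {Ω : Set (ι → ℝ)} {ρ : (ι → ℝ) → ℝ} {μ : Measure (ι → ℝ)}

/-- A polynomial of `L²(μ)`-norm zero vanishes on the nonempty open set `Ω`, hence identically. -/
lemma eq_zero_of_integral_eval_mul_self [IsFiniteMeasure μ] (hΩ : IsOpen Ω) (hne : Ω.Nonempty)
    (hcomp : IsCompact (closure Ω)) (hρc : ContinuousOn ρ Ω) (hρ : ∀ x ∈ Ω, 0 < ρ x)
    (hμ : μ = (volume.restrict Ω).withDensity fun x => ENNReal.ofReal (ρ x))
    {P : MvPolynomial ι ℝ}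
    (hP : ∫ x, MvPolynomial.eval x P * MvPolynomial.eval x P ∂μ = 0) : P = 0 := by
  have hc : Continuous fun x => MvPolynomial.eval x P := (contDiff_eval P (k := 0)).continuous
  have hint := integrable_of_eq_withDensity hΩ hcomp hμ (hc.mul hc)
  have h0 : ∀ᵐ x ∂μ, MvPolynomial.eval x P * MvPolynomial.eval x P = 0 :=
    (integral_eq_zero_iff_of_nonneg (fun x => mul_self_nonneg _) hint).mp hP
  have h1 : ∀ᵐ x ∂(volume.restrict Ω), MvPolynomial.eval x P = 0 := by
    have hm : AEMeasurable (fun x => ENNReal.ofReal (ρ x)) (volume.restrict Ω) :=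
      (hρc.aemeasurable hΩ.measurableSet).ennreal_ofReal
    rw [hμ, ae_withDensity_iff' hm] at h0
    filter_upwards [h0, ae_restrict_mem hΩ.measurableSet] with x hx hxΩ
    exact mul_self_eq_zero.mp (hx (ENNReal.ofReal_pos.mpr (hρ x hxΩ)).ne')
  have h2 : Set.EqOn (fun x => MvPolynomial.eval x P) (fun _ => 0) Ω :=
    Measure.eqOn_open_of_ae_eq h1 hΩ hc.continuousOn continuousOn_const
  obtain ⟨x₀, hx₀⟩ := hne
  obtain ⟨ε, hε, hball⟩ := Metric.isOpen_iff.mp hΩ x₀ hx₀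
  refine MvPolynomial.funext_set (fun i => Metric.ball (x₀ i) ε) (fun i => ?_) fun x hx => ?_
  · rw [Real.ball_eq_Ioo]
    exact Set.Ioo_infinite (by linarith)
  · rw [map_zero]
    refine h2 (hball ?_)
    rw [mem_ball_iff_norm, pi_norm_lt_iff hε]
    intro i
    have := hx i (Set.mem_univ i)
    rwa [mem_ball_iff_norm] at this

/-- The `L²(μ)` inner product on polynomials of bounded degree. -/
@[reducible] def polyInnerCore [IsFiniteMeasure μ] (hΩ : IsOpen Ω) (hne : Ω.Nonempty)
    (hcomp : IsCompact (closure Ω)) (hρc : ContinuousOn ρ Ω) (hρ : ∀ x ∈ Ω, 0 < ρ x)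
    (hμ : μ = (volume.restrict Ω).withDensity fun x => ENNReal.ofReal (ρ x)) (k : ℕ) :
    InnerProductSpace.Core ℝ (MvPolynomial.restrictTotalDegree ι ℝ k) :=
  have hint : ∀ P Q : MvPolynomial ι ℝ,
      Integrable (fun x => MvPolynomial.eval x P * MvPolynomial.eval x Q) μ := fun P Q =>
    integrable_of_eq_withDensity hΩ hcomp hμ
      ((contDiff_eval P (k := 0)).continuous.mul (contDiff_eval Q (k := 0)).continuous)
  { inner := fun P Q => ∫ x, MvPolynomial.eval x P.1 * MvPolynomial.eval x Q.1 ∂μ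
    conj_inner_symm := fun P Q => by
      simp only [conj_trivial, mul_comm]
    re_inner_nonneg := fun P => integral_nonneg fun x => mul_self_nonneg _
    add_left := fun P Q R => by
      rw [← integral_add (hint _ _) (hint _ _)]
      simp [add_mul]
    smul_left := fun P Q r => by
      rw [conj_trivial, ← integral_const_mul]
      simp [mul_assoc]
    definite := fun P hP => Subtype.ext
      (eq_zero_of_integral_eval_mul_self hΩ hne hcomp hρc hρ hμ hP) }

/-- A symmetric operator which preserves the degree can be diagonalized on polynomials. -/
lemma exists_eigenbasis [IsFiniteMeasure μ] (hΩ : IsOpen Ω) (hne : Ω.Nonempty)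
    (hcomp : IsCompact (closure Ω)) (hρc : ContinuousOn ρ Ω) (hρ : ∀ x ∈ Ω, 0 < ρ x)
    (hμ : μ = (volume.restrict Ω).withDensity fun x => ENNReal.ofReal (ρ x))
    {L : MvPolynomial ι ℝ →ₗ[ℝ] MvPolynomial ι ℝ}
    (hL : ∀ Q, (L Q).totalDegree ≤ Q.totalDegree)
    (hsymm : ∀ P Q : MvPolynomial ι ℝ,
      ∫ x, MvPolynomial.eval x P * MvPolynomial.eval x (L Q) ∂μ
        = ∫ x, MvPolynomial.eval x Q * MvPolynomial.eval x (L P) ∂μ) (k : ℕ) :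
    ∃ (m : ℕ) (e : Module.Basis (Fin m) ℝ (MvPolynomial.restrictTotalDegree ι ℝ k))
      (c : Fin m → ℝ),
      (∀ r s, ∫ x, MvPolynomial.eval x (e r : MvPolynomial ι ℝ)
        * MvPolynomial.eval x (e s : MvPolynomial ι ℝ) ∂μ = if r = s then 1 else 0) ∧
      ∀ r, L (e r) = c r • (e r : MvPolynomial ι ℝ) := by
  let core := polyInnerCore hΩ hne hcomp hρc hρ hμ k
  let _ : NormedAddCommGroup (MvPolynomial.restrictTotalDegree ι ℝ k) :=
    core.toNormedAddCommGroup
  let _ : InnerProductSpace ℝ (MvPolynomial.restrictTotalDegree ι ℝ k) :=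
    InnerProductSpace.ofCore core.toCore
  have hmap : ∀ Q ∈ MvPolynomial.restrictTotalDegree ι ℝ k,
      L Q ∈ MvPolynomial.restrictTotalDegree ι ℝ k := fun Q hQ => by
    rw [MvPolynomial.mem_restrictTotalDegree] at *
    exact (hL Q).trans hQ
  let T : MvPolynomial.restrictTotalDegree ι ℝ k →ₗ[ℝ] MvPolynomial.restrictTotalDegree ι ℝ k :=
    L.restrict hmap
  have hinner : ∀ P Q : MvPolynomial.restrictTotalDegree ι ℝ k, inner ℝ P Q
      = ∫ x, MvPolynomial.eval x P.1 * MvPolynomial.eval x Q.1 ∂μ := fun _ _ => rfl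
  have hT : T.IsSymmetric := fun P Q => by
    rw [hinner, hinner]
    exact (integral_congr_ae (ae_of_all _ fun x => mul_comm _ _)).trans (hsymm Q.1 P.1)
  refine ⟨_, (hT.eigenvectorBasis rfl).toBasis, hT.eigenvalues rfl, fun r s => ?_, fun r => ?_⟩
  · rw [← hinner]
    simp only [OrthonormalBasis.coe_toBasis]
    exact orthonormal_iff_ite.mp (hT.eigenvectorBasis rfl).orthonormal r s
  · have := congrArg Subtype.val (hT.apply_eigenvectorBasis rfl r)
    rw [OrthonormalBasis.coe_toBasis]
    exact this

end Diagonalization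

/-! ### The coefficients are polynomials -/

section PolynomialCoefficients

/-- Complex functions whose real and imaginary parts are polynomials of degree at most `k`. -/
def IsPolynomialOfDegree {ι : Type*} (k : ℕ) (F : (ι → ℝ) → ℂ) : Prop :=
  ∃ P Q : MvPolynomial ι ℝ, P.totalDegree ≤ k ∧ Q.totalDegree ≤ k ∧
    ∀ x, F x = MvPolynomial.eval x P + Complex.I * MvPolynomial.eval x Q

namespace IsPolynomialOfDegree

variable {ι : Type*} {k l : ℕ} {F G : (ι → ℝ) → ℂ}

lemma mono (hF : IsPolynomialOfDegree k F) (hkl : k ≤ l) : IsPolynomialOfDegree l F := by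
  obtain ⟨P, Q, hP, hQ, h⟩ := hF
  exact ⟨P, Q, hP.trans hkl, hQ.trans hkl, h⟩

lemma const (k : ℕ) (c : ℂ) : IsPolynomialOfDegree k fun _ : ι → ℝ => c :=
  ⟨MvPolynomial.C c.re, MvPolynomial.C c.im, by simp, by simp, fun x => by
    simp only [MvPolynomial.eval_C]
    rw [mul_comm]; exact (Complex.re_add_im c).symm⟩

lemma coord (i : ι) : IsPolynomialOfDegree 1 fun x : ι → ℝ => (x i : ℂ) :=
  ⟨MvPolynomial.X i, 0, by simp, by simp, fun x => by simp⟩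

lemma add (hF : IsPolynomialOfDegree k F) (hG : IsPolynomialOfDegree k G) :
    IsPolynomialOfDegree k fun x => F x + G x := by
  obtain ⟨P, Q, hP, hQ, h⟩ := hF
  obtain ⟨P', Q', hP', hQ', h'⟩ := hG
  refine ⟨P + P', Q + Q', (MvPolynomial.totalDegree_add _ _).trans (max_le hP hP'),
    (MvPolynomial.totalDegree_add _ _).trans (max_le hQ hQ'), fun x => ?_⟩
  simp only [h, h', map_add]
  push_cast
  ring

lemma mul (hF : IsPolynomialOfDegree k F) (hG : IsPolynomialOfDegree l G) :
    IsPolynomialOfDegree (k + l) fun x => F x * G x := by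
  obtain ⟨P, Q, hP, hQ, h⟩ := hF
  obtain ⟨P', Q', hP', hQ', h'⟩ := hG
  have hm : ∀ {R S : MvPolynomial ι ℝ}, R.totalDegree ≤ k → S.totalDegree ≤ l →
      (R * S).totalDegree ≤ k + l := fun hR hS =>
    (MvPolynomial.totalDegree_mul _ _).trans (add_le_add hR hS)
  refine ⟨P * P' - Q * Q', P * Q' + Q * P',
    (MvPolynomial.totalDegree_sub _ _).trans (max_le (hm hP hP') (hm hQ hQ')),
    (MvPolynomial.totalDegree_add _ _).trans (max_le (hm hP hQ') (hm hQ hP')), fun x => ?_⟩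
  simp only [h, h', map_add, map_sub, map_mul]
  push_cast
  linear_combination ((MvPolynomial.eval x Q : ℝ) : ℂ) * ((MvPolynomial.eval x Q' : ℝ) : ℂ) *
    Complex.I_mul_I

lemma const_mul (c : ℂ) (hF : IsPolynomialOfDegree k F) :
    IsPolynomialOfDegree k fun x => c * F x := by
  simpa using (const 0 c).mul hF

lemma sub (hF : IsPolynomialOfDegree k F) (hG : IsPolynomialOfDegree k G) :
    IsPolynomialOfDegree k fun x => F x - G x := by
  simpa [sub_eq_add_neg] using hF.add (hG.const_mul (-1))

lemma sum {κ : Type*} (s : Finset κ) {F : κ → (ι → ℝ) → ℂ}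
    (hF : ∀ a, IsPolynomialOfDegree k (F a)) : IsPolynomialOfDegree k fun x => ∑ a ∈ s, F a x := by
  classical
  induction s using Finset.induction_on with
  | empty => simpa using const k 0
  | insert a s ha ih => simpa [Finset.sum_insert ha] using (hF a).add ih

lemma exists_re (hF : IsPolynomialOfDegree k F) :
    ∃ P : MvPolynomial ι ℝ, P.totalDegree ≤ k ∧ ∀ x, (F x).re = MvPolynomial.eval x P := by
  obtain ⟨P, Q, hP, -, h⟩ := hF
  exact ⟨P, hP, fun x => by simp [h]⟩

end IsPolynomialOfDegree

variable {n d : ℕ} {A : Matrix (Fin d) (Fin d) ℂ} {B : Matrix (Fin d × Fin d) (Fin d × Fin d) ℂ}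

lemma isPolynomialOfDegree_Zmat (p : Fin n) (i j : Fin d) :
    IsPolynomialOfDegree 1 fun x : Idx n d → ℝ => Zmat x p i j := by
  have h : (fun x : Idx n d → ℝ => Zmat x p i j)
      = fun x => ∑ α, entryCoeff (p, i, j) α * (x α : ℂ) := by
    funext x
    rw [← toEntries_apply]; rfl
  rw [h]
  exact .sum _ fun α => (IsPolynomialOfDegree.coord α).const_mul _

lemma IsPolynomialOfDegree.toRealCoord {k : ℕ} {u : (Idx n d → ℝ) → Idx n d → ℂ}
    (hu : ∀ β, IsPolynomialOfDegree k fun x => u x β) (α : Idx n d) :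
    IsPolynomialOfDegree k fun x => toRealCoord (u x) α := by
  simp only [toRealCoord_apply]
  exact .sum _ fun β => (hu β).const_mul _

lemma isPolynomialOfDegree_gammaAB (γ β : Idx n d) :
    IsPolynomialOfDegree 2 fun x : Idx n d → ℝ => gammaAB A B (Zmat x) γ β := by
  obtain ⟨p, i, j⟩ := γ
  obtain ⟨q, k, l⟩ := β
  have h1 : ∀ (c : ℂ) (p : Fin n) (i j : Fin d),
      IsPolynomialOfDegree 2 fun x : Idx n d → ℝ => c * Zmat x p i j := fun c p i j =>
    ((isPolynomialOfDegree_Zmat p i j).const_mul c).mono (by norm_num)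
  have h2 : ∀ (p : Fin n) (i j : Fin d) (q : Fin n) (k l : Fin d),
      IsPolynomialOfDegree 2 fun x : Idx n d → ℝ => Zmat x p i j * Zmat x q k l :=
    fun p i j q k l => (isPolynomialOfDegree_Zmat p i j).mul (isPolynomialOfDegree_Zmat q k l)
  have h3 : ∀ (c : ℂ) (p : Fin n) (i j : Fin d) (q : Fin n) (k l : Fin d),
      IsPolynomialOfDegree 2 fun x : Idx n d → ℝ => c * Zmat x p i j * Zmat x q k l :=
    fun c p i j q k l => by simpa only [mul_assoc] using (h2 p i j q k l).const_mul c
  simp only [gammaAB, Matrix.mul_apply]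
  refine (((IsPolynomialOfDegree.sub ?_ ?_).sub ?_)).add ?_
  · by_cases hpq : p = q
    · simp only [hpq, if_true]
      exact (h1 _ _ _ _).add (h1 _ _ _ _)
    · simpa only [hpq, if_false] using IsPolynomialOfDegree.const 2 0
  · exact (IsPolynomialOfDegree.sum _ fun m => h2 _ _ _ _ _ _).const_mul _
  · exact (IsPolynomialOfDegree.sum _ fun m => h2 _ _ _ _ _ _).const_mul _
  · exact IsPolynomialOfDegree.sum _ fun a => IsPolynomialOfDegree.sum _ fun b =>
      (((h3 _ _ _ _ _ _ _).add (h3 _ _ _ _ _ _ _)).sub (h3 _ _ _ _ _ _ _)).sub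
        (h3 _ _ _ _ _ _ _)

lemma isPolynomialOfDegree_generatorAB (a : Fin (n + 1) → ℝ) (p : Fin n) (i j : Fin d) :
    IsPolynomialOfDegree 1 fun x : Idx n d → ℝ => generatorAB A B a (Zmat x) p i j := by
  have h1 : ∀ (c : ℂ) (p : Fin n) (i j : Fin d),
      IsPolynomialOfDegree 1 fun x : Idx n d → ℝ => c * Zmat x p i j := fun c p i j =>
    (isPolynomialOfDegree_Zmat p i j).const_mul c
  have h2 : IsPolynomialOfDegree 1 fun x : Idx n d → ℝ =>
      ∑ m, A i m * Zmat x p m j + ∑ m, Zmat x p i m * A m j := by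
    refine (IsPolynomialOfDegree.sum _ fun m => h1 _ _ _ _).add
      (IsPolynomialOfDegree.sum _ fun m => ?_)
    simpa only [mul_comm] using h1 (A m j) p i m
  simp only [generatorAB, Matrix.mul_apply, Matrix.trace, Matrix.diag]
  refine ((((IsPolynomialOfDegree.const 1 _).sub (.sum _ fun q => h2.const_mul _)).sub
    (h2.const_mul _)).sub ?_).add (.sum _ fun u => .sum _ fun v =>
      (((h1 _ _ _ _).add (h1 _ _ _ _)).sub (h1 _ _ _ _)).sub (h1 _ _ _ _))
  exact (IsPolynomialOfDegree.sum _ fun m => isPolynomialOfDegree_Zmat p m m).const_mul _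

lemma exists_polynomial_cometricAB (α β : Idx n d) :
    ∃ P : MvPolynomial (Idx n d) ℝ, P.totalDegree ≤ 2 ∧
      ∀ x, cometricAB A B x α β = MvPolynomial.eval x P :=
  (IsPolynomialOfDegree.toRealCoord (fun α' => IsPolynomialOfDegree.toRealCoord
    (fun β' => isPolynomialOfDegree_gammaAB α' β') β) α).exists_re

lemma exists_polynomial_driftAB (a : Fin (n + 1) → ℝ) (α : Idx n d) :
    ∃ P : MvPolynomial (Idx n d) ℝ, P.totalDegree ≤ 1 ∧
      ∀ x, driftAB A B a x α = MvPolynomial.eval x P :=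
  (IsPolynomialOfDegree.toRealCoord
    (fun γ => isPolynomialOfDegree_generatorAB a γ.1 γ.2.1 γ.2.2) α).exists_re

end PolynomialCoefficients

/-! ### Uniqueness of the drift -/

section Uniqueness

variable {ι : Type*} [Fintype ι] {Ω : Set (ι → ℝ)} {ρ : (ι → ℝ) → ℝ}
  {μ : Measure (ι → ℝ)} {g : (ι → ℝ) → Matrix ι ι ℝ} {b b' : (ι → ℝ) → ι → ℝ}

/-- Smooth functions with compact support in `Ω`. -/
def IsTestFunction (Ω : Set (ι → ℝ)) (f : (ι → ℝ) → ℝ) : Prop :=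
  ContDiff ℝ ∞ f ∧ HasCompactSupport f ∧ tsupport f ⊆ Ω

lemma IsTestFunction.mul_left {f h : (ι → ℝ) → ℝ} (hf : ContDiff ℝ ∞ f)
    (hh : IsTestFunction Ω h) : IsTestFunction Ω fun x => f x * h x :=
  ⟨hf.mul hh.1, hh.2.1.mul_left, (tsupport_mul_subset_right).trans hh.2.2⟩

lemma IsTestFunction.continuous_mul {f F : (ι → ℝ) → ℝ} (hΩ : IsOpen Ω)
    (hf : IsTestFunction Ω f) (hF : ContinuousOn F Ω) : Continuous fun x => f x * F x := by
  refine continuous_iff_continuousAt.mpr fun x => ?_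
  by_cases hx : x ∈ tsupport f
  · exact hf.1.continuous.continuousAt.mul (hF.continuousAt (hΩ.mem_nhds (hf.2.2 hx)))
  · refine (continuousAt_const (y := (0 : ℝ))).congr ?_
    filter_upwards [notMem_tsupport_iff_eventuallyEq.mp hx] with y hy
    simp [hy]

variable [DecidableEq ι]

/-- The vector field `∑ c_i ∂_i`. -/
def vectorField (c : (ι → ℝ) → ι → ℝ) (f : (ι → ℝ) → ℝ) (x : ι → ℝ) : ℝ := ∑ i, c x i * pd i f x

lemma continuousOn_vectorField {c : (ι → ℝ) → ι → ℝ} (hc : ∀ i, ContinuousOn (fun x => c x i) Ω)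
    {f : (ι → ℝ) → ℝ} (hf : ContDiff ℝ ∞ f) : ContinuousOn (vectorField c f) Ω :=
  continuousOn_finsetSum _ fun i _ => (hc i).mul (contDiff_pd hf i).continuous.continuousOn

lemma vectorField_mul (c : (ι → ℝ) → ι → ℝ) {f h : (ι → ℝ) → ℝ} (hf : ContDiff ℝ ∞ f)
    (hh : ContDiff ℝ ∞ h) (x : ι → ℝ) :
    vectorField c (fun y => f y * h y) x = f x * vectorField c h x + h x * vectorField c f x := by
  simp only [vectorField, pd_mul (hf.differentiable (by simp) x) (hh.differentiable (by simp) x),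
    mul_add, Finset.sum_add_distrib, Finset.mul_sum]
  congr 1 <;> exact Finset.sum_congr rfl fun _ _ => by ring

/-- The drift of a generator is unique. The difference `V` of two generators is a vector field which is
symmetric for `μ` on test functions. The derivation rule and the symmetry give
`∫ f h V k = ∫ h k V f + ∫ k f V h`, and adding two of these cyclic identities gives
`∫ h k V f = 0`. -/
lemma eq_of_isGenerator [IsFiniteMeasure μ] (hΩ : IsOpen Ω) (hcomp : IsCompact (closure Ω))
    (hρc : ContinuousOn ρ Ω) (hρ : ∀ x ∈ Ω, 0 < ρ x)
    (hμ : μ = (volume.restrict Ω).withDensity fun x => ENNReal.ofReal (ρ x))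
    (hg : ∀ i j, ContinuousOn (fun x => g x i j) Ω) (hb : IsGenerator Ω g μ b)
    (hb' : IsGenerator Ω g μ b') {x₀ : ι → ℝ} (hx₀ : x₀ ∈ Ω) : b x₀ = b' x₀ := by
  have hbi : ∀ i, ContinuousOn (fun x => b x i) Ω := fun i =>
    (continuous_apply i).comp_continuousOn hb.smooth_drift.continuousOn
  have hbi' : ∀ i, ContinuousOn (fun x => b' x i) Ω := fun i =>
    (continuous_apply i).comp_continuousOn hb'.smooth_drift.continuousOn
  set c : (ι → ℝ) → ι → ℝ := fun x => b x - b' x with hc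
  have hci : ∀ i, ContinuousOn (fun x => c x i) Ω := fun i => (hbi i).sub (hbi' i)
  have hint : ∀ {f F : (ι → ℝ) → ℝ}, IsTestFunction Ω f → ContinuousOn F Ω →
      Integrable (fun x => f x * F x) μ := fun hf hF =>
    integrable_of_eq_withDensity hΩ hcomp hμ (hf.continuous_mul hΩ hF)
  have hop : ∀ f x, diffusionOp g b f x = diffusionOp g b' f x + vectorField c f x := fun f x => by
    simp only [diffusionOp, vectorField, hc, Pi.sub_apply, sub_mul, Finset.sum_sub_distrib,
      smul_eq_mul]
    ring
  have hopc : ∀ {f : (ι → ℝ) → ℝ}, ContDiff ℝ ∞ f → ContinuousOn (diffusionOp g b' f) Ω :=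
    fun {f} hf => by
      unfold diffusionOp
      exact (continuousOn_finsetSum _ fun i _ => continuousOn_finsetSum _ fun j _ =>
        (hg i j).smul (contDiff_pd (contDiff_pd hf j) i).continuous.continuousOn).add
        (continuousOn_finsetSum _ fun i _ =>
          (hbi' i).smul (contDiff_pd hf i).continuous.continuousOn)
  have hsymm : ∀ {f h : (ι → ℝ) → ℝ}, IsTestFunction Ω f → IsTestFunction Ω h →
      ∫ x, f x * vectorField c h x ∂μ = ∫ x, h x * vectorField c f x ∂μ := by
    intro f h hf hh
    have h1 := hb.symm f h hf.1 hh.1 hf.2.1 hh.2.1 hf.2.2 hh.2.2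
    have h2 := hb'.symm f h hf.1 hh.1 hf.2.1 hh.2.1 hf.2.2 hh.2.2
    simp only [hop, mul_add] at h1
    rw [integral_add (hint hf (hopc hh.1)) (hint hf (continuousOn_vectorField hci hh.1)),
      integral_add (hint hh (hopc hf.1)) (hint hh (continuousOn_vectorField hci hf.1)), h2] at h1
    exact add_left_cancel h1
  have hvc : ∀ {f : (ι → ℝ) → ℝ}, IsTestFunction Ω f → ContinuousOn (vectorField c f) Ω :=
    fun hf => continuousOn_vectorField hci hf.1
  have h3 : ∀ {f h k : (ι → ℝ) → ℝ}, IsTestFunction Ω f → IsTestFunction Ω h →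
      IsTestFunction Ω k → ∫ x, f x * h x * vectorField c k x ∂μ
        = ∫ x, h x * k x * vectorField c f x ∂μ + ∫ x, k x * f x * vectorField c h x ∂μ := by
    intro f h k hf hh hk
    rw [hsymm (IsTestFunction.mul_left hf.1 hh) hk, ← integral_add
      (hint (IsTestFunction.mul_left hh.1 hk) (hvc hf))
      (hint (IsTestFunction.mul_left hk.1 hf) (hvc hh))]
    refine integral_congr_ae (ae_of_all _ fun x => ?_)
    simp only [vectorField_mul c hf.1 hh.1]
    ring
  have h4 : ∀ {f h k : (ι → ℝ) → ℝ}, IsTestFunction Ω f → IsTestFunction Ω h →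
      IsTestFunction Ω k → ∫ x, h x * k x * vectorField c f x ∂μ = 0 := by
    intro f h k hf hh hk
    have e1 := h3 hf hh hk
    have e2 := h3 hk hf hh
    have e3 : ∫ x, f x * h x * vectorField c k x ∂μ = ∫ x, f x * h x * vectorField c k x ∂μ := rfl
    linarith
  -- localize around `x₀`, where the test function `χ x_i` has `∂_j (χ x_i) = δ_{ij}`
  obtain ⟨R, hR, hball⟩ := Metric.isOpen_iff.mp hΩ x₀ hx₀
  let χ : ContDiffBump x₀ := ⟨R / 4, R / 2, by positivity, by linarith⟩
  have hχ : IsTestFunction Ω χ := ⟨χ.contDiff, χ.hasCompactSupport, by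
    rw [χ.tsupport_eq]
    exact (Metric.closedBall_subset_ball (by simp only [χ]; linarith)).trans hball⟩
  set U := Metric.ball x₀ (R / 4) with hU
  have hUΩ : U ⊆ Ω := (Metric.ball_subset_ball (by linarith)).trans hball
  have hχ1 : ∀ x ∈ U, χ x = 1 := fun x hx =>
    χ.one_of_mem_closedBall (Metric.ball_subset_closedBall hx)
  funext i
  have hf : IsTestFunction Ω fun x => x i * χ x :=
    IsTestFunction.mul_left (contDiff_apply ℝ ℝ i) hχ
  have hvf : ∀ x ∈ U, vectorField c (fun x => x i * χ x) x = c x i := by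
    intro x hx
    have heq : (fun x => x i * χ x) =ᶠ[𝓝 x] fun x => x i := by
      filter_upwards [Metric.isOpen_ball.mem_nhds hx] with y hy
      rw [hχ1 y hy, mul_one]
    have hpd : ∀ j, pd j (fun x : ι → ℝ => x i * χ x) x = if j = i then 1 else 0 := fun j => by
      rw [pd_congr heq]
      have h : HasFDerivAt (fun x : ι → ℝ => x i) _ x :=
        (ContinuousLinearMap.proj (R := ℝ) (φ := fun _ : ι => ℝ) i).hasFDerivAt
      rw [pd, h.fderiv, ContinuousLinearMap.proj_apply, Pi.single_apply]
      simp only [eq_comm]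
    simp [vectorField, hpd]
  have hloc : ∀ φ : (ι → ℝ) → ℝ, ContDiff ℝ ∞ φ → HasCompactSupport φ → tsupport φ ⊆ U →
      ∫ x, φ x • (ρ x * c x i) = 0 := by
    intro φ hφ hφc hφU
    have hφt : IsTestFunction Ω φ := ⟨hφ, hφc, hφU.trans hUΩ⟩
    have h5 := h4 hf hφt hχ
    rw [integral_eq_of_eq_withDensity hΩ hρc hρ hμ, ← integral_indicator hΩ.measurableSet] at h5
    rw [← h5]
    congr 1
    funext x
    by_cases hx : x ∈ U
    · rw [Set.indicator_of_mem (hUΩ hx), hvf x hx, hχ1 x hx, smul_eq_mul]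
      ring
    · have h0 : φ x = 0 := image_eq_zero_of_notMem_tsupport fun h => hx (hφU h)
      by_cases hxΩ : x ∈ Ω
      · rw [Set.indicator_of_mem hxΩ, h0]; simp
      · rw [Set.indicator_of_notMem hxΩ, h0]; simp
  have hcont : ContinuousOn (fun x => ρ x * c x i) U := (hρc.mul (hci i)).mono hUΩ
  have hae := Metric.isOpen_ball.ae_eq_zero_of_integral_contDiff_smul_eq_zero
    (hcont.locallyIntegrableOn Metric.isOpen_ball.measurableSet) hloc
  have hzero : Set.EqOn (fun x => ρ x * c x i) (fun _ => 0) U :=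
    Measure.eqOn_open_of_ae_eq ((ae_restrict_iff' Metric.isOpen_ball.measurableSet).mpr hae)
      Metric.isOpen_ball hcont continuousOn_const
  have h6 := hzero (Metric.mem_ball_self (by positivity : 0 < R / 4))
  simp only [hc, Pi.sub_apply] at h6
  exact sub_eq_zero.mp ((mul_eq_zero.mp h6).resolve_left (hρ x₀ hx₀).ne')

end Uniqueness

/-! ### The polynomial model -/

section Model

variable {n d : ℕ} {A : Matrix (Fin d) (Fin d) ℂ} {B : Matrix (Fin d × Fin d) (Fin d × Fin d) ℂ}
  {a : Fin (n + 1) → ℝ}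

lemma isPolynomialModel_matrixSimplex (hn : 1 ≤ n) (hA : A.PosDef) (hB : B.PosDef)
    (hsymm : ∀ (x : Idx n d → ℝ) (α β : Idx n d),
      gammaAB A B (Zmat x) α β = gammaAB A B (Zmat x) β α) (ha : ∀ r, 0 < a r) :
    IsPolynomialModel (interior (matrixSimplex n d)) (cometricAB A B)
      (dirichletMeasure n d a) := by
  have hprob := isProbabilityMeasure_dirichletMeasure (d := d) hn ha
  have hμ := dirichletMeasure_eq_withDensity (d := d) hn ha
  choose G hG2 hG using fun α β : Idx n d => exists_polynomial_cometricAB (A := A) (B := B) α β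
  choose b hb1 hb using fun α : Idx n d => exists_polynomial_driftAB (A := A) (B := B) a α
  have hL := diffusionOp_eval (g := cometricAB A B) (b := driftAB A B a)
    (fun x α β => hG α β x) (fun x α => hb α x)
  have hsymmL := fun P Q : MvPolynomial (Idx n d) ℝ =>
    integral_mul_diffusionOp_driftAB_comm (a := a) hn hA.isHermitian hB.isHermitian hsymm ha
      (contDiff_eval P) (contDiff_eval Q)
  refine ⟨isOpen_interior, isConnected_interior_matrixSimplex hn,
    isBounded_matrixSimplex.subset interior_subset, hasPiecewiseC1Boundary_matrixSimplex hn,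
    fun α β => (contDiff_cometricAB α β).contDiffOn,
    fun x hx => posDef_cometricAB hA hB hsymm ((mem_interior_matrixSimplex_iff hn x).mp hx), hprob,
    ⟨dirichletDensity a, contDiffOn_dirichletDensity hn a,
      fun x hx => dirichletDensity_pos hn ha hx, hμ⟩,
    driftAB A B a, isGenerator_driftAB hn hA.isHermitian hB.isHermitian hsymm ha, hsymmL,
    fun k => ?_⟩
  obtain ⟨m, e, c, h1, h2⟩ := exists_eigenbasis isOpen_interior
    (interior_matrixSimplex_nonempty hn) isCompact_closure_interior_matrixSimplex
    (contDiffOn_dirichletDensity hn a).continuousOn (fun x hx => dirichletDensity_pos hn ha hx) hμ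
    (totalDegree_polyDiffusion_le hG2 hb1) (fun P Q => by simpa only [hL] using hsymmL P Q) k
  exact ⟨m, e, c, h1, fun r x _ => by rw [hL, h2, MvPolynomial.smul_eval]⟩

/-- The entries are linear in the real coordinates, so that only the drift acts on them. -/
lemma diffusionOp_entry (g : (Idx n d → ℝ) → Matrix (Idx n d) (Idx n d) ℝ)
    (b : (Idx n d → ℝ) → Idx n d → ℝ) (γ : Idx n d) (x : Idx n d → ℝ) :
    diffusionOp g b (entry γ) x = ∑ α, entryCoeff γ α * (b x α : ℂ) := by
  have h : ∀ α, pd α (entry γ) = fun _ => entryCoeff γ α := fun α => funext fun y => pd_entry γ α y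
  simp only [diffusionOp, h, pd_const, smul_zero, Finset.sum_const_zero, zero_add]
  exact Finset.sum_congr rfl fun α _ => by rw [Complex.real_smul, mul_comm]

end Model

end

theorem theorem4p3 (n d : ℕ) (hn : 1 ≤ n) (hd : 1 ≤ d)
    (A : Matrix (Fin d) (Fin d) ℂ) (hA : A.PosDef)
    (B : Matrix (Fin d × Fin d) (Fin d × Fin d) ℂ) (hB : B.PosDef)
    (hsymm : ∀ (x : Idx n d → ℝ) (α β : Idx n d),
      gammaAB A B (Zmat x) α β = gammaAB A B (Zmat x) β α)
    (a : Fin (n + 1) → ℝ) (ha : ∀ r, 0 < a r) :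
    (∀ (x : Idx n d → ℝ) (p q : Fin n) (i j k l : Fin d),
      carreDuChamp (cometricAB A B) (fun y => Zmat y p i j) (fun y => Zmat y q k l) x
          = gammaAB A B (Zmat x) (p, i, j) (q, k, l) ∧
      gammaAB A B (Zmat x) (p, i, j) (q, k, l)
          = ∑ r, ∑ s, ∑ a', ∑ b', ∑ c', ∑ d',
              tensorAB A B p q i j k l r s a' b' c' d' * Zfull x r a' b' * Zfull x s c' d') ∧
    (∀ x ∈ interior (matrixSimplex n d), (cometricAB A B x).PosDef) ∧
    IsPolynomialModel (interior (matrixSimplex n d)) (cometricAB A B) (dirichletMeasure n d a) ∧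
    ∀ b : (Idx n d → ℝ) → Idx n d → ℝ,
      IsGenerator (interior (matrixSimplex n d)) (cometricAB A B) (dirichletMeasure n d a) b →
      ∀ x ∈ interior (matrixSimplex n d), ∀ (p : Fin n) (i j : Fin d),
        diffusionOp (cometricAB A B) b (fun y => Zmat y p i j) x
          = generatorAB A B a (Zmat x) p i j := by
  have hmodel := isPolynomialModel_matrixSimplex hn hA hB hsymm ha
  refine ⟨fun x p q i j k l => ⟨carreDuChamp_entry hA.isHermitian hB.isHermitian hsymm x
    (p, i, j) (q, k, l), gammaAB_eq_tensorAB x p q i j k l⟩, hmodel.elliptic, hmodel, fun b hb x hx p i j => ?_⟩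
  have := isProbabilityMeasure_dirichletMeasure (d := d) hn ha
  have hbx : b x = driftAB A B a x :=
    eq_of_isGenerator isOpen_interior isCompact_closure_interior_matrixSimplex
      (contDiffOn_dirichletDensity hn a).continuousOn (fun x hx => dirichletDensity_pos hn ha hx)
      (dirichletMeasure_eq_withDensity hn ha)
      (fun α β => (contDiff_cometricAB α β (k := 0)).continuous.continuousOn) hb
      (isGenerator_driftAB hn hA.isHermitian hB.isHermitian hsymm ha) hx
  have h := diffusionOp_entry (cometricAB A B) b (p, i, j) x
  rw [hbx, sum_entryCoeff_driftAB hA.isHermitian hB.isHermitian hsymm] at h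
  exact h
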